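/- Let $s\ge 0$ and let $S_0$ be a positive definite real symmetric $s\times s$ matrix (for instance the Gram matrix of a positive definite even unimodular lattice $K$ of rank $s$). Put $\Pi=\begin{pmatrix}0&-1\\-1&0\end{pmatrix}$ and let $M_{\mathbb R}=\mathbb R^2\oplus\mathbb R^s\oplus\mathbb R^2$ carry the symmetric bilinear form $(\,,\,)_M$, of signature $(s+2,2)$, with Gram matrix $$Q_M=\begin{pmatrix}0&0&\Pi\\0&S_0&0\\\Pi&0&0\end{pmatrix}.$$ Let $D$ be the space of oriented two-dimensional subspaces $z\subset M_{\mathbb R}$ on which $(\,,\,)_M$ is negative definite, with the quotient topology from the space of bases of such planes. Then: (1) $D$ is nonempty and has exactly two connected components, both open; for every $z_0\in D$ they are the component $D^0$ containing $z_0$ and the component containing $z_0$ with the opposite orientation. (2) For every $z_0\in D$, the component $D^0$ of $z_0$ has the structure of a complex manifold of dimension $s+2$ with a smooth Hermitian metric $g$ (a Riemannian metric invariant under the complex structure $J$) such that the orthogonal projection onto $z$ depends smoothly on $z\in D^0$ and, for every $z\in D^0$ and every positively oriented basis $(e_1,e_2)$ of $z$ with $(e_i,e_j)_M=-\delta_{ij}$,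 if a tangent vector at $z$, viewed as an element of $\mathrm{Hom}(z,z^\perp)$, is written as the pair $(x,y)$ of the images of $e_1,e_2$, then $$J(x,y)=(-y,x),\qquad g\big((x,y),(x',y')\big)=2(s+2)\big((x,x')_M+(y,y')_M\big).$$ With this structure $D^0$ is a Hermitian symmetric space (connected, and each point is an isolated fixed point of an involutive holomorphic isometry), and it is of noncompact type: there is a connected semisimple closed linear Lie group $G$ acting on $D^0$ continuously, transitively and with finite kernel by holomorphic isometries such that, for every $o\in D^0$, the Lie algebra of the stabilizer of $o$ is the $(+1)$-eigenspace of an involutive automorphism $\theta$ of the Lie algebra of $G$, the Killing form being negative definite on the $(+1)$-eigenspace and positive definite on the $(-1)$-eigenspace of $\theta$. (3) For every $z_0\in D$, the component $D^0$ of $z_0$, with this complex structure, is biholomorphic to a bounded symmetric domain in $\mathbb C^{s+2}$ (a bounded, connected, nonempty open set each point of which is an isolated fixed point of an involutive holomorphic automorphism). Hence $D$ is the disjoint union of two bounded symmetric domains in $\mathbb C^{s+2}$. -/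

import Mathlib

open Module Matrix Topology
open scoped Manifold ContDiff

noncomputable section

/-! ## Hermitian symmetric spaces of noncompact type and bounded symmetric domains -/

/-- Complex `n`-space with its Euclidean norm. -/
abbrev Cn (n : ℕ) : Type := EuclideanSpace ℂ (Fin n)

/-- A complex manifold modelled on `ℂⁿ` is in particular a real manifold, with the same charts. -/
instance realManifold {n : ℕ} {M : Type} [TopologicalSpace M] [ChartedSpace (Cn n) M]
    [IsManifold 𝓘(ℂ, Cn n) ω M] : IsManifold 𝓘(ℝ, Cn n) ω M := by
  refine isManifold_of_contDiffOn 𝓘(ℝ, Cn n) ω M fun e e' he he' => ?_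
  have h := (StructureGroupoid.compatible (contDiffGroupoid ω 𝓘(ℂ, Cn n)) he he').1
  exact h.restrict_scalars ℝ

/-- The almost complex structure (multiplication by `i`) on the tangent space of a complex manifold,
seen as an operation on the tangent space of the underlying real manifold. -/
def tangentJ {n : ℕ} {M : Type} [TopologicalSpace M] [ChartedSpace (Cn n) M] (x : M)
    (ξ : TangentSpace 𝓘(ℝ, Cn n) x) : TangentSpace 𝓘(ℝ, Cn n) x :=
  (Complex.I • (show Cn n from ξ) : Cn n)

/-- A Hermitian structure on a complex manifold: a smooth Riemannian metric on the underlying real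
manifold for which multiplication by `i` is isometric. -/
structure HermitianMetric (n : ℕ) (M : Type) [TopologicalSpace M] [ChartedSpace (Cn n) M]
    [IsManifold 𝓘(ℂ, Cn n) ω M] where
  /-- the underlying Riemannian metric -/
  riem : Bundle.ContMDiffRiemannianMetric 𝓘(ℝ, Cn n) ∞ (Cn n)
    (fun x : M => TangentSpace 𝓘(ℝ, Cn n) x)
  hermitian : ∀ (x : M) (ξ η : TangentSpace 𝓘(ℝ, Cn n) x),
    riem.inner x (tangentJ x ξ) (tangentJ x η) = riem.inner x ξ η

section Hermitian

attribute [local instance] LieRing.ofAssociativeRing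

variable {n : ℕ} {M : Type} [TopologicalSpace M] [ChartedSpace (Cn n) M]
  [IsManifold 𝓘(ℂ, Cn n) ω M]

/-- Holomorphic isometries of `M` onto itself. -/
structure IsHolomorphicIsometry (g : HermitianMetric n M) (φ : M ≃ M) : Prop where
  holomorphic : MDifferentiable 𝓘(ℂ, Cn n) 𝓘(ℂ, Cn n) φ
  holomorphic_symm : MDifferentiable 𝓘(ℂ, Cn n) 𝓘(ℂ, Cn n) φ.symm
  isometry : ∀ (x : M) (ξ η : TangentSpace 𝓘(ℝ, Cn n) x),
    g.riem.inner (φ x) (mfderiv 𝓘(ℝ, Cn n) 𝓘(ℝ, Cn n) φ x ξ)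
      (mfderiv 𝓘(ℝ, Cn n) 𝓘(ℝ, Cn n) φ x η) = g.riem.inner x ξ η

/-- `(M, g)` is a Hermitian symmetric space: a connected (Hausdorff, second countable) complex
manifold with a Hermitian structure, each point of which is an isolated fixed point of an
involutive holomorphic isometry. -/
structure IsHermitianSymmetricSpace (g : HermitianMetric n M) : Prop where
  t2 : T2Space M
  secondCountable : SecondCountableTopology M
  connected : ConnectedSpace M
  symmetry : ∀ p : M, ∃ φ : M ≃ M, IsHolomorphicIsometry g φ ∧ (∀ q, φ (φ q) = q) ∧
    φ p = p ∧ ∀ᶠ q in 𝓝[≠] p, φ q ≠ q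

/-- `𝔤` is the Lie algebra of the matrix group `G`. -/
def IsLieAlgebraOf {ι : Type} [Fintype ι] [DecidableEq ι] (G : Subgroup (GL ι ℝ))
    (𝔤 : LieSubalgebra ℝ (Matrix ι ι ℝ)) : Prop :=
  ∀ X : Matrix ι ι ℝ, X ∈ 𝔤 ↔
    ∀ t : ℝ, ∃ a : G, ((a : GL ι ℝ) : Matrix ι ι ℝ) = NormedSpace.exp (t • X)

/-- A Hermitian symmetric space is of noncompact type if it is a homogeneous space `G / K` of
a connected semisimple (closed linear) Lie group `G` acting on it continuously, transitively and
with finite kernel by holomorphic isometries, such that for every point `o`, with stabilizer `K`,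
there is a Cartan involution `θ` of the Lie algebra `𝔤` of `G` with `+1`-eigenspace the Lie
algebra of `K`: the Killing form is negative definite on the `+1`-eigenspace and positive definite
on the `-1`-eigenspace of `θ`. (Allowing only linear
`G` loses nothing: the identity component of the isometry group of such a space is the adjoint group
of its Lie algebra.) -/
def IsOfNoncompactType (g : HermitianMetric n M) : Prop :=
  ∃ (ι : Type) (_ : Fintype ι) (_ : DecidableEq ι) (G : Subgroup (GL ι ℝ))
    (𝔤 : LieSubalgebra ℝ (Matrix ι ι ℝ)) (ρ : G →* Equiv.Perm M),
    IsClosed (G : Set (GL ι ℝ)) ∧ IsConnected (G : Set (GL ι ℝ)) ∧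
    IsLieAlgebraOf G 𝔤 ∧ LieAlgebra.IsSemisimple ℝ 𝔤 ∧
    Continuous (fun p : G × M => ρ p.1 p.2) ∧
    (∀ a : G, IsHolomorphicIsometry g (ρ a)) ∧
    (∀ x y : M, ∃ a : G, ρ a x = y) ∧
    Finite ρ.ker ∧
    ∀ o : M, ∃ θ : 𝔤 ≃ₗ⁅ℝ⁆ 𝔤, (∀ X, θ (θ X) = X) ∧
      (∀ X : 𝔤, θ X = X ↔ ∀ t : ℝ, ∃ a : G,
        ((a : GL ι ℝ) : Matrix ι ι ℝ) = NormedSpace.exp (t • (X : Matrix ι ι ℝ)) ∧ ρ a o = o) ∧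
      (∀ X : 𝔤, θ X = X → X ≠ 0 → killingForm ℝ 𝔤 X X < 0) ∧
      (∀ X : 𝔤, θ X = -X → X ≠ 0 → 0 < killingForm ℝ 𝔤 X X)

end Hermitian

/-- Bounded symmetric domains in `ℂⁿ`: bounded connected open sets each point of which is an
isolated fixed point of an involutive holomorphic automorphism. -/
structure IsBoundedSymmetricDomain {n : ℕ} (U : Set (Cn n)) : Prop where
  isOpen : IsOpen U
  isConnected : IsConnected U
  isBounded : Bornology.IsBounded U
  symmetry : ∀ p ∈ U, ∃ σ : Cn n → Cn n, Set.MapsTo σ U U ∧ DifferentiableOn ℂ σ U ∧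
    (∀ x ∈ U, σ (σ x) = x) ∧ σ p = p ∧ ∀ᶠ q in 𝓝[≠] p, σ q ≠ q

/-- `M` is biholomorphic to the (open) subset `U` of `ℂⁿ`. -/
def IsBiholomorphicTo {n : ℕ} (M : Type) [TopologicalSpace M] [ChartedSpace (Cn n) M]
    (U : Set (Cn n)) : Prop :=
  ∃ (φ : M → Cn n) (ψ : Cn n → M), MDifferentiable 𝓘(ℂ, Cn n) 𝓘(ℂ, Cn n) φ ∧
    MDifferentiableOn 𝓘(ℂ, Cn n) 𝓘(ℂ, Cn n) ψ U ∧
    (∀ z, φ z ∈ U) ∧ (∀ z, ψ (φ z) = z) ∧ ∀ w ∈ U, φ (ψ w) = w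

/-! ## The quadratic space `M_ℝ` and the space of oriented negative planes -/

/-- The Gram matrix of the hyperbolic plane `Π_{1,1}`. -/
def hyperbolicGram : Matrix (Fin 2) (Fin 2) ℝ := !![0, -1; -1, 0]

/-- Index set of the coordinates of `M_ℝ = ℝ² ⊕ ℝˢ ⊕ ℝ²`. -/
abbrev MIdx (s : ℕ) : Type := Fin 2 ⊕ Fin s ⊕ Fin 2

/-- The real vector space `M_ℝ`, of dimension `s + 4`. -/
abbrev MR (s : ℕ) : Type := MIdx s → ℝ

/-- The block matrix `Q_M` with rows `(0, 0, Π)`, `(0, S₀, 0)`, `(Π, 0, 0)`. -/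
def gramM {s : ℕ} (S₀ : Matrix (Fin s) (Fin s) ℝ) : Matrix (MIdx s) (MIdx s) ℝ :=
  Matrix.fromBlocks 0 (Matrix.fromCols 0 hyperbolicGram) (Matrix.fromRows 0 hyperbolicGram)
    (Matrix.fromBlocks S₀ 0 0 0)

/-- The bilinear form `(x, y)_M = ᵗx Q_M y`. -/
def formM {s : ℕ} (S₀ : Matrix (Fin s) (Fin s) ℝ) : LinearMap.BilinForm ℝ (MR s) :=
  Matrix.toBilin' (gramM S₀)

theorem formM_isSymm {s : ℕ} {S₀ : Matrix (Fin s) (Fin s) ℝ} (hS₀ : S₀.PosDef) :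
    (formM S₀).IsSymm := by
  have hS : S₀ᵀ = S₀ := by
    rw [← Matrix.conjTranspose_eq_transpose_of_trivial]; exact hS₀.isHermitian.eq
  have hP : hyperbolicGramᵀ = hyperbolicGram := by
    ext i j; fin_cases i <;> fin_cases j <;> simp [hyperbolicGram]
  rw [formM, Matrix.isSymm_toBilin'_iff_isSymm, Matrix.IsSymm, gramM]
  simp [Matrix.fromBlocks_transpose, Matrix.transpose_fromRows, Matrix.transpose_fromCols, hS, hP]

/-- The space `D` of oriented negative two dimensional planes in `M_ℝ`. -/
structure OrientedNegPlane {s : ℕ} (S₀ : Matrix (Fin s) (Fin s) ℝ) where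
  /-- the plane -/
  plane : Submodule ℝ (MR s)
  finrank_eq : finrank ℝ plane = 2
  /-- its orientation -/
  orientation : Orientation ℝ plane (Fin 2)
  neg : ∀ v ∈ plane, v ≠ 0 → formM S₀ v v < 0

/-- Pairs of linearly independent vectors spanning a negative plane. -/
structure NegFrame {s : ℕ} (S₀ : Matrix (Fin s) (Fin s) ℝ) where
  /-- the two vectors -/
  vec : Fin 2 → MR s
  linInd : LinearIndependent ℝ vec
  neg : ∀ v ∈ Submodule.span ℝ (Set.range vec), v ≠ 0 → formM S₀ v v < 0

namespace NegFrame

variable {s : ℕ} {S₀ : Matrix (Fin s) (Fin s) ℝ}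

/-- Frames carry the topology of a subspace of `M_ℝ × M_ℝ`. -/
instance : TopologicalSpace (NegFrame S₀) := TopologicalSpace.induced NegFrame.vec inferInstance

/-- The plane spanned by a frame, oriented by the frame. -/
def toPlane (p : NegFrame S₀) : OrientedNegPlane S₀ where
  plane := Submodule.span ℝ (Set.range p.vec)
  finrank_eq := by simpa using finrank_span_eq_card p.linInd
  orientation := (Basis.span p.linInd).orientation
  neg := p.neg

/-- `(e₁, e₂)` is orthonormal with respect to `-(,)_M`. -/
def IsOrthonormal (p : NegFrame S₀) : Prop :=
  formM S₀ (p.vec 0) (p.vec 0) = -1 ∧ formM S₀ (p.vec 1) (p.vec 1) = -1 ∧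
    formM S₀ (p.vec 0) (p.vec 1) = 0

end NegFrame

namespace OrientedNegPlane

variable {s : ℕ} {S₀ : Matrix (Fin s) (Fin s) ℝ}

/-- `D` has the quotient topology from the space of frames. -/
instance : TopologicalSpace (OrientedNegPlane S₀) :=
  TopologicalSpace.coinduced NegFrame.toPlane inferInstance

/-- The same plane with the opposite orientation. -/
def opposite (z : OrientedNegPlane S₀) : OrientedNegPlane S₀ where
  plane := z.plane
  finrank_eq := z.finrank_eq
  orientation := -z.orientation
  neg := z.neg

theorem isCompl_orthogonal (hS₀ : S₀.PosDef) (z : OrientedNegPlane S₀) :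
    IsCompl z.plane ((formM S₀).orthogonal z.plane) := by
  rw [LinearMap.BilinForm.isCompl_orthogonal_iff_disjoint (formM_isSymm hS₀).isRefl,
    Submodule.disjoint_def]
  intro x hx hx'
  by_contra h
  exact (z.neg x hx h).ne (hx' x hx)

/-- The orthogonal projection of `M_ℝ = z ⊕ z^⊥` onto `z`. -/
def proj (hS₀ : S₀.PosDef) (z : OrientedNegPlane S₀) : MR s →L[ℝ] MR s :=
  LinearMap.toContinuousLinearMap
    (z.plane.projection ((formM S₀).orthogonal z.plane) (z.isCompl_orthogonal hS₀))

end OrientedNegPlane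

/-- The connected component `D⁰` of `D` that contains `z₀`. -/
abbrev DComponent {s : ℕ} {S₀ : Matrix (Fin s) (Fin s) ℝ} (z₀ : OrientedNegPlane S₀) : Type :=
  connectedComponent z₀

section Component

variable {s : ℕ} {S₀ : Matrix (Fin s) (Fin s) ℝ} {z₀ : OrientedNegPlane S₀}
  [ChartedSpace (Cn (s + 2)) (DComponent z₀)]

/-- The derivative at `z`, in the direction of the tangent vector `ξ`, of the family of orthogonal
projections onto the planes. Its restriction to the plane `z` is the linear map `z → z^⊥` that
corresponds to `ξ` under `T_z D = Hom(z, z^⊥)`: if `z_t` is a curve through `z` with velocity `ξ`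
and `v_t ∈ z_t` has `v_0 = v`, it is the map that sends `v` to the `z^⊥`-component of `v_0'`. -/
def dProj (hS₀ : S₀.PosDef) (z : DComponent z₀) (ξ : TangentSpace 𝓘(ℝ, Cn (s + 2)) z) :
    MR s →L[ℝ] MR s :=
  mfderiv 𝓘(ℝ, Cn (s + 2)) 𝓘(ℝ, MR s →L[ℝ] MR s)
    (fun z : DComponent z₀ => (z : OrientedNegPlane S₀).proj hS₀) z ξ

/-- The complex structure and the metric on `D⁰` are the ones coming from `J₀` and `g₀`.
For a positively oriented orthonormal basis `(e₁, e₂)` of `z` identify the tangent space of `D⁰` at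
`z` with the pairs `(x, y)` of vectors of `z^⊥`, where `x`, `y` are the images of `e₁`, `e₂`
under the map `z → z^⊥`. Then `J (x, y) = (-y, x)` and
`g ((x, y), (x', y')) = 2 (s + 2) ((x, x')_M + (y, y')_M)`. The differentiable structure is the one
for which the plane `z`, equivalently the orthogonal projection onto `z`, depends smoothly
on `z`. -/
structure IsCanonicalStructure [IsManifold 𝓘(ℂ, Cn (s + 2)) ω (DComponent z₀)]
    (hS₀ : S₀.PosDef) (g : HermitianMetric (s + 2) (DComponent z₀)) : Prop where
  smooth : ContMDiff 𝓘(ℝ, Cn (s + 2)) 𝓘(ℝ, MR s →L[ℝ] MR s) ∞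
    (fun z : DComponent z₀ => (z : OrientedNegPlane S₀).proj hS₀)
  complexStructure : ∀ (z : DComponent z₀) (e : NegFrame S₀), e.toPlane = z → e.IsOrthonormal →
    ∀ ξ : TangentSpace 𝓘(ℝ, Cn (s + 2)) z,
      dProj hS₀ z (tangentJ z ξ) (e.vec 0) = -dProj hS₀ z ξ (e.vec 1) ∧
      dProj hS₀ z (tangentJ z ξ) (e.vec 1) = dProj hS₀ z ξ (e.vec 0)
  metric : ∀ (z : DComponent z₀) (e : NegFrame S₀), e.toPlane = z → e.IsOrthonormal →
    ∀ ξ η : TangentSpace 𝓘(ℝ, Cn (s + 2)) z,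
      g.riem.inner z ξ η = 2 * ((s : ℝ) + 2) *
        (formM S₀ (dProj hS₀ z ξ (e.vec 0)) (dProj hS₀ z η (e.vec 0)) +
          formM S₀ (dProj hS₀ z ξ (e.vec 1)) (dProj hS₀ z η (e.vec 1)))

end Component

end

/-!
The space `D` is identified with two copies of a Lie ball, by writing an oriented negative plane
as a complex isotropic line.

Let `z₀` be an oriented negative plane. An orthonormal basis of `z₀^⊥`, followed by an
orthonormal basis of `z₀` for the negative of the form, is an *adapted basis* `β`
(`exists_adaptedBasis`): in its coordinates the form is `x₁² + ⋯ + xₙ² - y₁² - y₂²` with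
`n = s + 2`. If `(p, q)` is an oriented basis of a negative plane with `p ⟂ q` and
`(p, p) = (q, q)`, then `v = p + iq` satisfies `(v, v) = 0` and `(v, v̄) < 0`, and the oriented
plane determines `v` up to a nonzero complex factor (`AdaptedBasis.planeOf_eq_iff`). For such `v`
the quantities `a = y₁ + i y₂` and `b = y₁ - i y₂` satisfy `|a| ≠ |b|`, so the sign of
`|b|² - |a|²` (`side`) cuts `D` into two open and closed halves, which a change of orientation
interchanges. On the half `|a| < |b|` one may normalize `b = 1`, and then
`v = isoVec w = (w, (1 + w·w) / 2, i (1 - w·w) / 2)` with `w` in the Lie ball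
`2 |w|² < 1 + |w·w|²`, `|w·w| < 1`. The Lie ball is bounded and star-shaped about the origin,
hence connected, so each half is a component (`components_orientedNegPlane`), and `w` is a global
chart on the component of `z₀` (`AdaptedBasis.isOpenEmbedding_chart`). The chart gives the
complex structure, and makes the last claim, on bounded domains, immediate once the symmetries
are known.

The orthogonal projection `P` onto the plane is an explicit smooth function of `w`.
Differentiating `P p = p` gives `P' p = (1 - P) p'`, and as `w ↦ v` is holomorphic, `p' + i q'`
is complex linear in the tangent vector; this is the formula for `J`
(`AdaptedBasis.projDeriv_complexStructure`). The metric is defined by the required formula with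
the frame `(p, q)` divided by its length. It is independent of the frame
(`AdaptedBasis.metric_eq`) because two positively oriented orthonormal frames differ by a
rotation.

The subgroup of `O(n, 2)` that preserves the sign of `side` acts on the Lie ball by fractional
transformations `ballMap`. Since the projections are equivariant, so are their derivatives, and
the action is by holomorphic isometries (`AdaptedBasis.metric_ballMap`). The matrix `diag(1, -1)`
acts by `w ↦ -w`. The identity component of `O(n, 2)` is transitive: products of two reflections
map one negative unit vector to another and are connected to the identity by a path
(`exists_transvection`), and two of them move the standard negative frame to any given plane
(`exists_ballMap_zero_eq`). Conjugates of `w ↦ -w` are therefore symmetries at all points. Only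
`±1` act trivially.

For the Killing form, let `⟨X, Y⟩ = tr(Xᵀ Y)` on the Lie algebra `so(n, 2)`. The adjoint of
`ad X` is `ad Xᵀ`, so the Killing form of `X` and `Xᵀ` is the squared Hilbert–Schmidt norm of
`ad Xᵀ`, positive for `X ≠ 0` because the centre is trivial (`killingForm_soTranspose_pos`).
Hence the Killing form is nondegenerate, and `X ↦ -Xᵀ`, which is conjugation by `diag(1, -1)`, is
a Cartan involution; its fixed points are the Lie algebra of the stabilizer of the origin
(`isCartanAt_ballCenter`).
-/

noncomputable section

/-! ### Manifolds with a single chart -/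

section SingleChart

variable {𝕜 : Type*} [NontriviallyNormedField 𝕜] {E : Type*} [NormedAddCommGroup E]
  [NormedSpace 𝕜 E] {M : Type*} [TopologicalSpace M] [Nonempty M] {φ : M → E}

theorem extChartAt_singleton (hφ : IsOpenEmbedding φ) (z : M) :
    letI := hφ.singletonChartedSpace
    (extChartAt 𝓘(𝕜, E) z : M → E) = φ := by
  simp

theorem extChartAt_singleton_symm (hφ : IsOpenEmbedding φ) (z y : M) :
    letI := hφ.singletonChartedSpace
    (extChartAt 𝓘(𝕜, E) z).symm (φ y) = y := by
  let _ := hφ.singletonChartedSpace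
  exact (congrArg (extChartAt 𝓘(𝕜, E) z).symm
    (congrFun (extChartAt_singleton (𝕜 := 𝕜) hφ z) y).symm).trans
    ((extChartAt 𝓘(𝕜, E) z).left_inv (by simp [extChartAt]))

theorem hasMFDerivAt_vector (hφ : IsOpenEmbedding φ) {F : Type*} [NormedAddCommGroup F]
    [NormedSpace 𝕜 F] {f : M → F} {f₀ : E → F} {f' : E →L[𝕜] F} {z : M}
    (h : ∀ z, f z = f₀ (φ z)) (hf : HasFDerivAt f₀ f' (φ z)) :
    letI := hφ.singletonChartedSpace
    HasMFDerivAt 𝓘(𝕜, E) 𝓘(𝕜, F) f z f' := by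
  let _ := hφ.singletonChartedSpace
  have hc := extChartAt_singleton (𝕜 := 𝕜) hφ
  refine ⟨?_, ?_⟩
  · rw [show f = f₀ ∘ φ from funext h]
    exact hf.continuousAt.comp hφ.continuous.continuousAt
  · rw [congrFun (hc z) z]
    refine (hf.congr_of_eventuallyEq ?_).hasFDerivWithinAt
    filter_upwards [hφ.isOpen_range.mem_nhds ⟨z, rfl⟩] with w hw
    obtain ⟨y, rfl⟩ := hw
    simp only [writtenInExtChartAt, extChartAt_model_space_eq_id, Function.comp,
      extChartAt_singleton_symm hφ z y, h]
    rfl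

theorem hasMFDerivAt_self (hφ : IsOpenEmbedding φ) {f : M → M} (hfc : Continuous f) {f₀ : E → E}
    {f' : E →L[𝕜] E} {z : M} (h : ∀ z, φ (f z) = f₀ (φ z)) (hf : HasFDerivAt f₀ f' (φ z)) :
    letI := hφ.singletonChartedSpace
    HasMFDerivAt 𝓘(𝕜, E) 𝓘(𝕜, E) f z f' := by
  let _ := hφ.singletonChartedSpace
  have hc := extChartAt_singleton (𝕜 := 𝕜) hφ
  refine ⟨hfc.continuousAt, ?_⟩
  rw [congrFun (hc z) z]
  refine (hf.congr_of_eventuallyEq ?_).hasFDerivWithinAt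
  filter_upwards [hφ.isOpen_range.mem_nhds ⟨z, rfl⟩] with w hw
  obtain ⟨y, rfl⟩ := hw
  simp only [writtenInExtChartAt, Function.comp, extChartAt_singleton_symm hφ z y, hc, h]

/-- A right inverse of the chart on its range is differentiable there. -/
theorem mdifferentiableOn_chart_symm (hφ : IsOpenEmbedding φ) {ψ : E → M}
    (h : ∀ z, ψ (φ z) = z) :
    letI := hφ.singletonChartedSpace
    MDifferentiableOn 𝓘(𝕜, E) 𝓘(𝕜, E) ψ (Set.range φ) := by
  let _ := hφ.singletonChartedSpace
  have h1 := contMDiffOn_isOpenEmbedding_symm (n := 1) (I := 𝓘(𝕜, E)) hφ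
  refine (h1.mdifferentiableOn one_ne_zero).congr ?_
  rintro _ ⟨z, rfl⟩
  rw [h]
  exact ((hφ.toOpenPartialHomeomorph φ).left_inv (Set.mem_univ z)).symm

theorem contMDiff_vector (hφ : IsOpenEmbedding φ) {F : Type*} [NormedAddCommGroup F]
    [NormedSpace 𝕜 F] {f : M → F} {f₀ : E → F} {n : WithTop ℕ∞}
    (h : ∀ z, f z = f₀ (φ z)) (hf : ContDiffOn 𝕜 n f₀ (Set.range φ)) :
    letI := hφ.singletonChartedSpace
    ContMDiff 𝓘(𝕜, E) 𝓘(𝕜, F) n f := by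
  let _ := hφ.singletonChartedSpace
  have h1 : ContMDiff 𝓘(𝕜, E) 𝓘(𝕜, E) n φ := contMDiff_isOpenEmbedding hφ
  rw [show f = f₀ ∘ φ from funext h]
  exact hf.contMDiffOn.comp_contMDiff h1 (fun x => ⟨x, rfl⟩)

end SingleChart

/-- In a single chart the tangent bundle is trivialized by the identity maps, so a field of bilinear
forms on the tangent spaces is smooth as soon as its expression in the chart is. -/
theorem contMDiff_bilinear {n : ℕ} {M : Type} [TopologicalSpace M] [Nonempty M] {φ : M → Cn n}
    (hφ : IsOpenEmbedding φ) (b : Cn n → Cn n →L[ℝ] Cn n →L[ℝ] ℝ)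
    (hb : ContDiffOn ℝ ∞ b (Set.range φ)) :
    letI := hφ.singletonChartedSpace
    letI : IsManifold 𝓘(ℂ, Cn n) ω M := hφ.isManifold_singleton
    ∀ B : ∀ z : M, TangentSpace 𝓘(ℝ, Cn n) z →L[ℝ] TangentSpace 𝓘(ℝ, Cn n) z →L[ℝ] ℝ,
    (∀ z v w, B z v w = b (φ z) v w) →
    ContMDiff 𝓘(ℝ, Cn n) (𝓘(ℝ, Cn n).prod 𝓘(ℝ, Cn n →L[ℝ] Cn n →L[ℝ] ℝ)) ∞
    (fun z : M ↦ Bundle.TotalSpace.mk' (Cn n →L[ℝ] Cn n →L[ℝ] ℝ) z (B z)) := by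
  let _ := hφ.singletonChartedSpace
  have : IsManifold 𝓘(ℂ, Cn n) ω M := hφ.isManifold_singleton
  intro B hB
  have h1 := contMDiff_vector (𝕜 := ℝ) hφ (f := fun z => b (φ z)) (fun z => rfl) hb
  intro z
  rw [Bundle.contMDiffAt_section]
  convert h1 z using 2 with y
  ext v w
  have hy : y ∈ (trivializationAt (Cn n) (TangentSpace 𝓘(ℝ, Cn n)) z).baseSet := by
    rw [TangentBundle.trivializationAt_baseSet]
    exact mem_chart_source (Cn n) y
  have hs (v : Cn n) : (trivializationAt (Cn n) (TangentSpace 𝓘(ℝ, Cn n)) z).symm y v = v := by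
    have h2 := TangentBundle.symmL_trivializationAt_eq_core (I := 𝓘(ℝ, Cn n)) (b₀ := z) (b := y)
      (mem_chart_source (Cn n) y)
    have h3 := (tangentBundleCore 𝓘(ℝ, Cn n) M).coordChange_self (achart (Cn n) y) y
      (mem_chart_source (Cn n) y) v
    have h4 := congrArg (fun L => L v) h2
    exact (Bundle.Trivialization.symmL_apply _ hy _).symm.trans (h4.trans h3)
  have h5 := inCoordinates_apply_eq₂ (𝕜 := ℝ) (E₃ := Bundle.Trivial M ℝ) (F₃ := ℝ) (ϕ := B y)
    (v := v) (w := w) hy hy (Set.mem_univ (α := M) y)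
  rw [hs, hs] at h5
  have h6 := hB y v w
  rw [← h6]
  refine Eq.trans ?_ (h5.trans ?_)
  · rfl
  · exact LinearMap.congr_fun (Bundle.Trivial.linearMapAt_trivialization ℝ M ℝ y) _

theorem isVonNBounded_of_posDef {E : Type*} [NormedAddCommGroup E] [NormedSpace ℝ E]
    [FiniteDimensional ℝ E] (b : E →L[ℝ] E →L[ℝ] ℝ) (hb : ∀ v, v ≠ 0 → 0 < b v v) :
    Bornology.IsVonNBounded ℝ {v : E | b v v < 1} := by
  have hproper : ProperSpace E := FiniteDimensional.proper ℝ E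
  have hcont : Continuous fun v : E => b v v := by fun_prop
  rw [NormedSpace.isVonNBounded_iff']
  rcases (Metric.sphere (0 : E) 1).eq_empty_or_nonempty with hs | hs
  · refine ⟨0, fun v _ => ?_⟩
    by_contra h
    have hv : ‖v‖ ≠ 0 := fun h0 => h h0.le
    have : ‖v‖⁻¹ • v ∈ Metric.sphere (0 : E) 1 := by simp [norm_smul, hv]
    simp [hs] at this
  · obtain ⟨u, hu, hmin⟩ := (isCompact_sphere (0 : E) 1).exists_isMinOn hs hcont.continuousOn
    have hu0 : u ≠ 0 := by rintro rfl; simp at hu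
    have hm := hb u hu0
    refine ⟨Real.sqrt (b u u)⁻¹, fun v hv => ?_⟩
    by_cases hv0 : v = 0
    · simp [hv0]
    have hn : ‖v‖ ≠ 0 := norm_ne_zero_iff.2 hv0
    have h1 : ‖v‖⁻¹ • v ∈ Metric.sphere (0 : E) 1 := by simp [norm_smul, hn]
    have h2 : b u u ≤ b (‖v‖⁻¹ • v) (‖v‖⁻¹ • v) := hmin h1
    simp only [map_smul, _root_.smul_apply, smul_eq_mul] at h2
    refine Real.le_sqrt_of_sq_le ?_
    rw [← one_div, le_div_iff₀ hm]
    have h3 : ‖v‖ ^ 2 * b u u ≤ b v v := by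
      calc ‖v‖ ^ 2 * b u u ≤ ‖v‖ ^ 2 * (‖v‖⁻¹ * (‖v‖⁻¹ * b v v)) := by gcongr
        _ = b v v := by field_simp
    exact h3.trans (le_of_lt hv)

/-! ### Frames of negative planes -/

section Frames

variable {s : ℕ} {S₀ : Matrix (Fin s) (Fin s) ℝ}

theorem mem_span_pair_range {V : Type*} [AddCommGroup V] [Module ℝ V] {f : Fin 2 → V} {v : V} :
    v ∈ Submodule.span ℝ (Set.range f) ↔ ∃ a b : ℝ, a • f 0 + b • f 1 = v := by
  rw [Submodule.mem_span_range_iff_exists_fun]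
  constructor
  · rintro ⟨c, hc⟩
    exact ⟨c 0, c 1, by rw [← hc, Fin.sum_univ_two]⟩
  · rintro ⟨a, b, h⟩
    exact ⟨![a, b], by rw [← h, Fin.sum_univ_two]; rfl⟩

theorem formM_comm (hS₀ : S₀.PosDef) (x y : MR s) : formM S₀ x y = formM S₀ y x :=
  (formM_isSymm hS₀).eq x y

/-- Two orthogonal negative vectors form a frame. -/
def NegFrame.ofOrtho (hS₀ : S₀.PosDef) (p q : MR s) (hp : formM S₀ p p < 0)
    (hq : formM S₀ q q < 0) (hpq : formM S₀ p q = 0) : NegFrame S₀ where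
  vec := ![p, q]
  linInd := by
    rw [LinearIndependent.pair_iff]
    intro a b h
    have hqp : formM S₀ q p = 0 := by rw [formM_comm hS₀, hpq]
    have h1 : formM S₀ p (a • p + b • q) = 0 := by rw [h]; simp
    have h2 : formM S₀ q (a • p + b • q) = 0 := by rw [h]; simp
    simp only [map_add, map_smul, smul_eq_mul, hpq, hqp, mul_zero, add_zero, zero_add] at h1 h2
    exact ⟨(mul_eq_zero.1 h1).resolve_right hp.ne, (mul_eq_zero.1 h2).resolve_right hq.ne⟩
  neg := by
    intro v hv hv0
    obtain ⟨a, b, rfl⟩ := mem_span_pair_range.1 hv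
    have hqp : formM S₀ q p = 0 := by rw [formM_comm hS₀, hpq]
    simp only [Matrix.cons_val_zero, Matrix.cons_val_one, map_add, map_smul, LinearMap.add_apply,
      LinearMap.smul_apply, smul_eq_mul, hpq, hqp, mul_zero, add_zero, zero_add] at hv0 ⊢
    rcases eq_or_ne a 0 with rfl | ha
    · have hb : b ≠ 0 := by rintro rfl; simp at hv0
      nlinarith [mul_self_pos.2 hb]
    · nlinarith [mul_self_pos.2 ha, mul_self_nonneg b]

/-- A frame as a basis of the plane it spans. -/
def NegFrame.planeBasis (F : NegFrame S₀) : Basis (Fin 2) ℝ F.toPlane.plane :=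
  Basis.span F.linInd

theorem NegFrame.coe_planeBasis (F : NegFrame S₀) (i : Fin 2) :
    (F.planeBasis i : MR s) = F.vec i :=
  congrArg Subtype.val (Basis.span_apply F.linInd i)

theorem NegFrame.orientation_planeBasis (F : NegFrame S₀) :
    F.planeBasis.orientation = F.toPlane.orientation := rfl

theorem OrientedNegPlane.toPlane_eq_iff (z : OrientedNegPlane S₀) (F : NegFrame S₀) :
    F.toPlane = z ↔ ∃ b : Basis (Fin 2) ℝ z.plane, b.orientation = z.orientation ∧
      ∀ i, (b i : MR s) = F.vec i := by
  constructor
  · rintro rfl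
    exact ⟨F.planeBasis, rfl, F.coe_planeBasis⟩
  · rintro ⟨b, hb, hF⟩
    obtain ⟨W, hW, o, hn⟩ := z
    have hspan : W = Submodule.span ℝ (Set.range F.vec) := by
      have h1 := congrArg (Submodule.map W.subtype) b.span_eq
      rw [Submodule.map_span, Submodule.map_top, Submodule.range_subtype, ← Set.range_comp] at h1
      rw [← h1]
      congr 2
      exact funext hF
    subst hspan
    have : b = Basis.span F.linInd := by
      ext i : 1
      apply Subtype.ext
      rw [Basis.span_apply F.linInd]
      exact hF i
    subst this
    change (Basis.span F.linInd).orientation = o at hb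
    subst hb
    rfl

/-- The change of basis between two positively oriented frames of the same plane. -/
theorem NegFrame.toPlane_eq_toPlane_iff (F F' : NegFrame S₀) :
    F'.toPlane = F.toPlane ↔ ∃ a b c d : ℝ, 0 < a * d - b * c ∧
      F'.vec 0 = a • F.vec 0 + b • F.vec 1 ∧ F'.vec 1 = c • F.vec 0 + d • F.vec 1 := by
  have hsp := F.coe_planeBasis
  rw [OrientedNegPlane.toPlane_eq_iff]
  constructor
  · rintro ⟨b, hb, hF'⟩
    have hdet : 0 < F.planeBasis.det b :=
      (F.planeBasis.orientation_eq_iff_det_pos b).1 hb.symm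
    rw [Basis.det_apply, Matrix.det_fin_two] at hdet
    set B := F.planeBasis with hB
    have hrepr : ∀ i, F'.vec i = B.repr (b i) 0 • F.vec 0 + B.repr (b i) 1 • F.vec 1 := by
      intro i
      have h := congrArg (Subtype.val) (B.sum_repr (b i))
      rw [Fin.sum_univ_two] at h
      rw [← hF' i, ← h]
      simp [hsp]
    refine ⟨_, _, _, _, ?_, hrepr 0, hrepr 1⟩
    simp only [Basis.toMatrix_apply] at hdet
    linarith
  · rintro ⟨a, b, c, d, hdet, h0, h1⟩
    set B := F.planeBasis with hB
    have hmem : ∀ i, F'.vec i ∈ F.toPlane.plane := by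
      intro i
      refine mem_span_pair_range.2 ?_
      fin_cases i
      · exact ⟨a, b, h0.symm⟩
      · exact ⟨c, d, h1.symm⟩
    let f : Fin 2 → F.toPlane.plane := fun i => ⟨F'.vec i, hmem i⟩
    have hli : LinearIndependent ℝ f :=
      LinearIndependent.of_comp F.toPlane.plane.subtype F'.linInd
    let b' : Basis (Fin 2) ℝ F.toPlane.plane := basisOfLinearIndependentOfCardEqFinrank hli
      (by rw [F.toPlane.finrank_eq]; simp)
    have hb' : ⇑b' = f := coe_basisOfLinearIndependentOfCardEqFinrank _ _
    refine ⟨b', ?_, fun i => by rw [hb']⟩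
    rw [← F.orientation_planeBasis, eq_comm, Basis.orientation_eq_iff_det_pos, Basis.det_apply,
      Matrix.det_fin_two]
    have e0 : b' 0 = a • B 0 + b • B 1 := Subtype.ext (by
      rw [hb']
      simp only [Submodule.coe_add, Submodule.coe_smul, hsp]
      exact h0)
    have e1 : b' 1 = c • B 0 + d • B 1 := Subtype.ext (by
      rw [hb']
      simp only [Submodule.coe_add, Submodule.coe_smul, hsp]
      exact h1)
    rw [← hB]
    simp only [Basis.toMatrix_apply, e0, e1, map_add, map_smul, Basis.repr_self]
    simp
    linarith

theorem NegFrame.toPlane_surjective :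
    Function.Surjective (NegFrame.toPlane : NegFrame S₀ → OrientedNegPlane S₀) := by
  intro z
  have : Nonempty (Fin 2) := ⟨0⟩
  let b₀ : Basis (Fin 2) ℝ z.plane := finBasisOfFinrankEq ℝ z.plane z.finrank_eq
  let b := b₀.adjustToOrientation z.orientation
  have hli : LinearIndependent ℝ (fun i => (b i : MR s)) :=
    b.linearIndependent.map' z.plane.subtype (Submodule.ker_subtype _)
  have hmem : ∀ v ∈ Submodule.span ℝ (Set.range fun i => (b i : MR s)), v ∈ z.plane := by
    intro v hv
    refine Submodule.span_le.2 ?_ hv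
    rintro _ ⟨i, rfl⟩
    exact (b i).2
  refine ⟨⟨fun i => b i, hli, fun v hv => z.neg v (hmem v hv)⟩, ?_⟩
  rw [OrientedNegPlane.toPlane_eq_iff]
  exact ⟨b, b₀.orientation_adjustToOrientation z.orientation, fun i => rfl⟩

theorem NegFrame.isQuotientMap_toPlane :
    IsQuotientMap (NegFrame.toPlane : NegFrame S₀ → OrientedNegPlane S₀) :=
  ⟨⟨rfl⟩, NegFrame.toPlane_surjective⟩

theorem NegFrame.continuous_vec : Continuous (NegFrame.vec : NegFrame S₀ → Fin 2 → MR s) :=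
  continuous_induced_dom

theorem NegFrame.continuous_mk {X : Type*} [TopologicalSpace X] {f : X → NegFrame S₀}
    (h0 : Continuous fun x => (f x).vec 0) (h1 : Continuous fun x => (f x).vec 1) :
    Continuous f := by
  rw [continuous_induced_rng]
  refine continuous_pi fun i => ?_
  fin_cases i
  · exact h0
  · exact h1

end Frames

/-! ### Signature of the form and adapted bases -/

section Signature

variable {s : ℕ} {S₀ : Matrix (Fin s) (Fin s) ℝ}

theorem formM_apply (x y : MR s) : formM S₀ x y =
    -(x (.inl 0) * y (.inr (.inr 1)) + x (.inl 1) * y (.inr (.inr 0)) +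
      x (.inr (.inr 0)) * y (.inl 1) + x (.inr (.inr 1)) * y (.inl 0)) +
    (fun i => x (.inr (.inl i))) ⬝ᵥ S₀ *ᵥ (fun i => y (.inr (.inl i))) := by
  simp only [formM, Matrix.toBilin'_apply', gramM, dotProduct, Fintype.sum_sum_type, mulVec,
    Fin.sum_univ_two]
  simp [hyperbolicGram]
  ring

/-- The form is positive on the subspace `x₂ = -Π x₁` of codimension two. -/
theorem formM_pos_of_mem (hS₀ : S₀.PosDef) (x : MR s) (hx : x ≠ 0)
    (h0 : x (.inr (.inr 0)) = -x (.inl 1)) (h1 : x (.inr (.inr 1)) = -x (.inl 0)) :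
    0 < formM S₀ x x := by
  rw [formM_apply, h0, h1]
  set y : Fin s → ℝ := fun i => x (.inr (.inl i)) with hy
  have hnn : 0 ≤ y ⬝ᵥ S₀ *ᵥ y := by
    have := hS₀.posSemidef.dotProduct_mulVec_nonneg y
    simpa using this
  by_cases hy0 : y = 0
  · have : x (.inl 0) ≠ 0 ∨ x (.inl 1) ≠ 0 := by
      by_contra! h
      apply hx
      ext i
      rcases i with i | i | i
      · fin_cases i
        · exact h.1
        · exact h.2
      · exact congrFun hy0 i
      · fin_cases i
        · simp [h0, h.2]
        · simp [h1, h.1]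
    rcases this with h | h
    · nlinarith [mul_self_pos.2 h, mul_self_nonneg (x (.inl 1))]
    · nlinarith [mul_self_pos.2 h, mul_self_nonneg (x (.inl 0))]
  · have : 0 < y ⬝ᵥ S₀ *ᵥ y := by
      have := hS₀.dotProduct_mulVec_pos hy0
      simpa using this
    nlinarith [mul_self_nonneg (x (.inl 0)), mul_self_nonneg (x (.inl 1))]

/-- The orthogonal complement of a negative plane is positive: otherwise it would contain a vector
which together with the plane spans a nonpositive space of dimension three, which has to meet the
positive subspace of codimension two. -/
theorem formM_pos_of_orthogonal (hS₀ : S₀.PosDef) (z : OrientedNegPlane S₀) (x : MR s)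
    (hx : ∀ v ∈ z.plane, formM S₀ v x = 0) (hx0 : x ≠ 0) : 0 < formM S₀ x x := by
  by_contra! hneg
  let L : MR s →ₗ[ℝ] (Fin 2 → ℝ) := LinearMap.pi
    ![LinearMap.proj (.inr (.inr 0)) + LinearMap.proj (.inl 1),
      LinearMap.proj (.inr (.inr 1)) + LinearMap.proj (.inl 0)]
  let T : (z.plane × ℝ) →ₗ[ℝ] MR s :=
    z.plane.subtype.coprod (LinearMap.toSpanSingleton ℝ (MR s) x)
  have hT : ∀ v c, T (v, c) = (v : MR s) + c • x := fun v c => by simp [T]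
  have hker : LinearMap.ker (L ∘ₗ T) ≠ ⊥ := by
    apply LinearMap.ker_ne_bot_of_finrank_lt
    rw [Module.finrank_prod, z.finrank_eq]
    simp
  obtain ⟨⟨v, c⟩, hvc, hne⟩ := Submodule.exists_mem_ne_zero_of_ne_bot hker
  have hvx := hx v v.2
  have hxv : formM S₀ x v = 0 := by rw [formM_comm hS₀, hvx]
  have hL : L ((v : MR s) + c • x) = 0 := by rw [← hT]; exact hvc
  have hQ : formM S₀ ((v : MR s) + c • x) ((v : MR s) + c • x) ≤ 0 := by
    simp only [map_add, map_smul, LinearMap.add_apply, LinearMap.smul_apply, smul_eq_mul, hvx, hxv]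
    have : formM S₀ v v ≤ 0 := by
      by_cases h : (v : MR s) = 0
      · simp [h]
      · exact (z.neg v v.2 h).le
    nlinarith [mul_self_nonneg c]
  have hu : (v : MR s) + c • x ≠ 0 := by
    intro h
    have h1 : formM S₀ v ((v : MR s) + c • x) = 0 := by rw [h]; simp
    simp only [map_add, map_smul, smul_eq_mul, hvx, mul_zero, add_zero] at h1
    have hv : (v : MR s) = 0 := by
      by_contra h2
      exact (z.neg v v.2 h2).ne h1
    rw [hv, zero_add, smul_eq_zero] at h
    refine hne (Prod.ext (Subtype.ext hv) (h.resolve_right hx0))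
  refine hQ.not_gt (formM_pos_of_mem hS₀ _ hu ?_ ?_)
  · have := congrFun hL 0
    simp [L] at this ⊢
    linarith
  · have := congrFun hL 1
    simp [L] at this ⊢
    linarith

theorem exists_orthonormal_basis {W : Type*} [AddCommGroup W] [Module ℝ W] [FiniteDimensional ℝ W]
    (B : LinearMap.BilinForm ℝ W) (hB : ∀ x y, B x y = B y x) (hpos : ∀ x, x ≠ 0 → 0 < B x x)
    {m : ℕ} (hm : finrank ℝ W = m) :
    ∃ b : Basis (Fin m) ℝ W, ∀ i j, B (b i) (b j) = if i = j then 1 else 0 := by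
  subst hm
  let core : InnerProductSpace.Core ℝ W :=
    { inner := fun x y => B x y
      conj_inner_symm := fun x y => by simp [hB y x]
      re_inner_nonneg := fun x => by
        by_cases h : x = 0
        · simp [h]
        · exact (hpos x h).le
      add_left := fun x y z => by simp
      smul_left := fun x y r => by simp
      definite := fun x hx => by
        by_contra h
        exact (hpos x h).ne' hx }
  let _ : NormedAddCommGroup W := core.toNormedAddCommGroup
  let _ : InnerProductSpace ℝ W := InnerProductSpace.ofCore core.toCore
  refine ⟨(stdOrthonormalBasis ℝ W).toBasis, fun i j => ?_⟩
  rw [OrthonormalBasis.coe_toBasis]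
  exact orthonormal_iff_ite.1 (stdOrthonormalBasis ℝ W).orthonormal i j

/-- A basis of `M_ℝ` in which the form is `x₁² + ⋯ + x_{s+2}² - y₁² - y₂²`. -/
structure AdaptedBasis (S₀ : Matrix (Fin s) (Fin s) ℝ) where
  /-- the basis -/
  basis : Basis (Fin (s + 2) ⊕ Fin 2) ℝ (MR s)
  gram : ∀ i j, formM S₀ (basis i) (basis j) =
    LieAlgebra.Orthogonal.indefiniteDiagonal (Fin (s + 2)) (Fin 2) ℝ i j

/-- The negative plane spanned by the last two vectors of an adapted basis. -/
def AdaptedBasis.frame (hS₀ : S₀.PosDef) (β : AdaptedBasis S₀) : NegFrame S₀ :=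
  NegFrame.ofOrtho hS₀ (β.basis (.inr 0)) (β.basis (.inr 1))
    (by rw [β.gram]; simp [LieAlgebra.Orthogonal.indefiniteDiagonal])
    (by rw [β.gram]; simp [LieAlgebra.Orthogonal.indefiniteDiagonal])
    (by rw [β.gram]; simp [LieAlgebra.Orthogonal.indefiniteDiagonal])

theorem exists_adaptedBasis (hS₀ : S₀.PosDef) (z : OrientedNegPlane S₀) :
    ∃ β : AdaptedBasis S₀, (β.frame hS₀).toPlane = z := by
  have hcompl := z.isCompl_orthogonal hS₀
  have hdim : finrank ℝ ((formM S₀).orthogonal z.plane) = s + 2 := by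
    have h := Submodule.finrank_add_eq_of_isCompl hcompl
    rw [z.finrank_eq] at h
    simp at h
    omega
  obtain ⟨bp, hbp⟩ := exists_orthonormal_basis
    ((formM S₀).restrict ((formM S₀).orthogonal z.plane))
    (fun x y => formM_comm hS₀ x y)
    (fun x hx => formM_pos_of_orthogonal hS₀ z x (fun v hv => x.2 v hv)
      (fun h => hx (Subtype.ext h))) hdim
  obtain ⟨bn₀, hbn₀⟩ := exists_orthonormal_basis (-(formM S₀).restrict z.plane)
    (fun x y => by
      simp only [LinearMap.neg_apply, neg_inj]
      exact formM_comm hS₀ x y)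
    (fun x hx => by
      simp only [LinearMap.neg_apply, Left.neg_pos_iff]
      exact z.neg x x.2 (fun h => hx (Subtype.ext h))) z.finrank_eq
  set bn := bn₀.adjustToOrientation z.orientation with hbndef
  have hbn : ∀ i j, formM S₀ (bn i) (bn j) = if i = j then -1 else 0 := by
    intro i j
    have h := hbn₀ i j
    have h' : formM S₀ (bn₀ i) (bn₀ j) = if i = j then -1 else 0 := by
      have : -formM S₀ (bn₀ i) (bn₀ j) = if i = j then 1 else 0 := h
      rw [neg_eq_iff_eq_neg] at this
      rw [this]
      split_ifs <;> simp
    by_cases hij : i = j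
    · subst hij
      rcases bn₀.adjustToOrientation_apply_eq_or_eq_neg z.orientation i with h1 | h1 <;>
      simp [hbndef, h1, h']
    · rcases bn₀.adjustToOrientation_apply_eq_or_eq_neg z.orientation i with h1 | h1 <;>
      rcases bn₀.adjustToOrientation_apply_eq_or_eq_neg z.orientation j with h2 | h2 <;>
      simp [hbndef, h1, h2, h', hij]
  let f : Fin (s + 2) ⊕ Fin 2 → MR s := Sum.elim (fun i => bp i) (fun i => bn i)
  have hf : ∀ i j, formM S₀ (f i) (f j) =
      LieAlgebra.Orthogonal.indefiniteDiagonal (Fin (s + 2)) (Fin 2) ℝ i j := by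
    have horth : ∀ i j, formM S₀ (bn i) (bp j) = 0 := fun i j => (bp j).2 _ (bn i).2
    rintro (i | i) (j | j)
    · simpa [f, LieAlgebra.Orthogonal.indefiniteDiagonal, diagonal_apply] using hbp i j
    · simp [f, LieAlgebra.Orthogonal.indefiniteDiagonal]
      rw [formM_comm hS₀]; exact horth j i
    · simp [f, LieAlgebra.Orthogonal.indefiniteDiagonal]
      exact horth i j
    · simpa [f, LieAlgebra.Orthogonal.indefiniteDiagonal, diagonal_apply] using hbn i j
  have hli : LinearIndependent ℝ f := by
    rw [Fintype.linearIndependent_iff]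
    intro g hg i
    have h1 : formM S₀ (∑ i, g i • f i) (f i) = 0 := by rw [hg]; simp
    simp only [map_sum, map_smul, LinearMap.sum_apply, LinearMap.smul_apply, smul_eq_mul, hf] at h1
    rw [Finset.sum_eq_single i] at h1
    · rcases i with i | i <;>
      simpa [LieAlgebra.Orthogonal.indefiniteDiagonal] using h1
    · intro j _ hj
      simp [LieAlgebra.Orthogonal.indefiniteDiagonal, hj]
    · simp
  let b := basisOfLinearIndependentOfCardEqFinrank hli (by simp; omega)
  have hb : ⇑b = f := coe_basisOfLinearIndependentOfCardEqFinrank _ _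
  refine ⟨⟨b, fun i j => by rw [hb, hf]⟩, ?_⟩
  rw [OrientedNegPlane.toPlane_eq_iff]
  refine ⟨bn, bn₀.orientation_adjustToOrientation z.orientation, fun i => ?_⟩
  fin_cases i <;> simp [AdaptedBasis.frame, NegFrame.ofOrtho, hb, f]

theorem nonempty_orientedNegPlane (hS₀ : S₀.PosDef) : Nonempty (OrientedNegPlane S₀) :=
  ⟨(NegFrame.ofOrtho hS₀ (Sum.elim ![1, 0] (Sum.elim 0 ![0, 1]))
    (Sum.elim ![0, 1] (Sum.elim 0 ![1, 0]))
    (by rw [formM_apply]; simp [dotProduct, mulVec])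
    (by rw [formM_apply]; simp [dotProduct, mulVec])
    (by rw [formM_apply]; simp [dotProduct, mulVec])).toPlane⟩

end Signature

/-! ### Isotropic vectors and the Lie ball -/

section LieBall

variable {n : ℕ}

/-- The complex bilinear extension of the form `x₁² + ⋯ + xₙ² - y₁² - y₂²`. -/
def bilC (v w : Fin n ⊕ Fin 2 → ℂ) : ℂ :=
  ∑ k, v (.inl k) * w (.inl k) - (v (.inr 0) * w (.inr 0) + v (.inr 1) * w (.inr 1))

/-- The Hermitian extension of the form, on the diagonal. -/
def hermC (v : Fin n ⊕ Fin 2 → ℂ) : ℝ :=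
  ∑ k, ‖v (.inl k)‖ ^ 2 - (‖v (.inr 0)‖ ^ 2 + ‖v (.inr 1)‖ ^ 2)

/-- The form `x₁² + ⋯ + xₙ² - y₁² - y₂²`. -/
def formR (x y : Fin n ⊕ Fin 2 → ℝ) : ℝ :=
  ∑ k, x (.inl k) * y (.inl k) - (x (.inr 0) * y (.inr 0) + x (.inr 1) * y (.inr 1))

theorem bilC_eq_formR (v : Fin n ⊕ Fin 2 → ℂ) : bilC v v =
    ((formR (fun i => (v i).re) (fun i => (v i).re) -
      formR (fun i => (v i).im) (fun i => (v i).im) : ℝ) : ℂ) +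
      ((2 * formR (fun i => (v i).re) (fun i => (v i).im) : ℝ) : ℂ) * Complex.I := by
  simp only [formR, bilC]
  apply Complex.ext
  · simp [Finset.sum_sub_distrib]
    ring
  · simp [mul_comm, ← two_mul, ← Finset.mul_sum]
    ring

theorem hermC_eq_formR (v : Fin n ⊕ Fin 2 → ℂ) : hermC v =
    formR (fun i => (v i).re) (fun i => (v i).re) +
      formR (fun i => (v i).im) (fun i => (v i).im) := by
  simp only [formR, hermC, ← Complex.normSq_eq_norm_sq, Complex.normSq_apply,
    Finset.sum_add_distrib]
  ring

/-- Isotropic vectors on which the Hermitian form is negative. Their real and imaginary parts are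
orthogonal negative vectors of the same length; up to scaling by `ℂˣ` they are the
oriented negative planes. -/
def NegIso (v : Fin n ⊕ Fin 2 → ℂ) : Prop := bilC v v = 0 ∧ hermC v < 0

/-- The first null coordinate `y₁ + i y₂` in the negative directions. -/
def nullA (v : Fin n ⊕ Fin 2 → ℂ) : ℂ := v (.inr 0) + Complex.I * v (.inr 1)

/-- The second null coordinate `y₁ - i y₂` in the negative directions. -/
def nullB (v : Fin n ⊕ Fin 2 → ℂ) : ℂ := v (.inr 0) - Complex.I * v (.inr 1)

/-- The difference of the squared sizes of the null coordinates. It does not vanish on negative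
isotropic vectors, and its sign distinguishes the two orientations. -/
def side (v : Fin n ⊕ Fin 2 → ℂ) : ℝ := ‖nullB v‖ ^ 2 - ‖nullA v‖ ^ 2

/-- `w₁² + ⋯ + wₙ²`. -/
def dotSq (w : Cn n) : ℂ := ∑ k, w k ^ 2

/-- The Lie ball. -/
def lieBall (n : ℕ) : Set (Cn n) :=
  {w | 2 * ‖w‖ ^ 2 < 1 + ‖dotSq w‖ ^ 2 ∧ ‖dotSq w‖ < 1}

/-- The isotropic vector with coordinates `w` in the positive directions and with null coordinates
`nullA = w₁² + ⋯ + wₙ²` and `nullB = 1`. -/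
def isoVec (w : Cn n) : Fin n ⊕ Fin 2 → ℂ :=
  Sum.elim w ![(1 + dotSq w) / 2, Complex.I * (1 - dotSq w) / 2]

/-- The affine coordinates `v_k / nullB v` of a vector. -/
def affineCoord (v : Fin n ⊕ Fin 2 → ℂ) : Cn n := WithLp.toLp 2 fun k => v (.inl k) / nullB v

theorem parallelogram_null (v : Fin n ⊕ Fin 2 → ℂ) :
    ‖nullA v‖ ^ 2 + ‖nullB v‖ ^ 2 = 2 * (‖v (.inr 0)‖ ^ 2 + ‖v (.inr 1)‖ ^ 2) := by
  simp only [← Complex.normSq_eq_norm_sq, nullA, nullB, Complex.normSq_apply]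
  simp
  ring

theorem nullA_mul_nullB (v : Fin n ⊕ Fin 2 → ℂ) :
    nullA v * nullB v = v (.inr 0) * v (.inr 0) + v (.inr 1) * v (.inr 1) := by
  simp only [nullA, nullB]
  linear_combination (-v (.inr 1) * v (.inr 1)) * Complex.I_mul_I

theorem NegIso.sum_sq {v : Fin n ⊕ Fin 2 → ℂ} (hv : NegIso v) :
    ∑ k, v (.inl k) ^ 2 = nullA v * nullB v := by
  have h := hv.1
  rw [bilC, sub_eq_zero] at h
  rw [nullA_mul_nullB, ← h]
  exact Finset.sum_congr rfl fun _ _ => sq _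

theorem NegIso.sum_norm_sq {v : Fin n ⊕ Fin 2 → ℂ} (hv : NegIso v) :
    2 * ∑ k, ‖v (.inl k)‖ ^ 2 < ‖nullA v‖ ^ 2 + ‖nullB v‖ ^ 2 := by
  have h := hv.2
  rw [hermC] at h
  rw [parallelogram_null]
  linarith

theorem NegIso.star {v : Fin n ⊕ Fin 2 → ℂ} (hv : NegIso v) : NegIso (star v) := by
  constructor
  · have := congrArg (starRingEnd ℂ) hv.1
    simpa [bilC] using this
  · have := hv.2
    simpa [hermC] using this

theorem side_star (v : Fin n ⊕ Fin 2 → ℂ) : side (star v) = -side v := by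
  have hA : nullA (star v) = starRingEnd ℂ (nullB v) := by
    simp [nullA, nullB]
  have hB : nullB (star v) = starRingEnd ℂ (nullA v) := by
    simp [nullA, nullB, sub_eq_add_neg]
  rw [side, side, hA, hB, Complex.norm_conj, Complex.norm_conj]
  ring

theorem norm_sum_sq_le {ι : Type*} [Fintype ι] (f : ι → ℂ) :
    ‖∑ k, f k ^ 2‖ ≤ ∑ k, ‖f k‖ ^ 2 :=
  (norm_sum_le _ _).trans_eq (Finset.sum_congr rfl fun _ _ => norm_pow _ _)

theorem norm_dotSq_le (w : Cn n) : ‖dotSq w‖ ≤ ‖w‖ ^ 2 := by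
  rw [EuclideanSpace.norm_sq_eq]
  exact norm_sum_sq_le _

/-- If the two null coordinates had the same size, then `|∑ v_k²| ≤ ∑ |v_k|²` would contradict the
negativity of the Hermitian form. -/
theorem NegIso.side_ne_zero {v : Fin n ⊕ Fin 2 → ℂ} (hv : NegIso v) : side v ≠ 0 := by
  intro h
  have h1 := hv.sum_norm_sq
  have h2 := norm_sum_sq_le fun k => v (.inl k)
  rw [hv.sum_sq, norm_mul] at h2
  rw [side, sub_eq_zero] at h
  have h3 : ‖nullB v‖ = ‖nullA v‖ := by
    rwa [sq_eq_sq₀ (norm_nonneg _) (norm_nonneg _)] at h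
  rw [h3] at h1 h2
  nlinarith

theorem nullB_ne_zero {v : Fin n ⊕ Fin 2 → ℂ} (hs : 0 < side v) : nullB v ≠ 0 := by
  intro h
  rw [side, h] at hs
  simp at hs
  nlinarith [sq_nonneg ‖nullA v‖]

@[simp] theorem nullA_isoVec (w : Cn n) : nullA (isoVec w) = dotSq w := by
  simp only [nullA, isoVec, Sum.elim_inr, cons_val_zero, cons_val_one]
  linear_combination ((1 - dotSq w) / 2) * Complex.I_mul_I

@[simp] theorem nullB_isoVec (w : Cn n) : nullB (isoVec w) = 1 := by
  simp only [nullB, isoVec, Sum.elim_inr, cons_val_zero, cons_val_one]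
  linear_combination (-(1 - dotSq w) / 2) * Complex.I_mul_I

@[simp] theorem isoVec_inl (w : Cn n) (k : Fin n) : isoVec w (.inl k) = w k := rfl

@[simp] theorem affineCoord_isoVec (w : Cn n) : affineCoord (isoVec w) = w := by
  ext k
  simp [affineCoord]

theorem bilC_isoVec (w : Cn n) : bilC (isoVec w) (isoVec w) = 0 := by
  rw [bilC, ← nullA_mul_nullB, nullA_isoVec, nullB_isoVec, mul_one, sub_eq_zero]
  exact Finset.sum_congr rfl fun k _ => (sq _).symm

theorem hermC_isoVec (w : Cn n) : hermC (isoVec w) = ‖w‖ ^ 2 - (1 + ‖dotSq w‖ ^ 2) / 2 := by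
  have h := parallelogram_null (isoVec w)
  rw [nullA_isoVec, nullB_isoVec] at h
  simp only [hermC, EuclideanSpace.norm_sq_eq, isoVec_inl]
  simp at h
  linarith

theorem negIso_isoVec {w : Cn n} (hw : w ∈ lieBall n) : NegIso (isoVec w) :=
  ⟨bilC_isoVec w, by rw [hermC_isoVec]; linarith [hw.1]⟩

theorem side_isoVec_pos {w : Cn n} (hw : w ∈ lieBall n) : 0 < side (isoVec w) := by
  rw [side, nullA_isoVec, nullB_isoVec]
  have := hw.2
  have h0 := norm_nonneg (dotSq w)
  simp
  nlinarith

theorem bilC_smul (c : ℂ) (v : Fin n ⊕ Fin 2 → ℂ) : bilC (c • v) (c • v) = c ^ 2 * bilC v v := by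
  simp only [bilC, Pi.smul_apply, smul_eq_mul, mul_sub, Finset.mul_sum]
  congr 1
  · exact Finset.sum_congr rfl fun k _ => by ring
  · ring

theorem hermC_smul (c : ℂ) (v : Fin n ⊕ Fin 2 → ℂ) : hermC (c • v) = ‖c‖ ^ 2 * hermC v := by
  simp only [hermC, Pi.smul_apply, smul_eq_mul, mul_sub, Finset.mul_sum, norm_mul, mul_pow]
  ring

theorem nullA_smul (c : ℂ) (v : Fin n ⊕ Fin 2 → ℂ) : nullA (c • v) = c * nullA v := by
  simp [nullA]; ring

theorem nullB_smul (c : ℂ) (v : Fin n ⊕ Fin 2 → ℂ) : nullB (c • v) = c * nullB v := by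
  simp [nullB]; ring

theorem side_smul (c : ℂ) (v : Fin n ⊕ Fin 2 → ℂ) : side (c • v) = ‖c‖ ^ 2 * side v := by
  simp only [side, nullA_smul, nullB_smul, norm_mul, mul_pow]; ring

theorem affineCoord_smul {c : ℂ} (hc : c ≠ 0) (v : Fin n ⊕ Fin 2 → ℂ) :
    affineCoord (c • v) = affineCoord v := by
  ext k
  simp only [affineCoord, nullB_smul, Pi.smul_apply, smul_eq_mul]
  rw [mul_div_mul_left _ _ hc]

theorem NegIso.smul {c : ℂ} (hc : c ≠ 0) {v : Fin n ⊕ Fin 2 → ℂ} (hv : NegIso v) :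
    NegIso (c • v) := by
  refine ⟨by rw [bilC_smul, hv.1, mul_zero], ?_⟩
  rw [hermC_smul]
  have : 0 < ‖c‖ ^ 2 := by positivity
  nlinarith [hv.2]

/-- A negative isotropic vector on the positive side is a multiple of the one determined by its
affine coordinates. -/
theorem NegIso.eq_smul_isoVec {v : Fin n ⊕ Fin 2 → ℂ} (hv : NegIso v) (hs : 0 < side v) :
    v = nullB v • isoVec (affineCoord v) := by
  have hb := nullB_ne_zero hs
  have hdot : dotSq (affineCoord v) = nullA v / nullB v := by
    have : dotSq (affineCoord v) = (∑ k, v (.inl k) ^ 2) / nullB v ^ 2 := by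
      rw [Finset.sum_div]
      exact Finset.sum_congr rfl fun k _ => div_pow _ _ _
    rw [this, hv.sum_sq]
    field_simp
  have hA : nullA (nullB v • isoVec (affineCoord v)) = nullA v := by
    rw [nullA_smul, nullA_isoVec, hdot]; field_simp
  have hB : nullB (nullB v • isoVec (affineCoord v)) = nullB v := by
    rw [nullB_smul, nullB_isoVec, mul_one]
  generalize hu : nullB v • isoVec (affineCoord v) = u at hA hB
  have hu' : ∀ k, u (.inl k) = v (.inl k) := by
    intro k
    rw [← hu]
    simp only [Pi.smul_apply, isoVec_inl, affineCoord, smul_eq_mul]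
    field_simp
  have h0 : u (.inr 0) = v (.inr 0) := by
    simp only [nullA, nullB] at hA hB
    linear_combination (hA + hB) / 2
  have h1 : u (.inr 1) = v (.inr 1) := by
    simp only [nullA, nullB] at hA hB
    have : Complex.I * u (.inr 1) = Complex.I * v (.inr 1) := by
      linear_combination (hA - hB) / 2
    exact mul_left_cancel₀ Complex.I_ne_zero this
  ext i
  rcases i with k | j
  · exact (hu' k).symm
  · fin_cases j
    · exact h0.symm
    · exact h1.symm

theorem NegIso.affineCoord_mem {v : Fin n ⊕ Fin 2 → ℂ} (hv : NegIso v) (hs : 0 < side v) :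
    affineCoord v ∈ lieBall n := by
  have hb := nullB_ne_zero hs
  have h := hv.eq_smul_isoVec hs
  have hb' : 0 < ‖nullB v‖ ^ 2 := by positivity
  have h1 := hv.2
  rw [h, hermC_smul, hermC_isoVec] at h1
  have h2 := hs
  rw [h, side_smul, side, nullA_isoVec, nullB_isoVec] at h2
  have h1' := neg_of_mul_neg_right h1 hb'.le
  have h2' := pos_of_mul_pos_right h2 hb'.le
  constructor
  · linarith
  · simp only [norm_one, one_pow, sub_pos] at h2'
    nlinarith [norm_nonneg (dotSq (affineCoord v))]

theorem continuous_dotSq : Continuous (dotSq : Cn n → ℂ) := by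
  unfold dotSq; fun_prop

theorem isOpen_lieBall : IsOpen (lieBall n) := by
  have := continuous_dotSq (n := n)
  have h1 : IsOpen {w : Cn n | 2 * ‖w‖ ^ 2 < 1 + ‖dotSq w‖ ^ 2} :=
    isOpen_lt (by fun_prop) (by fun_prop)
  have h2 : IsOpen {w : Cn n | ‖dotSq w‖ < 1} := isOpen_lt (by fun_prop) (by fun_prop)
  exact h1.inter h2

theorem zero_mem_lieBall : (0 : Cn n) ∈ lieBall n := by
  have h : dotSq (0 : Cn n) = 0 := by simp [dotSq]
  have h1 : 2 * ‖(0 : Cn n)‖ ^ 2 < 1 + ‖dotSq (0 : Cn n)‖ ^ 2 := by simp [h]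
  exact ⟨h1, by simp [h]⟩

theorem norm_lt_one_of_mem_lieBall {w : Cn n} (hw : w ∈ lieBall n) : ‖w‖ < 1 := by
  have h1 := hw.1
  have h2 := hw.2
  have h3 := norm_nonneg (dotSq w)
  nlinarith [norm_nonneg w]

theorem isBounded_lieBall : Bornology.IsBounded (lieBall n) :=
  isBounded_iff_forall_norm_le.2 ⟨1, fun _ hw => (norm_lt_one_of_mem_lieBall hw).le⟩

/-- The Lie ball is star-shaped. -/
theorem smul_mem_lieBall {w : Cn n} (hw : w ∈ lieBall n) {t : ℝ} (h0 : 0 ≤ t) (h1 : t ≤ 1) :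
    t • w ∈ lieBall n := by
  have hd : dotSq (t • w) = (t ^ 2 : ℝ) • dotSq w := by
    simp [dotSq, Finset.mul_sum, mul_pow]
  have hle := norm_dotSq_le w
  have hw1 := hw.1
  have hw2 := hw.2
  have h3 := norm_nonneg (dotSq w)
  have ht : t ^ 2 ≤ 1 := by nlinarith
  have ht0 := sq_nonneg t
  change 2 * ‖t • w‖ ^ 2 < 1 + ‖dotSq (t • w)‖ ^ 2 ∧ ‖dotSq (t • w)‖ < 1
  rw [hd, norm_smul, norm_smul, Real.norm_of_nonneg h0,
    Real.norm_of_nonneg ht0]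
  set x := ‖dotSq w‖
  set y := ‖w‖ ^ 2
  set u := t ^ 2
  constructor
  · rw [mul_pow, mul_pow, show (‖w‖ ^ 2 : ℝ) = y from rfl]
    have hxy : (1 + u) * x ^ 2 ≤ 2 * y := by nlinarith
    nlinarith
  · nlinarith

theorem isConnected_lieBall : IsConnected (lieBall n) := by
  have : StarConvex ℝ (0 : Cn n) (lieBall n) := by
    rw [starConvex_zero_iff]
    intro w hw t h0 h1
    exact smul_mem_lieBall hw h0 h1
  exact (this.isPathConnected zero_mem_lieBall).isConnected

end LieBall

/-! ### Oriented negative planes as isotropic lines -/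

section Planes

variable {s : ℕ} {S₀ : Matrix (Fin s) (Fin s) ℝ}

namespace AdaptedBasis

variable (β : AdaptedBasis S₀)

/-- The vector with given coordinates in an adapted basis. -/
def vecOf (x : Fin (s + 2) ⊕ Fin 2 → ℝ) : MR s := β.basis.equivFun.symm x

theorem formM_eq (x y : MR s) : formM S₀ x y =
    formR (β.basis.equivFun x) (β.basis.equivFun y) := by
  conv_lhs => rw [← β.basis.sum_equivFun x, ← β.basis.sum_equivFun y]
  simp only [map_sum, map_smul, LinearMap.sum_apply, LinearMap.smul_apply, smul_eq_mul, β.gram,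
    formR, LieAlgebra.Orthogonal.indefiniteDiagonal, diagonal_apply]
  simp [Fintype.sum_sum_type, mul_comm]
  ring

theorem equivFun_vecOf (x : Fin (s + 2) ⊕ Fin 2 → ℝ) : β.basis.equivFun (β.vecOf x) = x :=
  β.basis.equivFun.apply_symm_apply x

theorem vecOf_equivFun (x : MR s) : β.vecOf (β.basis.equivFun x) = x :=
  β.basis.equivFun.symm_apply_apply x

theorem formM_vecOf (x y : Fin (s + 2) ⊕ Fin 2 → ℝ) :
    formM S₀ (β.vecOf x) (β.vecOf y) = formR x y := by
  rw [β.formM_eq, equivFun_vecOf, equivFun_vecOf]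

/-- The complex coordinates of `p + i q`. -/
def cplx (p q : MR s) : Fin (s + 2) ⊕ Fin 2 → ℂ :=
  fun i => (β.basis.equivFun p i : ℂ) + (β.basis.equivFun q i : ℂ) * Complex.I

/-- The real part of a vector in complex coordinates. -/
def reVec (v : Fin (s + 2) ⊕ Fin 2 → ℂ) : MR s := β.vecOf fun i => (v i).re

/-- The imaginary part of a vector in complex coordinates. -/
def imVec (v : Fin (s + 2) ⊕ Fin 2 → ℂ) : MR s := β.vecOf fun i => (v i).im

theorem cplx_reVec_imVec (v : Fin (s + 2) ⊕ Fin 2 → ℂ) : β.cplx (β.reVec v) (β.imVec v) = v := by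
  ext i
  simp only [cplx, reVec, imVec, equivFun_vecOf]
  exact Complex.re_add_im (v i)

theorem reVec_cplx (p q : MR s) : β.reVec (β.cplx p q) = p := by
  simp only [reVec, cplx]
  simpa using β.vecOf_equivFun p

theorem imVec_cplx (p q : MR s) : β.imVec (β.cplx p q) = q := by
  simp only [imVec, cplx]
  simpa using β.vecOf_equivFun q

theorem reVec_smul (c : ℂ) (v : Fin (s + 2) ⊕ Fin 2 → ℂ) :
    β.reVec (c • v) = c.re • β.reVec v + (-c.im) • β.imVec v := by
  simp only [reVec, imVec, vecOf, ← map_smul, ← map_add]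
  congr 1
  ext i
  simp
  ring

theorem imVec_smul (c : ℂ) (v : Fin (s + 2) ⊕ Fin 2 → ℂ) :
    β.imVec (c • v) = c.im • β.reVec v + c.re • β.imVec v := by
  simp only [reVec, imVec, vecOf, ← map_smul, ← map_add]
  congr 1
  ext i
  simp
  ring

theorem bilC_eq (v : Fin (s + 2) ⊕ Fin 2 → ℂ) : bilC v v =
    ((formM S₀ (β.reVec v) (β.reVec v) - formM S₀ (β.imVec v) (β.imVec v) : ℝ) : ℂ) +
      ((2 * formM S₀ (β.reVec v) (β.imVec v) : ℝ) : ℂ) * Complex.I := by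
  simp only [reVec, imVec, formM_vecOf]
  exact bilC_eq_formR v

theorem hermC_eq (v : Fin (s + 2) ⊕ Fin 2 → ℂ) : hermC v =
    formM S₀ (β.reVec v) (β.reVec v) + formM S₀ (β.imVec v) (β.imVec v) := by
  simp only [reVec, imVec, formM_vecOf]
  exact hermC_eq_formR v

theorem negIso_iff (v : Fin (s + 2) ⊕ Fin 2 → ℂ) : NegIso v ↔
    formM S₀ (β.reVec v) (β.reVec v) < 0 ∧
    formM S₀ (β.imVec v) (β.imVec v) = formM S₀ (β.reVec v) (β.reVec v) ∧
    formM S₀ (β.reVec v) (β.imVec v) = 0 := by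
  rw [NegIso, β.bilC_eq, β.hermC_eq, Complex.ext_iff]
  simp only [Complex.add_re, Complex.ofReal_re, Complex.mul_re, Complex.I_re, Complex.ofReal_im,
    Complex.I_im, Complex.add_im, Complex.mul_im, Complex.zero_re, Complex.zero_im]
  constructor
  · rintro ⟨⟨h1, h2⟩, h3⟩
    exact ⟨by linarith, by linarith, by linarith⟩
  · rintro ⟨h1, h2, h3⟩
    exact ⟨⟨by linarith, by linarith⟩, by linarith⟩

/-- The frame given by the real and imaginary parts of a negative isotropic vector. -/
def frameOf (hS₀ : S₀.PosDef) (v : Fin (s + 2) ⊕ Fin 2 → ℂ) (hv : NegIso v) : NegFrame S₀ :=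
  NegFrame.ofOrtho hS₀ (β.reVec v) (β.imVec v) ((β.negIso_iff v).1 hv).1
    (((β.negIso_iff v).1 hv).2.1.trans_lt ((β.negIso_iff v).1 hv).1) ((β.negIso_iff v).1 hv).2.2

/-- The oriented plane of a negative isotropic vector. -/
def planeOf (hS₀ : S₀.PosDef) (v : Fin (s + 2) ⊕ Fin 2 → ℂ) (hv : NegIso v) :
    OrientedNegPlane S₀ := (β.frameOf hS₀ v hv).toPlane

theorem frameOf_vec_zero (hS₀ : S₀.PosDef) {v : Fin (s + 2) ⊕ Fin 2 → ℂ} (hv : NegIso v) :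
    (β.frameOf hS₀ v hv).vec 0 = β.reVec v := rfl

theorem frameOf_vec_one (hS₀ : S₀.PosDef) {v : Fin (s + 2) ⊕ Fin 2 → ℂ} (hv : NegIso v) :
    (β.frameOf hS₀ v hv).vec 1 = β.imVec v := rfl

/-- A positively oriented change between two pairs of orthogonal vectors of equal length is
complex multiplication by a scalar. -/
theorem conformal_change {E a b c d : ℝ} (hE : E ≠ 0) (hdet : 0 < a * d - b * c)
    (h1 : (a ^ 2 + b ^ 2) * E = (c ^ 2 + d ^ 2) * E) (h2 : (a * c + b * d) * E = 0) :
    d = a ∧ c = -b := by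
  have h1' := mul_right_cancel₀ hE h1
  have h2' := (mul_eq_zero.1 h2).resolve_right hE
  have h3 : (a * d - b * c) ^ 2 = (a ^ 2 + b ^ 2) ^ 2 := by
    have : (a * d - b * c) ^ 2 = (a ^ 2 + b ^ 2) * (c ^ 2 + d ^ 2) - (a * c + b * d) ^ 2 := by ring
    rw [this, h2', ← h1']; ring
  have h4 : a * d - b * c = a ^ 2 + b ^ 2 :=
    (sq_eq_sq₀ hdet.le (by positivity)).1 h3
  have h5 : (d - a) ^ 2 + (c + b) ^ 2 = 0 := by nlinarith
  constructor
  · nlinarith [sq_nonneg (d - a), sq_nonneg (c + b)]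
  · nlinarith [sq_nonneg (d - a), sq_nonneg (c + b)]

theorem planeOf_eq_iff (hS₀ : S₀.PosDef) {v v' : Fin (s + 2) ⊕ Fin 2 → ℂ} (hv : NegIso v)
    (hv' : NegIso v') :
    β.planeOf hS₀ v' hv' = β.planeOf hS₀ v hv ↔ ∃ c : ℂ, c ≠ 0 ∧ v' = c • v := by
  rw [planeOf, planeOf, NegFrame.toPlane_eq_toPlane_iff]
  simp only [frameOf_vec_zero, frameOf_vec_one]
  constructor
  · rintro ⟨a, b, c, d, hdet, h0, h1⟩
    obtain ⟨e1, e2, e3⟩ := (β.negIso_iff v).1 hv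
    obtain ⟨f1, f2, f3⟩ := (β.negIso_iff v').1 hv'
    have e3' : formM S₀ (β.imVec v) (β.reVec v) = 0 := by rw [formM_comm hS₀, e3]
    rw [h0, h1] at f2 f3
    simp only [map_add, map_smul, LinearMap.add_apply, LinearMap.smul_apply, smul_eq_mul, e2, e3,
      e3'] at f2 f3
    obtain ⟨rfl, rfl⟩ := conformal_change (E := formM S₀ (β.reVec v) (β.reVec v)) e1.ne hdet
      (by linarith) (by linarith)
    refine ⟨⟨d, -b⟩, ?_, ?_⟩
    · intro h
      have h1 := congrArg Complex.re h
      have h2 := congrArg Complex.im h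
      simp at h1 h2
      rw [h1, h2] at hdet
      simp at hdet
    · rw [← β.cplx_reVec_imVec v', ← β.cplx_reVec_imVec (_ • v), h0, h1, reVec_smul, imVec_smul]
      simp
  · rintro ⟨c, hc, rfl⟩
    refine ⟨c.re, -c.im, c.im, c.re, ?_, β.reVec_smul c v, β.imVec_smul c v⟩
    have := Complex.normSq_pos.2 hc
    rw [Complex.normSq_apply] at this
    linarith

end AdaptedBasis

/-- The Gram determinant of a negative frame is positive. -/
theorem NegFrame.gram_pos (hS₀ : S₀.PosDef) (F : NegFrame S₀) :
    formM S₀ (F.vec 0) (F.vec 0) < 0 ∧ 0 < formM S₀ (F.vec 0) (F.vec 0) *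
      formM S₀ (F.vec 1) (F.vec 1) - formM S₀ (F.vec 0) (F.vec 1) ^ 2 := by
  have h10 : formM S₀ (F.vec 1) (F.vec 0) = formM S₀ (F.vec 0) (F.vec 1) := formM_comm hS₀ _ _
  have hli := LinearIndependent.pair_iff.1 (show LinearIndependent ℝ ![F.vec 0, F.vec 1] by
    convert F.linInd using 1
    ext i : 1
    fin_cases i <;> rfl)
  have h0 : formM S₀ (F.vec 0) (F.vec 0) < 0 := by
    refine F.neg _ (Submodule.subset_span ⟨0, rfl⟩) (F.linInd.ne_zero 0)
  refine ⟨h0, ?_⟩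
  set E := formM S₀ (F.vec 0) (F.vec 0)
  set f := formM S₀ (F.vec 0) (F.vec 1)
  set g := formM S₀ (F.vec 1) (F.vec 1)
  have h := F.neg ((-f) • F.vec 0 + E • F.vec 1) (mem_span_pair_range.2 ⟨_, _, rfl⟩)
    (fun h => h0.ne (hli _ _ h).2)
  simp only [map_add, map_smul, LinearMap.add_apply, LinearMap.smul_apply, smul_eq_mul, h10] at h
  have h' : E * (E * g - f ^ 2) < 0 := by
    calc E * (E * g - f ^ 2) = _ := by ring
      _ < 0 := h
  exact pos_of_mul_neg_right h' h0.le

/-- The Gram-Schmidt process, normalized so that the second vector gets the length of the first. -/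
def NegFrame.gramSchmidtSnd (F : NegFrame S₀) : MR s :=
  (-formM S₀ (F.vec 0) (F.vec 0) / √(formM S₀ (F.vec 0) (F.vec 0) *
      formM S₀ (F.vec 1) (F.vec 1) - formM S₀ (F.vec 0) (F.vec 1) ^ 2)) • F.vec 1 +
  (formM S₀ (F.vec 0) (F.vec 1) / √(formM S₀ (F.vec 0) (F.vec 0) *
      formM S₀ (F.vec 1) (F.vec 1) - formM S₀ (F.vec 0) (F.vec 1) ^ 2)) • F.vec 0

namespace AdaptedBasis

variable (β : AdaptedBasis S₀)

/-- A negative isotropic vector for the oriented plane of a frame, depending continuously on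
the frame. -/
def isoOfFrame (F : NegFrame S₀) : Fin (s + 2) ⊕ Fin 2 → ℂ := β.cplx (F.vec 0) F.gramSchmidtSnd

theorem negIso_isoOfFrame (hS₀ : S₀.PosDef) (F : NegFrame S₀) : NegIso (β.isoOfFrame F) := by
  rw [β.negIso_iff, isoOfFrame, reVec_cplx, imVec_cplx]
  have h10 : formM S₀ (F.vec 1) (F.vec 0) = formM S₀ (F.vec 0) (F.vec 1) := formM_comm hS₀ _ _
  obtain ⟨h0, h1⟩ := F.gram_pos hS₀
  have hs := Real.sqrt_pos.2 h1
  have hs2 := Real.sq_sqrt h1.le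
  simp only [NegFrame.gramSchmidtSnd, map_add, map_smul, LinearMap.add_apply, LinearMap.smul_apply,
    smul_eq_mul, h10]
  set r := √(formM S₀ (F.vec 0) (F.vec 0) *
      formM S₀ (F.vec 1) (F.vec 1) - formM S₀ (F.vec 0) (F.vec 1) ^ 2)
  refine ⟨h0, ?_, ?_⟩
  · field_simp
    rw [hs2]
    ring
  · field_simp
    ring

theorem planeOf_isoOfFrame (hS₀ : S₀.PosDef) (F : NegFrame S₀) :
    β.planeOf hS₀ (β.isoOfFrame F) (β.negIso_isoOfFrame hS₀ F) = F.toPlane := by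
  rw [planeOf, NegFrame.toPlane_eq_toPlane_iff, frameOf_vec_zero, frameOf_vec_one, isoOfFrame,
    reVec_cplx, imVec_cplx]
  obtain ⟨h0, h1⟩ := F.gram_pos hS₀
  have hs := Real.sqrt_pos.2 h1
  refine ⟨1, 0, _, _, ?_, by simp, add_comm _ _⟩
  have : 0 < -formM S₀ (F.vec 0) (F.vec 0) / √(formM S₀ (F.vec 0) (F.vec 0) *
      formM S₀ (F.vec 1) (F.vec 1) - formM S₀ (F.vec 0) (F.vec 1) ^ 2) :=
    div_pos (by linarith) hs
  linarith

/-- A negative isotropic vector representing an oriented negative plane. -/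
def isoOf (z : OrientedNegPlane S₀) : Fin (s + 2) ⊕ Fin 2 → ℂ :=
  β.isoOfFrame (NegFrame.toPlane_surjective z).choose

theorem negIso_isoOf (hS₀ : S₀.PosDef) (z : OrientedNegPlane S₀) : NegIso (β.isoOf z) :=
  β.negIso_isoOfFrame hS₀ _

theorem planeOf_isoOf (hS₀ : S₀.PosDef) (z : OrientedNegPlane S₀) :
    β.planeOf hS₀ (β.isoOf z) (β.negIso_isoOf hS₀ z) = z :=
  (β.planeOf_isoOfFrame hS₀ _).trans (NegFrame.toPlane_surjective z).choose_spec

theorem isoOf_planeOf (hS₀ : S₀.PosDef) {v : Fin (s + 2) ⊕ Fin 2 → ℂ} (hv : NegIso v) :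
    ∃ c : ℂ, c ≠ 0 ∧ β.isoOf (β.planeOf hS₀ v hv) = c • v :=
  (β.planeOf_eq_iff hS₀ hv (β.negIso_isoOf hS₀ _)).1 (β.planeOf_isoOf hS₀ _)

theorem isoOf_toPlane (hS₀ : S₀.PosDef) (F : NegFrame S₀) :
    ∃ c : ℂ, c ≠ 0 ∧ β.isoOf F.toPlane = c • β.isoOfFrame F := by
  rw [← β.planeOf_isoOfFrame hS₀ F]
  exact β.isoOf_planeOf hS₀ _

theorem continuous_cplx {X : Type*} [TopologicalSpace X] {p q : X → MR s} (hp : Continuous p)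
    (hq : Continuous q) : Continuous fun x => β.cplx (p x) (q x) := by
  have h : Continuous β.basis.equivFun :=
    LinearMap.continuous_of_finiteDimensional β.basis.equivFun.toLinearMap
  refine continuous_pi fun i => ?_
  have h1 : Continuous fun x => β.basis.equivFun (p x) i := (continuous_apply i).comp (h.comp hp)
  have h2 : Continuous fun x => β.basis.equivFun (q x) i := (continuous_apply i).comp (h.comp hq)
  unfold cplx
  fun_prop

theorem continuous_formM {X : Type*} [TopologicalSpace X] {p q : X → MR s} (hp : Continuous p)
    (hq : Continuous q) : Continuous fun x => formM S₀ (p x) (q x) := by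
  simp only [formM, Matrix.toBilin'_apply']
  fun_prop

theorem continuous_isoOfFrame (hS₀ : S₀.PosDef) :
    Continuous (β.isoOfFrame : NegFrame S₀ → Fin (s + 2) ⊕ Fin 2 → ℂ) := by
  have h0 : Continuous fun F : NegFrame S₀ => F.vec 0 :=
    (continuous_apply 0).comp NegFrame.continuous_vec
  have h1 : Continuous fun F : NegFrame S₀ => F.vec 1 :=
    (continuous_apply 1).comp NegFrame.continuous_vec
  have h00 := continuous_formM (S₀ := S₀) h0 h0
  have h01 := continuous_formM (S₀ := S₀) h0 h1
  have h11 := continuous_formM (S₀ := S₀) h1 h1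
  have hr : Continuous fun F : NegFrame S₀ => √(formM S₀ (F.vec 0) (F.vec 0) *
      formM S₀ (F.vec 1) (F.vec 1) - formM S₀ (F.vec 0) (F.vec 1) ^ 2) := by fun_prop
  have hr0 : ∀ F : NegFrame S₀, √(formM S₀ (F.vec 0) (F.vec 0) *
      formM S₀ (F.vec 1) (F.vec 1) - formM S₀ (F.vec 0) (F.vec 1) ^ 2) ≠ 0 :=
    fun F => (Real.sqrt_pos.2 (F.gram_pos hS₀).2).ne'
  refine β.continuous_cplx h0 ?_
  exact ((h00.neg.div hr hr0).smul h1).add ((h01.div hr hr0).smul h0)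

theorem continuous_planeOf (hS₀ : S₀.PosDef) {X : Type*} [TopologicalSpace X]
    {v : X → Fin (s + 2) ⊕ Fin 2 → ℂ} (hv : ∀ x, NegIso (v x)) (hc : Continuous v) :
    Continuous fun x => β.planeOf hS₀ (v x) (hv x) := by
  have h : Continuous β.basis.equivFun.symm :=
    LinearMap.continuous_of_finiteDimensional β.basis.equivFun.symm.toLinearMap
  refine NegFrame.isQuotientMap_toPlane.continuous.comp (NegFrame.continuous_mk ?_ ?_)
  · exact h.comp (by fun_prop)
  · exact h.comp (by fun_prop)

end AdaptedBasis

end Planes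

/-! ### The two components and the chart onto the Lie ball -/

section Components

variable {s : ℕ} {S₀ : Matrix (Fin s) (Fin s) ℝ}

namespace AdaptedBasis

variable (β : AdaptedBasis S₀)

theorem side_isoOf_toPlane (hS₀ : S₀.PosDef) (F : NegFrame S₀) : ∃ r : ℝ, 0 < r ∧
    side (β.isoOf F.toPlane) = r * side (β.isoOfFrame F) := by
  obtain ⟨c, hc, h⟩ := β.isoOf_toPlane hS₀ F
  exact ⟨‖c‖ ^ 2, by positivity, by rw [h, side_smul]⟩

theorem side_isoOf_planeOf (hS₀ : S₀.PosDef) {v : Fin (s + 2) ⊕ Fin 2 → ℂ} (hv : NegIso v) :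
    ∃ r : ℝ, 0 < r ∧ side (β.isoOf (β.planeOf hS₀ v hv)) = r * side v := by
  obtain ⟨c, hc, h⟩ := β.isoOf_planeOf hS₀ hv
  exact ⟨‖c‖ ^ 2, by positivity, by rw [h, side_smul]⟩

/-- The planes that have the orientation of the last two vectors of the adapted basis. -/
def posHalf : Set (OrientedNegPlane S₀) := {z | 0 < side (β.isoOf z)}

/-- The planes that have the other orientation. -/
def negHalf : Set (OrientedNegPlane S₀) := {z | side (β.isoOf z) < 0}

theorem planeOf_mem_posHalf (hS₀ : S₀.PosDef) {v : Fin (s + 2) ⊕ Fin 2 → ℂ} (hv : NegIso v) :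
    β.planeOf hS₀ v hv ∈ β.posHalf ↔ 0 < side v := by
  obtain ⟨r, hr, h⟩ := β.side_isoOf_planeOf hS₀ hv
  change 0 < side _ ↔ _
  rw [h]
  exact mul_pos_iff_of_pos_left hr

theorem planeOf_mem_negHalf (hS₀ : S₀.PosDef) {v : Fin (s + 2) ⊕ Fin 2 → ℂ} (hv : NegIso v) :
    β.planeOf hS₀ v hv ∈ β.negHalf ↔ side v < 0 := by
  obtain ⟨r, hr, h⟩ := β.side_isoOf_planeOf hS₀ hv
  change side _ < 0 ↔ _
  rw [h]
  exact ⟨fun h => neg_of_mul_neg_right h hr.le, mul_neg_of_pos_of_neg hr⟩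

theorem compl_posHalf (hS₀ : S₀.PosDef) : β.posHalfᶜ = β.negHalf := by
  ext z
  exact not_lt.trans (β.negIso_isoOf hS₀ z).side_ne_zero.le_iff_lt

theorem continuous_side_isoOfFrame (hS₀ : S₀.PosDef) :
    Continuous fun F : NegFrame S₀ => side (β.isoOfFrame F) := by
  have h := β.continuous_isoOfFrame hS₀
  unfold side nullA nullB
  fun_prop

theorem isOpen_posHalf (hS₀ : S₀.PosDef) : IsOpen β.posHalf := by
  rw [← NegFrame.isQuotientMap_toPlane.isOpen_preimage]
  convert isOpen_lt continuous_const (β.continuous_side_isoOfFrame hS₀) using 1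
  ext F
  obtain ⟨r, hr, h⟩ := β.side_isoOf_toPlane hS₀ F
  change 0 < side _ ↔ 0 < side _
  rw [h]
  exact mul_pos_iff_of_pos_left hr

theorem isOpen_negHalf (hS₀ : S₀.PosDef) : IsOpen β.negHalf := by
  rw [← NegFrame.isQuotientMap_toPlane.isOpen_preimage]
  convert isOpen_lt (β.continuous_side_isoOfFrame hS₀) continuous_const using 1
  ext F
  obtain ⟨r, hr, h⟩ := β.side_isoOf_toPlane hS₀ F
  change side _ < 0 ↔ side _ < 0
  rw [h]
  exact ⟨fun h => neg_of_mul_neg_right h hr.le, mul_neg_of_pos_of_neg hr⟩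

theorem isClopen_posHalf (hS₀ : S₀.PosDef) : IsClopen β.posHalf :=
  ⟨⟨by rw [β.compl_posHalf hS₀]; exact β.isOpen_negHalf hS₀⟩, β.isOpen_posHalf hS₀⟩

theorem isClopen_negHalf (hS₀ : S₀.PosDef) : IsClopen β.negHalf := by
  rw [← β.compl_posHalf hS₀]
  exact (β.isClopen_posHalf hS₀).compl

/-- The affine coordinates of an oriented negative plane. -/
def coord (z : OrientedNegPlane S₀) : Cn (s + 2) := affineCoord (β.isoOf z)

/-- The oriented negative plane with given affine coordinates. -/
def ofCoord (hS₀ : S₀.PosDef) (w : lieBall (s + 2)) : OrientedNegPlane S₀ :=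
  β.planeOf hS₀ (isoVec w) (negIso_isoVec w.2)

theorem coord_mem {z : OrientedNegPlane S₀} (hS₀ : S₀.PosDef) (hz : z ∈ β.posHalf) :
    β.coord z ∈ lieBall (s + 2) :=
  (β.negIso_isoOf hS₀ z).affineCoord_mem hz

theorem ofCoord_mem (hS₀ : S₀.PosDef) (w : lieBall (s + 2)) : β.ofCoord hS₀ w ∈ β.posHalf :=
  (β.planeOf_mem_posHalf hS₀ _).2 (side_isoVec_pos w.2)

theorem coord_planeOf (hS₀ : S₀.PosDef) {v : Fin (s + 2) ⊕ Fin 2 → ℂ} (hv : NegIso v) :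
    β.coord (β.planeOf hS₀ v hv) = affineCoord v := by
  obtain ⟨c, hc, h⟩ := β.isoOf_planeOf hS₀ hv
  rw [coord, h, affineCoord_smul hc]

theorem coord_ofCoord (hS₀ : S₀.PosDef) (w : lieBall (s + 2)) :
    β.coord (β.ofCoord hS₀ w) = w := by
  rw [ofCoord, coord_planeOf, affineCoord_isoVec]

theorem ofCoord_coord (hS₀ : S₀.PosDef) {z : OrientedNegPlane S₀} (hz : z ∈ β.posHalf) :
    β.ofCoord hS₀ ⟨β.coord z, β.coord_mem hS₀ hz⟩ = z := by
  conv_rhs => rw [← β.planeOf_isoOf hS₀ z]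
  rw [ofCoord, eq_comm, planeOf_eq_iff]
  exact ⟨_, nullB_ne_zero hz, (β.negIso_isoOf hS₀ z).eq_smul_isoVec hz⟩

theorem continuous_isoVec {n : ℕ} : Continuous (isoVec : Cn n → Fin n ⊕ Fin 2 → ℂ) := by
  have := continuous_dotSq (n := n)
  refine continuous_pi fun i => ?_
  rcases i with k | j
  · simp only [isoVec_inl]
    fun_prop
  · fin_cases j
    · change Continuous fun w : Cn n => (1 + dotSq w) / 2
      fun_prop
    · change Continuous fun w : Cn n => Complex.I * (1 - dotSq w) / 2
      fun_prop

theorem continuous_ofCoord (hS₀ : S₀.PosDef) : Continuous (β.ofCoord hS₀) :=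
  β.continuous_planeOf hS₀ _ (continuous_isoVec.comp continuous_subtype_val)

theorem continuousOn_coord (hS₀ : S₀.PosDef) : ContinuousOn β.coord β.posHalf := by
  rw [NegFrame.isQuotientMap_toPlane.continuousOn_isOpen_iff (β.isOpen_posHalf hS₀)]
  have h1 : ∀ F : NegFrame S₀, β.coord F.toPlane = affineCoord (β.isoOfFrame F) := fun F => by
    obtain ⟨c, hc, h⟩ := β.isoOf_toPlane hS₀ F
    rw [coord, h, affineCoord_smul hc]
  have hc := β.continuous_isoOfFrame hS₀
  have h2 : ContinuousOn (fun F : NegFrame S₀ => affineCoord (β.isoOfFrame F))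
      (NegFrame.toPlane ⁻¹' β.posHalf) := by
    refine (PiLp.continuous_toLp 2 _).comp_continuousOn (continuousOn_pi.2 fun k => ?_)
    refine ContinuousOn.div (by fun_prop) (by unfold nullB; fun_prop) ?_
    intro F hF
    apply nullB_ne_zero
    obtain ⟨r, hr, h⟩ := β.side_isoOf_toPlane hS₀ F
    change 0 < side _ at hF
    rw [h] at hF
    exact pos_of_mul_pos_right hF hr.le
  exact h2.congr fun F _ => h1 F

theorem range_ofCoord (hS₀ : S₀.PosDef) : Set.range (β.ofCoord hS₀) = β.posHalf := by
  ext z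
  constructor
  · rintro ⟨w, rfl⟩
    exact β.ofCoord_mem hS₀ w
  · intro hz
    exact ⟨_, β.ofCoord_coord hS₀ hz⟩

theorem isPreconnected_posHalf (hS₀ : S₀.PosDef) : IsPreconnected β.posHalf := by
  have : ConnectedSpace (lieBall (s + 2)) := isConnected_iff_connectedSpace.1 isConnected_lieBall
  rw [← β.range_ofCoord hS₀]
  exact isPreconnected_range (β.continuous_ofCoord hS₀)

theorem connectedComponent_eq_posHalf (hS₀ : S₀.PosDef) {z : OrientedNegPlane S₀}
    (hz : z ∈ β.posHalf) : connectedComponent z = β.posHalf :=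
  ((β.isClopen_posHalf hS₀).connectedComponent_subset hz).antisymm
    ((β.isPreconnected_posHalf hS₀).subset_connectedComponent hz)

theorem reVec_conj (v : Fin (s + 2) ⊕ Fin 2 → ℂ) : β.reVec (star v) = β.reVec v := by
  simp [reVec]

theorem imVec_conj (v : Fin (s + 2) ⊕ Fin 2 → ℂ) : β.imVec (star v) = -β.imVec v := by
  simp only [imVec, vecOf, ← map_neg]
  congr 1

theorem opposite_planeOf (hS₀ : S₀.PosDef) {v : Fin (s + 2) ⊕ Fin 2 → ℂ} (hv : NegIso v) :
    (β.planeOf hS₀ v hv).opposite = β.planeOf hS₀ (star v) hv.star := by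
  symm
  rw [planeOf, OrientedNegPlane.toPlane_eq_iff]
  set b := (β.frameOf hS₀ v hv).planeBasis
  refine ⟨b.unitsSMul (Function.update 1 1 (-1)), ?_, fun i => ?_⟩
  · exact b.orientation_neg_single 1
  · have h : ((b.unitsSMul (Function.update 1 1 (-1)) i : (β.planeOf hS₀ v hv).plane) : MR s) =
        (Function.update (1 : Fin 2 → ℝˣ) 1 (-1) i : ℝˣ) • (β.frameOf hS₀ v hv).vec i := by
      rw [Basis.unitsSMul_apply, ← NegFrame.coe_planeBasis]
      rfl
    refine h.trans ?_
    fin_cases i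
    · simp [frameOf_vec_zero, reVec_conj]
    · simp [frameOf_vec_one, imVec_conj]

theorem opposite_mem_negHalf (hS₀ : S₀.PosDef) {z : OrientedNegPlane S₀} (hz : z ∈ β.posHalf) :
    z.opposite ∈ β.negHalf := by
  rw [← β.planeOf_isoOf hS₀ z, opposite_planeOf, planeOf_mem_negHalf, side_star]
  exact neg_neg_iff_pos.2 hz

theorem isPreconnected_negHalf (hS₀ : S₀.PosDef) : IsPreconnected β.negHalf := by
  have : ConnectedSpace (lieBall (s + 2)) := isConnected_iff_connectedSpace.1 isConnected_lieBall
  have hc : Continuous fun w : lieBall (s + 2) =>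
      β.planeOf hS₀ (star (isoVec (w : Cn (s + 2)))) (negIso_isoVec w.2).star :=
    β.continuous_planeOf hS₀ _ (continuous_isoVec.comp continuous_subtype_val).star
  convert isPreconnected_range hc
  ext z
  constructor
  · intro hz
    have hv := β.negIso_isoOf hS₀ z
    have hs : 0 < side (star (β.isoOf z)) := by
      rw [side_star]
      exact neg_pos.2 hz
    refine ⟨⟨_, hv.star.affineCoord_mem hs⟩, ?_⟩
    conv_rhs => rw [← β.planeOf_isoOf hS₀ z]
    simp only
    rw [eq_comm, planeOf_eq_iff]
    refine ⟨star (nullB (star (β.isoOf z))), star_ne_zero.2 (nullB_ne_zero hs), ?_⟩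
    rw [← star_smul, ← hv.star.eq_smul_isoVec hs, star_star]
  · rintro ⟨w, rfl⟩
    rw [planeOf_mem_negHalf, side_star]
    exact neg_neg_iff_pos.2 (side_isoVec_pos w.2)

theorem connectedComponent_eq_negHalf (hS₀ : S₀.PosDef) {z : OrientedNegPlane S₀}
    (hz : z ∈ β.negHalf) : connectedComponent z = β.negHalf :=
  ((β.isClopen_negHalf hS₀).connectedComponent_subset hz).antisymm
    ((β.isPreconnected_negHalf hS₀).subset_connectedComponent hz)

/-- The plane spanned by the last two vectors of the adapted basis is the centre of the ball. -/
theorem toPlane_frame (hS₀ : S₀.PosDef) : (β.frame hS₀).toPlane =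
    β.ofCoord hS₀ ⟨0, zero_mem_lieBall⟩ := by
  have hre : β.reVec (isoVec 0) = (1 / 2 : ℝ) • β.basis (.inr 0) := by
    simp [reVec, vecOf, Basis.equivFun_symm_apply, Fintype.sum_sum_type, isoVec, dotSq]
  have him : β.imVec (isoVec 0) = (1 / 2 : ℝ) • β.basis (.inr 1) := by
    simp [imVec, vecOf, Basis.equivFun_symm_apply, Fintype.sum_sum_type, isoVec, dotSq]
  symm
  rw [ofCoord, planeOf, NegFrame.toPlane_eq_toPlane_iff, frameOf_vec_zero, frameOf_vec_one]
  refine ⟨1 / 2, 0, 0, 1 / 2, by norm_num, ?_, ?_⟩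
  · rw [zero_smul, add_zero]
    exact hre
  · rw [zero_smul, zero_add]
    exact him

variable {z₀ : OrientedNegPlane S₀}

/-- The component of a plane is homeomorphic to the Lie ball. -/
def homeo (hS₀ : S₀.PosDef) (h : connectedComponent z₀ = β.posHalf) :
    DComponent z₀ ≃ₜ lieBall (s + 2) where
  toFun z := ⟨β.coord z.1, β.coord_mem hS₀ (h.subset z.2)⟩
  invFun w := ⟨β.ofCoord hS₀ w, h.superset (β.ofCoord_mem hS₀ w)⟩
  left_inv z := Subtype.ext (β.ofCoord_coord hS₀ (h.subset z.2))
  right_inv w := Subtype.ext (β.coord_ofCoord hS₀ w)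
  continuous_toFun := ((β.continuousOn_coord hS₀).comp_continuous continuous_subtype_val
    fun z => h.subset z.2).subtype_mk _
  continuous_invFun := (β.continuous_ofCoord hS₀).subtype_mk _

/-- The global chart on the component of a plane. -/
def chart (z₀ : OrientedNegPlane S₀) (z : DComponent z₀) : Cn (s + 2) := β.coord z.1

theorem isOpenEmbedding_chart (hS₀ : S₀.PosDef) (h : connectedComponent z₀ = β.posHalf) :
    IsOpenEmbedding (β.chart z₀) :=
  isOpen_lieBall.isOpenEmbedding_subtypeVal.comp (β.homeo hS₀ h).isOpenEmbedding

theorem chart_mem (hS₀ : S₀.PosDef) (h : connectedComponent z₀ = β.posHalf) (z : DComponent z₀) :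
    β.chart z₀ z ∈ lieBall (s + 2) :=
  β.coord_mem hS₀ (h.subset z.2)

theorem exists_chart_eq (hS₀ : S₀.PosDef) (h : connectedComponent z₀ = β.posHalf)
    {w : Cn (s + 2)} (hw : w ∈ lieBall (s + 2)) : ∃ z, β.chart z₀ z = w :=
  ⟨(β.homeo hS₀ h).symm ⟨w, hw⟩, β.coord_ofCoord hS₀ ⟨w, hw⟩⟩

theorem range_chart (hS₀ : S₀.PosDef) (h : connectedComponent z₀ = β.posHalf) :
    Set.range (β.chart z₀) = lieBall (s + 2) := by
  ext w
  exact ⟨fun ⟨z, hz⟩ => hz ▸ β.chart_mem hS₀ h z, fun hw => β.exists_chart_eq hS₀ h hw⟩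

theorem planeOf_chart (hS₀ : S₀.PosDef) (h : connectedComponent z₀ = β.posHalf)
    (z : DComponent z₀) :
    β.planeOf hS₀ (isoVec (β.chart z₀ z)) (negIso_isoVec (β.chart_mem hS₀ h z)) = z :=
  β.ofCoord_coord hS₀ (h.subset z.2)

end AdaptedBasis

/-- The set `D` has two components, both open, which are interchanged by the change
of orientation. -/
theorem components_orientedNegPlane (hS₀ : S₀.PosDef) (z₀ : OrientedNegPlane S₀) :
    IsOpen (connectedComponent z₀) ∧ IsOpen (connectedComponent z₀.opposite) ∧
    Disjoint (connectedComponent z₀) (connectedComponent z₀.opposite) ∧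
    connectedComponent z₀ ∪ connectedComponent z₀.opposite = Set.univ := by
  obtain ⟨β, hβ⟩ := exists_adaptedBasis hS₀ z₀
  have hz : z₀ ∈ β.posHalf := by
    rw [← hβ, β.toPlane_frame]
    exact β.ofCoord_mem hS₀ _
  rw [β.connectedComponent_eq_posHalf hS₀ hz,
    β.connectedComponent_eq_negHalf hS₀ (β.opposite_mem_negHalf hS₀ hz), ← β.compl_posHalf hS₀]
  exact ⟨β.isOpen_posHalf hS₀, (β.isClopen_posHalf hS₀).compl.isOpen, disjoint_compl_right,
    Set.union_compl_self _⟩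

end Components

/-! ### The derivative of the isotropic vector -/

section IsoVecDeriv

variable {n : ℕ}

/-- The derivative of `w ↦ w₁² + ⋯ + wₙ²`. -/
def dotSqDeriv (w : Cn n) : Cn n →L[ℂ] ℂ :=
  ∑ k, (2 * w k) • (EuclideanSpace.proj k : Cn n →L[ℂ] ℂ)

theorem dotSqDeriv_apply (w ξ : Cn n) : dotSqDeriv w ξ = 2 * ∑ k, w k * ξ k := by
  simp [dotSqDeriv, Finset.mul_sum, mul_assoc]

theorem hasFDerivAt_dotSq (w : Cn n) : HasFDerivAt (dotSq : Cn n → ℂ) (dotSqDeriv w) w := by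
  unfold dotSqDeriv
  refine HasFDerivAt.fun_sum fun k _ => ?_
  have h := ((EuclideanSpace.proj k : Cn n →L[ℂ] ℂ).hasFDerivAt (x := w)).pow 2
  simpa using h

/-- The derivative of `isoVec`. -/
def isoVecDeriv (w : Cn n) : Cn n →L[ℂ] (Fin n ⊕ Fin 2 → ℂ) :=
  ContinuousLinearMap.pi (Sum.elim (fun k => (EuclideanSpace.proj k : Cn n →L[ℂ] ℂ))
    ![(1 / 2 : ℂ) • dotSqDeriv w, (-Complex.I / 2 : ℂ) • dotSqDeriv w])

theorem isoVecDeriv_inl (w ξ : Cn n) (k : Fin n) : isoVecDeriv w ξ (.inl k) = ξ k := rfl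

theorem isoVecDeriv_inr_zero (w ξ : Cn n) :
    isoVecDeriv w ξ (.inr 0) = (1 / 2 : ℂ) * dotSqDeriv w ξ := rfl

theorem isoVecDeriv_inr_one (w ξ : Cn n) :
    isoVecDeriv w ξ (.inr 1) = (-Complex.I / 2 : ℂ) * dotSqDeriv w ξ := rfl

theorem hasFDerivAt_isoVec (w : Cn n) :
    HasFDerivAt (isoVec : Cn n → Fin n ⊕ Fin 2 → ℂ) (isoVecDeriv w) w := by
  rw [hasFDerivAt_pi']
  have hd := hasFDerivAt_dotSq w
  rintro (k | j)
  · exact (EuclideanSpace.proj k : Cn n →L[ℂ] ℂ).hasFDerivAt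
  · fin_cases j
    · refine ((hd.const_add 1).mul_const (1 / 2)).congr_fderiv ?_ |>.congr_of_eventuallyEq ?_
      · rfl
      · refine .of_forall fun w => ?_
        change (1 + dotSq w) / 2 = _
        ring
    · refine ((hd.const_sub 1).mul_const (Complex.I / 2)).congr_fderiv ?_
        |>.congr_of_eventuallyEq ?_
      · ext ξ
        change (Complex.I / 2) * -(dotSqDeriv w ξ) = (-Complex.I / 2 : ℂ) * dotSqDeriv w ξ
        ring
      · refine .of_forall fun w => ?_
        change Complex.I * (1 - dotSq w) / 2 = _
        ring

theorem contDiff_isoVec {𝕜 : Type*} [NontriviallyNormedField 𝕜] [NormedAlgebra 𝕜 ℂ]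
    {m : WithTop ℕ∞} : ContDiff 𝕜 m (isoVec : Cn n → Fin n ⊕ Fin 2 → ℂ) := by
  have hd : ContDiff 𝕜 m (dotSq : Cn n → ℂ) := by
    refine ContDiff.sum fun k _ => ContDiff.pow ?_ 2
    exact ((EuclideanSpace.proj k : Cn n →L[ℂ] ℂ).restrictScalars 𝕜).contDiff
  refine contDiff_pi.2 ?_
  rintro (k | j)
  · exact ((EuclideanSpace.proj k : Cn n →L[ℂ] ℂ).restrictScalars 𝕜).contDiff
  · fin_cases j
    · exact (contDiff_const.add hd).div_const 2
    · exact (contDiff_const.mul (contDiff_const.sub hd)).div_const 2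

theorem nullB_isoVecDeriv (w ξ : Cn n) : nullB (isoVecDeriv w ξ) = 0 := by
  rw [nullB, isoVecDeriv_inr_zero, isoVecDeriv_inr_one]
  linear_combination (dotSqDeriv w ξ / 2) * Complex.I_mul_I

theorem bilC_isoVecDeriv (w ξ : Cn n) : bilC (isoVecDeriv w ξ) (isoVec w) = 0 := by
  have h : ∑ k, ξ k * w k = dotSqDeriv w ξ / 2 := by
    rw [dotSqDeriv_apply, mul_div_cancel_left₀ _ two_ne_zero]
    exact Finset.sum_congr rfl fun _ _ => mul_comm _ _
  simp only [bilC, isoVecDeriv_inl, isoVec_inl, h, isoVecDeriv_inr_zero, isoVecDeriv_inr_one]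
  simp only [isoVec, Sum.elim_inr, cons_val_zero, cons_val_one]
  linear_combination ((dotSqDeriv w ξ) / 4 * (1 - dotSq w)) * Complex.I_mul_I

theorem bilC_combination (v : Fin n ⊕ Fin 2 → ℂ) (a b : ℂ) :
    bilC (a • v + b • star v) v = a * bilC v v + b * hermC v := by
  have hs : ∀ x : ℂ, star x * x = ((‖x‖ ^ 2 : ℝ) : ℂ) := fun x => by
    rw [← Complex.normSq_eq_norm_sq, Complex.normSq_eq_conj_mul_self]; rfl
  simp only [bilC, hermC, Pi.add_apply, Pi.smul_apply, Pi.star_apply, smul_eq_mul, add_mul,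
    mul_assoc, hs, Finset.sum_add_distrib, ← Finset.mul_sum]
  push_cast
  ring

/-- No derivative of the isotropic vector lies in the complexification of its plane. -/
theorem eq_zero_of_isoVecDeriv_eq {w ξ : Cn n} (hw : w ∈ lieBall n) {a b : ℂ}
    (h : isoVecDeriv w ξ = a • isoVec w + b • star (isoVec w)) : ξ = 0 := by
  have h1 := bilC_isoVecDeriv w ξ
  rw [h, bilC_combination, bilC_isoVec, mul_zero, zero_add, mul_eq_zero] at h1
  have hb : b = 0 := h1.resolve_right (by exact_mod_cast (negIso_isoVec hw).2.ne)
  have h2 := nullB_isoVecDeriv w ξ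
  rw [h, hb, zero_smul, add_zero, nullB_smul, nullB_isoVec, mul_one] at h2
  rw [h2, hb, zero_smul, zero_smul, add_zero] at h
  ext k
  rw [← isoVecDeriv_inl w ξ k, h]
  rfl

end IsoVecDeriv

/-! ### The projections onto the planes and the metric -/

section Metric

variable {s : ℕ} {S₀ : Matrix (Fin s) (Fin s) ℝ}

namespace AdaptedBasis

variable (β : AdaptedBasis S₀)

/-- The real part as a continuous real linear map. -/
def reL : (Fin (s + 2) ⊕ Fin 2 → ℂ) →L[ℝ] MR s :=
  LinearMap.toContinuousLinearMap (β.basis.equivFun.symm.toLinearMap ∘ₗ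
    LinearMap.pi fun i => Complex.reLm ∘ₗ LinearMap.proj i)

/-- The imaginary part as a continuous real linear map. -/
def imL : (Fin (s + 2) ⊕ Fin 2 → ℂ) →L[ℝ] MR s :=
  LinearMap.toContinuousLinearMap (β.basis.equivFun.symm.toLinearMap ∘ₗ
    LinearMap.pi fun i => Complex.imLm ∘ₗ LinearMap.proj i)

theorem reL_apply (v : Fin (s + 2) ⊕ Fin 2 → ℂ) : β.reL v = β.reVec v := rfl

theorem imL_apply (v : Fin (s + 2) ⊕ Fin 2 → ℂ) : β.imL v = β.imVec v := rfl

/-- The form as a continuous bilinear map. -/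
def _root_.formL (S₀ : Matrix (Fin s) (Fin s) ℝ) : MR s →L[ℝ] MR s →L[ℝ] ℝ :=
  LinearMap.toContinuousBilinearMap (formM S₀)

/-- The orthogonal projection onto the plane of a negative isotropic vector. -/
def projOf (v : Fin (s + 2) ⊕ Fin 2 → ℂ) : MR s →L[ℝ] MR s :=
  (formM S₀ (β.reVec v) (β.reVec v))⁻¹ •
    ((formL S₀ (β.reVec v)).smulRight (β.reVec v) + (formL S₀ (β.imVec v)).smulRight (β.imVec v))

theorem projOf_apply (v : Fin (s + 2) ⊕ Fin 2 → ℂ) (x : MR s) : β.projOf v x =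
    (formM S₀ (β.reVec v) (β.reVec v))⁻¹ •
      (formM S₀ (β.reVec v) x • β.reVec v + formM S₀ (β.imVec v) x • β.imVec v) := rfl

theorem mem_planeOf (hS₀ : S₀.PosDef) {v : Fin (s + 2) ⊕ Fin 2 → ℂ} (hv : NegIso v) (x : MR s) :
    x ∈ (β.planeOf hS₀ v hv).plane ↔ ∃ a b : ℝ, a • β.reVec v + b • β.imVec v = x :=
  mem_span_pair_range

theorem formM_sub_projOf (hS₀ : S₀.PosDef) {v : Fin (s + 2) ⊕ Fin 2 → ℂ} (hv : NegIso v)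
    (x y : MR s) (hy : y ∈ (β.planeOf hS₀ v hv).plane) :
    formM S₀ y (x - β.projOf v x) = 0 := by
  obtain ⟨a, b, rfl⟩ := (β.mem_planeOf hS₀ hv y).1 hy
  obtain ⟨h1, h2, h3⟩ := (β.negIso_iff v).1 hv
  have h3' : formM S₀ (β.imVec v) (β.reVec v) = 0 := by rw [formM_comm hS₀, h3]
  simp only [projOf_apply, map_sub, map_add, map_smul, LinearMap.add_apply, LinearMap.smul_apply,
    smul_eq_mul, h2, h3, h3']
  have h4 := mul_inv_cancel₀ h1.ne
  linear_combination (-(a * formM S₀ (β.reVec v) x + b * formM S₀ (β.imVec v) x)) * h4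

theorem proj_planeOf (hS₀ : S₀.PosDef) {v : Fin (s + 2) ⊕ Fin 2 → ℂ} (hv : NegIso v) :
    (β.planeOf hS₀ v hv).proj hS₀ = β.projOf v := by
  set z := β.planeOf hS₀ v hv with hz
  ext1 x
  have h1 : β.projOf v x ∈ z.plane := by
    rw [hz, mem_planeOf, projOf_apply]
    exact ⟨_, _, by rw [smul_add, smul_smul, smul_smul]⟩
  have h2 : x - β.projOf v x ∈ (formM S₀).orthogonal z.plane :=
    fun y hy => β.formM_sub_projOf hS₀ hv x y hy
  have h3 : z.plane.projection ((formM S₀).orthogonal z.plane) (z.isCompl_orthogonal hS₀) x =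
      β.projOf v x := by
    conv_lhs => rw [← add_sub_cancel (β.projOf v x) x]
    rw [map_add, Submodule.projection_apply_of_mem_left _ h1,
      Submodule.projection_apply_of_mem_right _ h2, add_zero]
  exact h3

theorem projOf_reVec (hS₀ : S₀.PosDef) {v : Fin (s + 2) ⊕ Fin 2 → ℂ} (hv : NegIso v) :
    β.projOf v (β.reVec v) = β.reVec v := by
  obtain ⟨h1, h2, h3⟩ := (β.negIso_iff v).1 hv
  have h3' : formM S₀ (β.imVec v) (β.reVec v) = 0 := by rw [formM_comm hS₀, h3]
  rw [projOf_apply, h3', zero_smul, add_zero, inv_smul_smul₀ h1.ne]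

theorem projOf_imVec {v : Fin (s + 2) ⊕ Fin 2 → ℂ} (hv : NegIso v) :
    β.projOf v (β.imVec v) = β.imVec v := by
  obtain ⟨h1, h2, h3⟩ := (β.negIso_iff v).1 hv
  rw [projOf_apply, h3, h2, zero_smul, zero_add, inv_smul_smul₀ h1.ne]

theorem contDiff_reVec {m : WithTop ℕ∞} :
    ContDiff ℝ m fun w : Cn (s + 2) => β.reVec (isoVec w) :=
  β.reL.contDiff.comp contDiff_isoVec

theorem contDiff_imVec {m : WithTop ℕ∞} :
    ContDiff ℝ m fun w : Cn (s + 2) => β.imVec (isoVec w) :=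
  β.imL.contDiff.comp contDiff_isoVec

theorem contDiffOn_projOf {m : WithTop ℕ∞} :
    ContDiffOn ℝ m (fun w : Cn (s + 2) => β.projOf (isoVec w)) (lieBall (s + 2)) := by
  have hp := β.contDiff_reVec (m := m)
  have hq := β.contDiff_imVec (m := m)
  have hQ := fun {f g : Cn (s + 2) → MR s} (hf : ContDiff ℝ m f) (hg : ContDiff ℝ m g) =>
    ((formL S₀).contDiff.comp hf).clm_apply hg
  rw [contDiffOn_clm_apply]
  intro x
  refine ContDiffOn.smul (ContDiffOn.inv (hQ hp hp).contDiffOn fun w hw => ?_)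
    ((((hQ hp contDiff_const).smul hp).add ((hQ hq contDiff_const).smul hq)).contDiffOn)
  exact ((β.negIso_iff _).1 (negIso_isoVec hw)).1.ne

/-- The derivative of the projections in the chart. -/
def projDeriv (w : Cn (s + 2)) : Cn (s + 2) →L[ℝ] MR s →L[ℝ] MR s :=
  fderiv ℝ (fun w : Cn (s + 2) => β.projOf (isoVec w)) w

theorem hasFDerivAt_projOf {w : Cn (s + 2)} (hw : w ∈ lieBall (s + 2)) :
    HasFDerivAt (fun w : Cn (s + 2) => β.projOf (isoVec w)) (β.projDeriv w) w :=
  ((β.contDiffOn_projOf (m := 1)).contDiffAt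
    (isOpen_lieBall.mem_nhds hw)).differentiableAt one_ne_zero |>.hasFDerivAt

theorem contDiffOn_projDeriv : ContDiffOn ℝ ∞ β.projDeriv (lieBall (s + 2)) :=
  (β.contDiffOn_projOf (m := ∞)).fderiv_of_isOpen isOpen_lieBall (by simp)

/-- Differentiating `P v = v` for a vector `v` of the plane gives `P' v = (1 - P) v'`. -/
theorem projDeriv_of_fixed {w : Cn (s + 2)} (hw : w ∈ lieBall (s + 2)) {f : Cn (s + 2) → MR s}
    {f' : Cn (s + 2) →L[ℝ] MR s} (hf : HasFDerivAt f f' w)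
    (h : ∀ w ∈ lieBall (s + 2), β.projOf (isoVec w) (f w) = f w) (ξ : Cn (s + 2)) :
    β.projDeriv w ξ (f w) = f' ξ - β.projOf (isoVec w) (f' ξ) := by
  have h1 := (β.hasFDerivAt_projOf hw).clm_apply hf
  have h2 : HasFDerivAt (fun w => β.projOf (isoVec w) (f w)) f' w := by
    refine hf.congr_of_eventuallyEq ?_
    filter_upwards [isOpen_lieBall.mem_nhds hw] with y hy using h y hy
  have h3 := congrArg (fun L => L ξ) (h1.unique h2)
  simp only [_root_.add_apply, ContinuousLinearMap.comp_apply,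
    ContinuousLinearMap.flip_apply] at h3
  exact eq_sub_of_add_eq' h3

theorem projDeriv_reVec (hS₀ : S₀.PosDef) {w : Cn (s + 2)} (hw : w ∈ lieBall (s + 2))
    (ξ : Cn (s + 2)) : β.projDeriv w ξ (β.reVec (isoVec w)) =
      β.reVec (isoVecDeriv w ξ) - β.projOf (isoVec w) (β.reVec (isoVecDeriv w ξ)) :=
  β.projDeriv_of_fixed hw (f := fun w => β.reVec (isoVec w))
    (β.reL.hasFDerivAt.comp w ((hasFDerivAt_isoVec w).restrictScalars ℝ))
    (fun _ hw => β.projOf_reVec hS₀ (negIso_isoVec hw)) ξ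

theorem projDeriv_imVec {w : Cn (s + 2)} (hw : w ∈ lieBall (s + 2))
    (ξ : Cn (s + 2)) : β.projDeriv w ξ (β.imVec (isoVec w)) =
      β.imVec (isoVecDeriv w ξ) - β.projOf (isoVec w) (β.imVec (isoVecDeriv w ξ)) :=
  β.projDeriv_of_fixed hw (f := fun w => β.imVec (isoVec w))
    (β.imL.hasFDerivAt.comp w ((hasFDerivAt_isoVec w).restrictScalars ℝ))
    (fun _ hw => β.projOf_imVec (negIso_isoVec hw)) ξ

theorem projDeriv_I_reVec (hS₀ : S₀.PosDef) {w : Cn (s + 2)} (hw : w ∈ lieBall (s + 2))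
    (ξ : Cn (s + 2)) : β.projDeriv w (Complex.I • ξ) (β.reVec (isoVec w)) =
      -β.projDeriv w ξ (β.imVec (isoVec w)) := by
  rw [β.projDeriv_reVec hS₀ hw, β.projDeriv_imVec hw, map_smul, reVec_smul]
  simp only [Complex.I_re, Complex.I_im, zero_smul, zero_add, neg_smul, one_smul, map_neg]
  abel

theorem projDeriv_I_imVec (hS₀ : S₀.PosDef) {w : Cn (s + 2)} (hw : w ∈ lieBall (s + 2))
    (ξ : Cn (s + 2)) : β.projDeriv w (Complex.I • ξ) (β.imVec (isoVec w)) =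
      β.projDeriv w ξ (β.reVec (isoVec w)) := by
  rw [β.projDeriv_reVec hS₀ hw, β.projDeriv_imVec hw, map_smul, imVec_smul]
  simp only [Complex.I_re, Complex.I_im, zero_smul, add_zero, one_smul]

/-- The metric in the chart. -/
def metric (w : Cn (s + 2)) : Cn (s + 2) →L[ℝ] Cn (s + 2) →L[ℝ] ℝ :=
  (2 * ((s : ℝ) + 2) * (-formM S₀ (β.reVec (isoVec w)) (β.reVec (isoVec w)))⁻¹) •
    ((formL S₀).bilinearComp ((β.projDeriv w).flip (β.reVec (isoVec w)))
        ((β.projDeriv w).flip (β.reVec (isoVec w))) +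
      (formL S₀).bilinearComp ((β.projDeriv w).flip (β.imVec (isoVec w)))
        ((β.projDeriv w).flip (β.imVec (isoVec w))))

theorem metric_apply (w ξ η : Cn (s + 2)) : β.metric w ξ η =
    (2 * ((s : ℝ) + 2) * (-formM S₀ (β.reVec (isoVec w)) (β.reVec (isoVec w)))⁻¹) *
    (formM S₀ (β.projDeriv w ξ (β.reVec (isoVec w))) (β.projDeriv w η (β.reVec (isoVec w))) +
      formM S₀ (β.projDeriv w ξ (β.imVec (isoVec w))) (β.projDeriv w η (β.imVec (isoVec w)))) :=
  rfl

theorem metric_symm (hS₀ : S₀.PosDef) (w ξ η : Cn (s + 2)) :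
    β.metric w ξ η = β.metric w η ξ := by
  simp only [metric_apply]
  rw [formM_comm hS₀ (β.projDeriv w ξ (β.reVec (isoVec w))),
    formM_comm hS₀ (β.projDeriv w ξ (β.imVec (isoVec w)))]

theorem formM_sub_projOf_nonneg (hS₀ : S₀.PosDef) {v : Fin (s + 2) ⊕ Fin 2 → ℂ} (hv : NegIso v)
    (x : MR s) : 0 ≤ formM S₀ (x - β.projOf v x) (x - β.projOf v x) ∧
      (formM S₀ (x - β.projOf v x) (x - β.projOf v x) = 0 → β.projOf v x = x) := by
  by_cases h : x - β.projOf v x = 0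
  · rw [h]
    exact ⟨by simp, fun _ => (sub_eq_zero.1 h).symm⟩
  · have h1 := formM_pos_of_orthogonal hS₀ (β.planeOf hS₀ v hv) _
      (fun y hy => β.formM_sub_projOf hS₀ hv x y hy) h
    exact ⟨h1.le, fun h2 => absurd h2 h1.ne'⟩

theorem metric_pos (hS₀ : S₀.PosDef) {w : Cn (s + 2)} (hw : w ∈ lieBall (s + 2)) (ξ : Cn (s + 2))
    (hξ : ξ ≠ 0) : 0 < β.metric w ξ ξ := by
  have hv := negIso_isoVec hw
  have hneg := ((β.negIso_iff _).1 hv).1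
  rw [metric_apply]
  refine mul_pos (mul_pos (by positivity) (inv_pos.2 (by linarith))) ?_
  rw [β.projDeriv_reVec hS₀ hw, β.projDeriv_imVec hw]
  obtain ⟨h1, h1'⟩ := β.formM_sub_projOf_nonneg hS₀ hv (β.reVec (isoVecDeriv w ξ))
  obtain ⟨h2, h2'⟩ := β.formM_sub_projOf_nonneg hS₀ hv (β.imVec (isoVecDeriv w ξ))
  refine lt_of_le_of_ne (add_nonneg h1 h2) fun h => hξ ?_
  have e1 := h1' (by linarith)
  have e2 := h2' (by linarith)
  rw [projOf_apply, smul_add, smul_smul, smul_smul] at e1 e2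
  generalize (formM S₀ (β.reVec (isoVec w)) (β.reVec (isoVec w)))⁻¹ *
    formM S₀ (β.reVec (isoVec w)) (β.reVec (isoVecDeriv w ξ)) = a at e1
  generalize (formM S₀ (β.reVec (isoVec w)) (β.reVec (isoVec w)))⁻¹ *
    formM S₀ (β.imVec (isoVec w)) (β.reVec (isoVecDeriv w ξ)) = b at e1
  generalize (formM S₀ (β.reVec (isoVec w)) (β.reVec (isoVec w)))⁻¹ *
    formM S₀ (β.reVec (isoVec w)) (β.imVec (isoVecDeriv w ξ)) = c at e2
  generalize (formM S₀ (β.reVec (isoVec w)) (β.reVec (isoVec w)))⁻¹ *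
    formM S₀ (β.imVec (isoVec w)) (β.imVec (isoVecDeriv w ξ)) = d at e2
  -- The derivative lies in the complexified plane, which is spanned by the vector and its
  -- conjugate.
  refine eq_zero_of_isoVecDeriv_eq hw (a := ⟨(a + d) / 2, (c - b) / 2⟩)
    (b := ⟨(a - d) / 2, (c + b) / 2⟩) ?_
  rw [← β.cplx_reVec_imVec (isoVecDeriv w ξ), ← β.cplx_reVec_imVec (_ + _), ← e1, ← e2]
  congr 1
  · rw [← reL_apply β (_ + _), map_add, reL_apply, reL_apply, reVec_smul, reVec_smul, reVec_conj,
      imVec_conj]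
    module
  · rw [← imL_apply β (_ + _), map_add, imL_apply, imL_apply, imVec_smul, imVec_smul, reVec_conj,
      imVec_conj]
    module

theorem metric_I (hS₀ : S₀.PosDef) {w : Cn (s + 2)} (hw : w ∈ lieBall (s + 2))
    (ξ η : Cn (s + 2)) : β.metric w (Complex.I • ξ) (Complex.I • η) = β.metric w ξ η := by
  simp only [metric_apply, β.projDeriv_I_reVec hS₀ hw, β.projDeriv_I_imVec hS₀ hw, map_neg,
    LinearMap.neg_apply, neg_neg]
  ring

theorem contDiffOn_metric : ContDiffOn ℝ ∞ β.metric (lieBall (s + 2)) := by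
  have hp := (β.contDiff_reVec (m := ∞)).contDiffOn (s := lieBall (s + 2))
  have hq := (β.contDiff_imVec (m := ∞)).contDiffOn (s := lieBall (s + 2))
  have hQ := fun {f g : Cn (s + 2) → MR s} (hf : ContDiffOn ℝ ∞ f (lieBall (s + 2)))
    (hg : ContDiffOn ℝ ∞ g (lieBall (s + 2))) =>
    ((formL S₀).contDiff.comp_contDiffOn hf).clm_apply hg
  have hd := fun (ξ : Cn (s + 2)) {f : Cn (s + 2) → MR s}
    (hf : ContDiffOn ℝ ∞ f (lieBall (s + 2))) =>
    (β.contDiffOn_projDeriv.clm_apply (contDiffOn_const (c := ξ))).clm_apply hf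
  rw [contDiffOn_clm_apply]
  intro ξ
  rw [contDiffOn_clm_apply]
  intro η
  refine ContDiffOn.mul (contDiffOn_const.mul (ContDiffOn.inv (hQ hp hp).neg fun w hw => ?_))
    ((hQ (hd ξ hp) (hd η hp)).add (hQ (hd ξ hq) (hd η hq)))
  exact neg_ne_zero.2 ((β.negIso_iff _).1 (negIso_isoVec hw)).1.ne

/-- An orthonormal frame of the plane with coordinates `w` is a complex multiple of the standard
frame. -/
theorem exists_smul_of_isOrthonormal (hS₀ : S₀.PosDef) {w : Cn (s + 2)} (hw : w ∈ lieBall (s + 2))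
    {e : NegFrame S₀} (he : e.toPlane = β.planeOf hS₀ (isoVec w) (negIso_isoVec hw))
    (ho : e.IsOrthonormal) : ∃ c : ℂ, e.vec 0 = β.reVec (c • isoVec w) ∧
      e.vec 1 = β.imVec (c • isoVec w) ∧
      c.re ^ 2 + c.im ^ 2 = (-formM S₀ (β.reVec (isoVec w)) (β.reVec (isoVec w)))⁻¹ := by
  obtain ⟨h0, h1, h01⟩ := ho
  have hv : NegIso (β.cplx (e.vec 0) (e.vec 1)) := by
    rw [β.negIso_iff, reVec_cplx, imVec_cplx, h0, h1, h01]
    norm_num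
  have hpl : β.planeOf hS₀ _ hv = e.toPlane := by
    rw [planeOf, NegFrame.toPlane_eq_toPlane_iff, frameOf_vec_zero, frameOf_vec_one, reVec_cplx,
      imVec_cplx]
    exact ⟨1, 0, 0, 1, by norm_num, by simp, by simp⟩
  obtain ⟨c, hc, h⟩ := (β.planeOf_eq_iff hS₀ (negIso_isoVec hw) hv).1 (hpl.trans he)
  have e0 : e.vec 0 = β.reVec (c • isoVec w) := by rw [← h, reVec_cplx]
  have e1 : e.vec 1 = β.imVec (c • isoVec w) := by rw [← h, imVec_cplx]
  refine ⟨c, e0, e1, ?_⟩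
  obtain ⟨h2, h3, h4⟩ := (β.negIso_iff _).1 (negIso_isoVec hw)
  have h4' : formM S₀ (β.imVec (isoVec w)) (β.reVec (isoVec w)) = 0 := by rw [formM_comm hS₀, h4]
  rw [e0, reVec_smul] at h0
  simp only [map_add, map_smul, LinearMap.add_apply, LinearMap.smul_apply, smul_eq_mul, h3, h4,
    h4'] at h0
  refine eq_inv_of_mul_eq_one_left ?_
  linarith

theorem projDeriv_complexStructure (hS₀ : S₀.PosDef) {w : Cn (s + 2)} (hw : w ∈ lieBall (s + 2))
    {e : NegFrame S₀} (he : e.toPlane = β.planeOf hS₀ (isoVec w) (negIso_isoVec hw))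
    (ho : e.IsOrthonormal) (ξ : Cn (s + 2)) :
    β.projDeriv w (Complex.I • ξ) (e.vec 0) = -β.projDeriv w ξ (e.vec 1) ∧
    β.projDeriv w (Complex.I • ξ) (e.vec 1) = β.projDeriv w ξ (e.vec 0) := by
  obtain ⟨c, e0, e1, -⟩ := β.exists_smul_of_isOrthonormal hS₀ hw he ho
  rw [e0, e1, reVec_smul, imVec_smul]
  simp only [map_add, map_smul, β.projDeriv_I_reVec hS₀ hw, β.projDeriv_I_imVec hS₀ hw]
  constructor <;> module

theorem metric_eq (hS₀ : S₀.PosDef) {w : Cn (s + 2)} (hw : w ∈ lieBall (s + 2))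
    {e : NegFrame S₀} (he : e.toPlane = β.planeOf hS₀ (isoVec w) (negIso_isoVec hw))
    (ho : e.IsOrthonormal) (ξ η : Cn (s + 2)) :
    β.metric w ξ η = 2 * ((s : ℝ) + 2) *
      (formM S₀ (β.projDeriv w ξ (e.vec 0)) (β.projDeriv w η (e.vec 0)) +
        formM S₀ (β.projDeriv w ξ (e.vec 1)) (β.projDeriv w η (e.vec 1))) := by
  obtain ⟨c, e0, e1, hc⟩ := β.exists_smul_of_isOrthonormal hS₀ hw he ho
  rw [metric_apply, e0, e1, reVec_smul, imVec_smul, ← hc]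
  simp only [map_add, map_smul, LinearMap.add_apply, LinearMap.smul_apply, smul_eq_mul]
  ring

end AdaptedBasis

end Metric

/-! ### The action of the indefinite orthogonal group on the Lie ball -/

section GroupAction

variable {n : ℕ}

/-- Real matrices in the coordinates of an adapted basis. -/
abbrev IMat (n : ℕ) : Type := Matrix (Fin n ⊕ Fin 2) (Fin n ⊕ Fin 2) ℝ

/-- Invertible real matrices in the coordinates of an adapted basis. -/
abbrev IGL (n : ℕ) : Type := GL (Fin n ⊕ Fin 2) ℝ

/-- The Gram matrix `diag(1, …, 1, -1, -1)`. -/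
def etaMat (n : ℕ) : IMat n := LieAlgebra.Orthogonal.indefiniteDiagonal (Fin n) (Fin 2) ℝ

theorem etaMat_eq : etaMat n = Matrix.diagonal (Sum.elim (fun _ => 1) fun _ => -1) := rfl

theorem etaMat_mul_self : etaMat n * etaMat n = 1 := by
  rw [etaMat_eq, Matrix.diagonal_mul_diagonal, ← Matrix.diagonal_one]
  congr 1
  ext i
  rcases i with i | i <;> simp

theorem etaMat_transpose : (etaMat n)ᵀ = etaMat n := by
  rw [etaMat_eq, Matrix.diagonal_transpose]

theorem formR_eq (x y : Fin n ⊕ Fin 2 → ℝ) : formR x y = x ⬝ᵥ etaMat n *ᵥ y := by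
  simp [formR, dotProduct, etaMat_eq, mulVec_diagonal, Fintype.sum_sum_type]
  ring

/-- The indefinite orthogonal group `O(n, 2)`. -/
def indefO (n : ℕ) : Subgroup (IGL n) where
  carrier := {A | (A : IMat n)ᵀ * etaMat n * (A : IMat n) = etaMat n}
  one_mem' := by
    change (1 : IMat n)ᵀ * etaMat n * 1 = etaMat n
    simp
  mul_mem' := by
    intro A B hA hB
    change ((A : IMat n) * (B : IMat n))ᵀ * etaMat n * ((A : IMat n) * (B : IMat n)) = etaMat n
    change (A : IMat n)ᵀ * etaMat n * (A : IMat n) = etaMat n at hA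
    change (B : IMat n)ᵀ * etaMat n * (B : IMat n) = etaMat n at hB
    calc _ = (B : IMat n)ᵀ * ((A : IMat n)ᵀ * etaMat n * (A : IMat n)) * (B : IMat n) := by
          simp only [Matrix.transpose_mul, Matrix.mul_assoc]
      _ = etaMat n := by rw [hA, hB]
  inv_mem' := by
    intro A hA
    change (A : IMat n)ᵀ * etaMat n * (A : IMat n) = etaMat n at hA
    change ((A⁻¹ : IGL n) : IMat n)ᵀ * etaMat n * ((A⁻¹ : IGL n) : IMat n) = etaMat n
    have h : (A : IMat n) * ((A⁻¹ : IGL n) : IMat n) = 1 := A.mul_inv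
    calc _ = ((A⁻¹ : IGL n) : IMat n)ᵀ * ((A : IMat n)ᵀ * etaMat n * (A : IMat n)) *
            ((A⁻¹ : IGL n) : IMat n) := by rw [hA]
      _ = ((A : IMat n) * ((A⁻¹ : IGL n) : IMat n))ᵀ * etaMat n *
            ((A : IMat n) * ((A⁻¹ : IGL n) : IMat n)) := by
          simp only [Matrix.transpose_mul, Matrix.mul_assoc]
      _ = etaMat n := by rw [h]; simp

theorem mem_indefO {A : IGL n} :
    A ∈ indefO n ↔ (A : IMat n)ᵀ * etaMat n * (A : IMat n) = etaMat n := Iff.rfl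

theorem formR_mulVec {A : IGL n} (hA : A ∈ indefO n) (x y : Fin n ⊕ Fin 2 → ℝ) :
    formR ((A : IMat n) *ᵥ x) ((A : IMat n) *ᵥ y) = formR x y := by
  rw [formR_eq, formR_eq, ← Matrix.vecMul_transpose, ← Matrix.dotProduct_mulVec,
    Matrix.mulVec_mulVec, Matrix.mulVec_mulVec, mem_indefO.1 hA]

/-- A real matrix acting on complex vectors. -/
def cAct (A : IMat n) (v : Fin n ⊕ Fin 2 → ℂ) :
    Fin n ⊕ Fin 2 → ℂ := A.map (algebraMap ℝ ℂ) *ᵥ v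

theorem cAct_apply (A : IMat n) (v : Fin n ⊕ Fin 2 → ℂ)
    (i : Fin n ⊕ Fin 2) : cAct A v i = ∑ j, (A i j : ℂ) * v j := rfl

theorem cAct_one (v : Fin n ⊕ Fin 2 → ℂ) : cAct 1 v = v := by
  simp [cAct]

theorem cAct_mul (A B : IMat n) (v : Fin n ⊕ Fin 2 → ℂ) :
    cAct (A * B) v = cAct A (cAct B v) := by
  rw [cAct, Matrix.map_mul, cAct, cAct, Matrix.mulVec_mulVec]

theorem cAct_smul (A : IMat n) (c : ℂ)
    (v : Fin n ⊕ Fin 2 → ℂ) : cAct A (c • v) = c • cAct A v :=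
  Matrix.mulVec_smul _ _ _

theorem cAct_star (A : IMat n) (v : Fin n ⊕ Fin 2 → ℂ) :
    cAct A (star v) = star (cAct A v) := by
  ext i
  simp [cAct_apply]

theorem re_cAct (A : IMat n) (v : Fin n ⊕ Fin 2 → ℂ) :
    (fun i => (cAct A v i).re) = A *ᵥ fun i => (v i).re := by
  ext i
  simp [cAct_apply, mulVec, dotProduct]

theorem im_cAct (A : IMat n) (v : Fin n ⊕ Fin 2 → ℂ) :
    (fun i => (cAct A v i).im) = A *ᵥ fun i => (v i).im := by
  ext i
  simp [cAct_apply, mulVec, dotProduct]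

theorem NegIso.cAct {A : IGL n} (hA : A ∈ indefO n) {v : Fin n ⊕ Fin 2 → ℂ}
    (hv : NegIso v) : NegIso (cAct (A : IMat n) v) := by
  rw [NegIso, bilC_eq_formR, hermC_eq_formR, re_cAct, im_cAct, formR_mulVec hA, formR_mulVec hA,
    formR_mulVec hA, ← bilC_eq_formR, ← hermC_eq_formR]
  exact hv

theorem continuous_cAct : Continuous fun p :
    IMat n × (Fin n ⊕ Fin 2 → ℂ) => cAct p.1 p.2 := by
  refine continuous_pi fun i => ?_
  simp only [cAct_apply]
  fun_prop

/-- The subgroup of `O(n, 2)` that preserves the orientation of the negative planes. -/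
def indefOPlus (n : ℕ) : Subgroup (IGL n) where
  carrier := {A | A ∈ indefO n ∧ ∀ v : Fin n ⊕ Fin 2 → ℂ, NegIso v → 0 < side v →
    0 < side (cAct (A : IMat n) v)}
  one_mem' := ⟨one_mem _, fun v _ hs => by simpa [cAct_one] using hs⟩
  mul_mem' := by
    rintro A B ⟨hA, hA'⟩ ⟨hB, hB'⟩
    refine ⟨mul_mem hA hB, fun v hv hs => ?_⟩
    rw [Units.val_mul, cAct_mul]
    exact hA' _ (hv.cAct hB) (hB' v hv hs)
  inv_mem' := by
    rintro A ⟨hA, hA'⟩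
    refine ⟨inv_mem hA, fun v hv hs => ?_⟩
    have hv' := hv.cAct (inv_mem hA)
    by_contra h
    -- Otherwise the conjugate of `A⁻¹ v` is on the positive side and is mapped by `A` to the
    -- negative side.
    have h1 := hA' (star (cAct ((A⁻¹ : IGL n) : IMat n) v)) hv'.star (by
      rw [side_star]
      exact neg_pos.2 (lt_of_le_of_ne (not_lt.1 h) hv'.side_ne_zero))
    rw [cAct_star, ← cAct_mul, ← Units.val_mul, mul_inv_cancel, Units.val_one, cAct_one,
      side_star] at h1
    linarith

theorem mem_indefOPlus {A : IGL n} : A ∈ indefOPlus n ↔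
    A ∈ indefO n ∧ ∀ v : Fin n ⊕ Fin 2 → ℂ, NegIso v → 0 < side v →
      0 < side (cAct (A : IMat n) v) := Iff.rfl

/-- The action of a matrix on the Lie ball by fractional transformations. -/
def ballMap (A : IMat n) (w : Cn n) : Cn n :=
  affineCoord (cAct A (isoVec w))

theorem side_cAct_isoVec_pos {A : IGL n} (hA : A ∈ indefOPlus n) {w : Cn n}
    (hw : w ∈ lieBall n) : 0 < side (cAct (A : IMat n) (isoVec w)) :=
  (mem_indefOPlus.1 hA).2 _ (negIso_isoVec hw) (side_isoVec_pos hw)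

theorem ballMap_mem {A : IGL n} (hA : A ∈ indefOPlus n) {w : Cn n}
    (hw : w ∈ lieBall n) : ballMap (A : IMat n) w ∈ lieBall n :=
  ((negIso_isoVec hw).cAct (mem_indefOPlus.1 hA).1).affineCoord_mem (side_cAct_isoVec_pos hA hw)

theorem cAct_isoVec {A : IGL n} (hA : A ∈ indefOPlus n) {w : Cn n}
    (hw : w ∈ lieBall n) : cAct (A : IMat n) (isoVec w) =
      nullB (cAct (A : IMat n) (isoVec w)) • isoVec (ballMap (A : IMat n) w) :=
  ((negIso_isoVec hw).cAct (mem_indefOPlus.1 hA).1).eq_smul_isoVec (side_cAct_isoVec_pos hA hw)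

instance : MulAction (indefOPlus n) (lieBall n) where
  smul A w := ⟨ballMap ((A : IGL n) : IMat n) (w : Cn n), ballMap_mem A.2 w.2⟩
  one_smul w := Subtype.ext (by
    change affineCoord (cAct 1 (isoVec (w : Cn n))) = w
    rw [cAct_one, affineCoord_isoVec])
  mul_smul A B w := Subtype.ext (by
    change affineCoord
      (cAct (((A : IGL n) : IMat n) * ((B : IGL n) : IMat n)) (isoVec (w : Cn n))) =
      affineCoord
        (cAct ((A : IGL n) : IMat n) (isoVec (ballMap ((B : IGL n) : IMat n) w)))
    rw [cAct_mul, cAct_isoVec B.2 w.2, cAct_smul, affineCoord_smul]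
    exact nullB_ne_zero (side_cAct_isoVec_pos B.2 w.2))

instance : ContinuousSMul (indefOPlus n) (lieBall n) := by
  refine ⟨?_⟩
  refine Continuous.subtype_mk ?_ _
  have h : Continuous fun p : indefOPlus n × lieBall n =>
      cAct ((p.1 : IGL n) : IMat n) (isoVec (p.2 : Cn n)) := by
    have hi : Continuous (isoVec : Cn n → _) := AdaptedBasis.continuous_isoVec
    have hA : Continuous fun p : indefOPlus n × lieBall n => ((p.1 : IGL n) : IMat n) :=
      Units.continuous_val.comp (continuous_subtype_val.comp continuous_fst)
    exact continuous_cAct.comp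
      (hA.prodMk (hi.comp (continuous_subtype_val.comp continuous_snd)))
  refine (PiLp.continuous_toLp 2 _).comp (continuous_pi fun k => ?_)
  refine Continuous.div (by fun_prop) (by unfold nullB; fun_prop) ?_
  exact fun p => nullB_ne_zero (side_cAct_isoVec_pos p.1.2 p.2.2)

theorem differentiableAt_ballMap {A : IGL n} (hA : A ∈ indefOPlus n) {w : Cn n}
    (hw : w ∈ lieBall n) : DifferentiableAt ℂ (ballMap (A : IMat n)) w := by
  have h : ∀ i, DifferentiableAt ℂ (fun w : Cn n => cAct (A : IMat n) (isoVec w) i) w := by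
    intro i
    simp only [cAct_apply]
    have hi : ∀ j, DifferentiableAt ℂ (fun w : Cn n => isoVec w j) w := fun j =>
      ((hasFDerivAt_pi'.1 (hasFDerivAt_isoVec w)) j).differentiableAt
    fun_prop
  rw [differentiableAt_euclidean]
  intro k
  have hB : DifferentiableAt ℂ (fun w : Cn n => nullB (cAct (A : IMat n) (isoVec w))) w :=
    (h (.inr 0)).sub ((h (.inr 1)).const_mul _)
  have hq := (h (.inl k)).mul (hB.inv (nullB_ne_zero (side_cAct_isoVec_pos hA hw)))
  exact hq.congr_of_eventuallyEq (.of_forall fun _ => div_eq_mul_inv _ _)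

/-- The symmetry of the Lie ball at its centre. -/
def centralSymm (n : ℕ) : IGL n where
  val := etaMat n
  inv := etaMat n
  val_inv := etaMat_mul_self
  inv_val := etaMat_mul_self

theorem cAct_etaMat (v : Fin n ⊕ Fin 2 → ℂ) :
    cAct (etaMat n) v = Sum.elim (fun k => v (.inl k)) (fun j => -v (.inr j)) := by
  ext i
  rcases i with i | i <;>
  simp [cAct, etaMat_eq, Matrix.mulVec_diagonal]

theorem nullB_cAct_etaMat (v : Fin n ⊕ Fin 2 → ℂ) : nullB (cAct (etaMat n) v) = -nullB v := by
  rw [cAct_etaMat]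
  simp [nullB]
  ring

theorem nullA_cAct_etaMat (v : Fin n ⊕ Fin 2 → ℂ) : nullA (cAct (etaMat n) v) = -nullA v := by
  rw [cAct_etaMat]
  simp [nullA]
  ring

theorem centralSymm_mem : centralSymm n ∈ indefOPlus n := by
  refine mem_indefOPlus.2 ⟨?_, fun v _ hs => ?_⟩
  · rw [mem_indefO]
    change (etaMat n)ᵀ * etaMat n * etaMat n = etaMat n
    rw [etaMat_transpose, etaMat_mul_self, Matrix.one_mul]
  · change 0 < side (cAct (etaMat n) v)
    rw [side, nullB_cAct_etaMat, nullA_cAct_etaMat, norm_neg, norm_neg]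
    exact hs

theorem ballMap_centralSymm (w : Cn n) : ballMap (etaMat n) w = -w := by
  ext k
  rw [ballMap]
  simp only [affineCoord, nullB_cAct_etaMat, nullB_isoVec]
  rw [cAct_etaMat]
  simp [div_neg]

/-- An element that fixes the centre of the ball has vanishing upper right block. -/
theorem apply_inl_inr_eq_zero {A : IGL n} (hA : A ∈ indefOPlus n)
    (h : ballMap (A : IMat n) 0 = 0) (k : Fin n) (j : Fin 2) :
    (A : IMat n) (.inl k) (.inr j) = 0 := by
  have h1 := congrFun (cAct_isoVec hA zero_mem_lieBall) (.inl k)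
  rw [h, Pi.smul_apply, isoVec_inl, cAct_apply] at h1
  have hr := congrArg Complex.re h1
  have hi := congrArg Complex.im h1
  simp [Fintype.sum_sum_type, isoVec, dotSq] at hr hi
  fin_cases j
  · exact hr
  · exact hi

/-- An element of the group is determined up to sign by its action on the ball. -/
theorem eq_one_or_neg_one_of_ballMap_eq [NeZero n] {A : IGL n}
    (hA : A ∈ indefOPlus n) (h : ∀ w ∈ lieBall n, ballMap (A : IMat n) w = w) :
    (A : IMat n) = 1 ∨
      (A : IMat n) = -1 := by
  have hfix : ∀ w ∈ lieBall n, ∃ b : ℂ, ∀ i, ∑ j, ((A : IMat n) i j : ℂ) * isoVec w j =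
      b * isoVec w i := by
    intro w hw
    have h1 := cAct_isoVec hA hw
    rw [h w hw] at h1
    exact ⟨_, fun i => congrFun h1 i⟩
  set a := (A : IMat n) with ha
  have hz : dotSq (0 : Cn n) = 0 := by simp [dotSq]
  obtain ⟨b, hb⟩ := hfix 0 zero_mem_lieBall
  have hb' : ∀ i, (a i (.inr 0) : ℂ) * (1 / 2) + a i (.inr 1) * (Complex.I / 2) =
      b * isoVec 0 i := by
    intro i
    rw [← hb i]
    simp [Fintype.sum_sum_type, isoVec, hz]
  -- The centre is fixed, so the upper right block is zero and the lower right one is complex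
  -- linear.
  have hk : ∀ k, a (.inl k) (.inr 0) = 0 ∧ a (.inl k) (.inr 1) = 0 := fun k =>
    have h0 := apply_inl_inr_eq_zero hA (h 0 zero_mem_lieBall) k
    ⟨h0 0, h0 1⟩
  have h0 := hb' (.inr 0)
  have h1 := hb' (.inr 1)
  simp only [isoVec, hz, Sum.elim_inr, cons_val_zero, cons_val_one] at h0 h1
  have h01 : (a (.inr 1) (.inr 0) : ℂ) + a (.inr 1) (.inr 1) * Complex.I =
      Complex.I * (a (.inr 0) (.inr 0) + a (.inr 0) (.inr 1) * Complex.I) := by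
    linear_combination 2 * h1 - 2 * Complex.I * h0
  have e1 : a (.inr 1) (.inr 0) = -a (.inr 0) (.inr 1) := by
    have := congrArg Complex.re h01
    simpa using this
  have e2 : a (.inr 1) (.inr 1) = a (.inr 0) (.inr 0) := by
    have := congrArg Complex.im h01
    simpa using this
  -- The points of the coordinate axes are fixed as well.
  have hd : ∀ k, dotSq (EuclideanSpace.single k (1 / 2) : Cn n) = 1 / 4 := by
    intro k
    rw [dotSq, Finset.sum_eq_single k]
    · simp
      norm_num
    · intro j _ hj
      simp [hj]
    · simp
  have hmem : ∀ k, (EuclideanSpace.single k (1 / 2) : Cn n) ∈ lieBall n := by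
    intro k
    constructor
    · rw [hd]
      simp
      norm_num
    · rw [hd]
      norm_num
  have haxis : ∀ k, ∃ b : ℂ, (∀ j, (a (.inl j) (.inl k) : ℂ) = if j = k then b else 0) ∧
      (∀ j, (a (.inr j) (.inl k) : ℂ) / 2 + a (.inr j) (.inr 0) * (5 / 8) +
        a (.inr j) (.inr 1) * (Complex.I * (3 / 8)) =
          b * ![5 / 8, Complex.I * (3 / 8)] j) := by
    intro k
    obtain ⟨b, hb⟩ := hfix _ (hmem k)
    have hb2 : ∀ i, (a i (.inl k) : ℂ) / 2 + a i (.inr 0) * (5 / 8) +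
        a i (.inr 1) * (Complex.I * (3 / 8)) = b * isoVec (EuclideanSpace.single k (1 / 2)) i := by
      intro i
      rw [← hb i, Fintype.sum_sum_type, Fin.sum_univ_two]
      simp only [isoVec, hd, Sum.elim_inl, Sum.elim_inr, cons_val_zero, cons_val_one]
      rw [Finset.sum_eq_single k]
      · simp
        ring
      · intro j _ hj
        simp [hj]
      · simp
    refine ⟨b, fun j => ?_, fun j => ?_⟩
    · have := hb2 (.inl j)
      rw [(hk j).1, (hk j).2, isoVec_inl] at this
      split_ifs with hjk
      · subst hjk
        simp at this
        linear_combination 2 * this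
      · simp [hjk] at this
        simpa using this
    · rw [hb2]
      congr 1
      fin_cases j
      · change (1 + dotSq _) / 2 = (5 / 8 : ℂ)
        rw [hd]
        norm_num
      · change Complex.I * (1 - dotSq _) / 2 = Complex.I * (3 / 8)
        rw [hd]
        ring
  have hres : ∀ k, a (.inl k) (.inl k) = a (.inr 0) (.inr 0) ∧ a (.inr 0) (.inl k) = 0 ∧
      a (.inr 1) (.inl k) = 0 ∧ a (.inr 0) (.inr 1) = 0 := by
    intro k
    obtain ⟨b, hb1, hb2⟩ := haxis k
    have hbk := hb1 k
    rw [if_pos rfl] at hbk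
    have g0 := hb2 0
    have g1 := hb2 1
    rw [← hbk] at g0 g1
    simp only [cons_val_zero, cons_val_one, e1, e2] at g0 g1
    have g0r := congrArg Complex.re g0
    have g0i := congrArg Complex.im g0
    have g1r := congrArg Complex.re g1
    have g1i := congrArg Complex.im g1
    simp at g0r g0i g1r g1i
    refine ⟨by linarith, by linarith, ?_, by linarith⟩
    rw [g0i] at g1r
    linarith
  have hoff : ∀ j k, j ≠ k → a (.inl j) (.inl k) = 0 := by
    intro j k hjk
    obtain ⟨b, hb1, -⟩ := haxis k
    have := hb1 j
    rw [if_neg hjk] at this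
    exact_mod_cast this
  have hscalar : a = a (.inr 0) (.inr 0) • (1 : IMat n) := by
    have h12 := (hres 0).2.2.2
    ext i j
    rw [Matrix.smul_apply, Matrix.one_apply, smul_eq_mul, mul_ite, mul_one, mul_zero]
    rcases i with i | i <;> rcases j with j | j
    · by_cases hij : i = j
      · subst hij
        simpa using (hres i).1
      · simpa [hij] using hoff i j hij
    · fin_cases j
      · simpa using (hk i).1
      · simpa using (hk i).2
    · fin_cases i
      · simpa using (hres j).2.1
      · simpa using (hres j).2.2.1
    · fin_cases i <;> fin_cases j <;> simp [h12, e1, e2]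
  have horth := mem_indefO.1 (mem_indefOPlus.1 hA).1
  rw [← ha, hscalar] at horth
  have h2 := congrFun (congrFun horth (.inr 0)) (.inr 0)
  simp [etaMat_eq] at h2
  rw [hscalar]
  have h3 : a (.inr 0) (.inr 0) = 1 ∨ a (.inr 0) (.inr 0) = -1 := by
    apply mul_self_eq_one_iff.1
    linarith
  rcases h3 with h3 | h3
  · left
    rw [h3, one_smul]
  · right
    rw [h3, neg_smul, one_smul]

end GroupAction

/-! ### Invariance of the metric under the orthogonal group -/

section Isometry

variable {s : ℕ} {S₀ : Matrix (Fin s) (Fin s) ℝ}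

namespace AdaptedBasis

variable (β : AdaptedBasis S₀)

/-- A matrix in the coordinates of an adapted basis, as an endomorphism of `M_ℝ`. -/
def realAct (A : IMat (s + 2)) : MR s →L[ℝ] MR s :=
  LinearMap.toContinuousLinearMap (β.basis.equivFun.symm.toLinearMap ∘ₗ
    Matrix.mulVecLin A ∘ₗ β.basis.equivFun.toLinearMap)

theorem realAct_apply (A : IMat (s + 2)) (x : MR s) :
    β.realAct A x = β.vecOf (A *ᵥ β.basis.equivFun x) := rfl

theorem realAct_vecOf (A : IMat (s + 2)) (x : Fin (s + 2) ⊕ Fin 2 → ℝ) :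
    β.realAct A (β.vecOf x) = β.vecOf (A *ᵥ x) := by
  rw [realAct_apply, equivFun_vecOf]

theorem formM_realAct {A : IGL (s + 2)} (hA : A ∈ indefO (s + 2)) (x y : MR s) :
    formM S₀ (β.realAct (A : IMat (s + 2)) x) (β.realAct (A : IMat (s + 2)) y) =
      formM S₀ x y := by
  rw [realAct_apply, realAct_apply, formM_vecOf, formR_mulVec hA, ← formM_eq]

theorem reVec_cAct (A : IMat (s + 2)) (v : Fin (s + 2) ⊕ Fin 2 → ℂ) :
    β.reVec (cAct A v) = β.realAct A (β.reVec v) := by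
  rw [reVec, reVec, re_cAct, realAct_vecOf]

theorem imVec_cAct (A : IMat (s + 2)) (v : Fin (s + 2) ⊕ Fin 2 → ℂ) :
    β.imVec (cAct A v) = β.realAct A (β.imVec v) := by
  rw [imVec, imVec, im_cAct, realAct_vecOf]

/-- The projection depends only on the plane, hence only on the isotropic line. -/
theorem projOf_smul (hS₀ : S₀.PosDef) {v v' : Fin (s + 2) ⊕ Fin 2 → ℂ} (hv : NegIso v)
    (hv' : NegIso v') {c : ℂ} (hc : c ≠ 0) (h : v' = c • v) : β.projOf v' = β.projOf v := by
  rw [← β.proj_planeOf hS₀ hv, ← β.proj_planeOf hS₀ hv',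
    (β.planeOf_eq_iff hS₀ hv hv').2 ⟨c, hc, h⟩]

theorem projOf_cAct {A : IGL (s + 2)} (hA : A ∈ indefO (s + 2))
    (v : Fin (s + 2) ⊕ Fin 2 → ℂ) (x : MR s) :
    β.projOf (cAct (A : IMat (s + 2)) v) (β.realAct (A : IMat (s + 2)) x) =
      β.realAct (A : IMat (s + 2)) (β.projOf v x) := by
  simp only [projOf_apply, reVec_cAct, imVec_cAct, β.formM_realAct hA, map_smul, map_add]

theorem projOf_ballMap (hS₀ : S₀.PosDef) {A : IGL (s + 2)} (hA : A ∈ indefOPlus (s + 2))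
    {w : Cn (s + 2)} (hw : w ∈ lieBall (s + 2)) (x : MR s) :
    β.projOf (isoVec (ballMap (A : IMat (s + 2)) w)) (β.realAct (A : IMat (s + 2)) x) =
      β.realAct (A : IMat (s + 2)) (β.projOf (isoVec w) x) := by
  rw [← β.projOf_cAct (mem_indefOPlus.1 hA).1,
    β.projOf_smul hS₀ (negIso_isoVec (ballMap_mem hA hw))
      ((negIso_isoVec hw).cAct (mem_indefOPlus.1 hA).1)
      (nullB_ne_zero (side_cAct_isoVec_pos hA hw)) (cAct_isoVec hA hw)]

/-- The differentiated form of the equivariance of the projections. -/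
theorem projDeriv_ballMap (hS₀ : S₀.PosDef) {A : IGL (s + 2)} (hA : A ∈ indefOPlus (s + 2))
    {w : Cn (s + 2)} (hw : w ∈ lieBall (s + 2)) {F' : Cn (s + 2) →L[ℝ] Cn (s + 2)}
    (hF : HasFDerivAt (ballMap (A : IMat (s + 2))) F' w) (ξ : Cn (s + 2)) (x : MR s) :
    β.projDeriv (ballMap (A : IMat (s + 2)) w) (F' ξ) (β.realAct (A : IMat (s + 2)) x) =
      β.realAct (A : IMat (s + 2)) (β.projDeriv w ξ x) := by
  have h1 := ((β.hasFDerivAt_projOf (ballMap_mem hA hw)).comp w hF).clm_apply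
    (hasFDerivAt_const (β.realAct (A : IMat (s + 2)) x) w)
  have h2 := (β.realAct (A : IMat (s + 2))).hasFDerivAt.comp w
    ((β.hasFDerivAt_projOf hw).clm_apply (hasFDerivAt_const x w))
  have h3 := h1.congr_of_eventuallyEq (Filter.eventuallyEq_iff_exists_mem.2
    ⟨_, isOpen_lieBall.mem_nhds hw, fun y hy => (β.projOf_ballMap hS₀ hA hy x).symm⟩)
  have h4 := congrArg (fun L => L ξ) (h3.unique h2)
  simpa using h4

/-- The metric can be computed with any representative of the isotropic line. -/
theorem metric_eq_of_smul {w : Cn (s + 2)} (hw : w ∈ lieBall (s + 2)) {c : ℂ} (hc : c ≠ 0)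
    (hS₀ : S₀.PosDef) (ξ η : Cn (s + 2)) : β.metric w ξ η =
    (2 * ((s : ℝ) + 2) *
      (-formM S₀ (β.reVec (c • isoVec w)) (β.reVec (c • isoVec w)))⁻¹) *
    (formM S₀ (β.projDeriv w ξ (β.reVec (c • isoVec w)))
        (β.projDeriv w η (β.reVec (c • isoVec w))) +
      formM S₀ (β.projDeriv w ξ (β.imVec (c • isoVec w)))
        (β.projDeriv w η (β.imVec (c • isoVec w)))) := by
  obtain ⟨h2, h3, h4⟩ := (β.negIso_iff _).1 (negIso_isoVec hw)
  have h4' : formM S₀ (β.imVec (isoVec w)) (β.reVec (isoVec w)) = 0 := by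
    rw [formM_comm hS₀, h4]
  have hn : c.re ^ 2 + c.im ^ 2 ≠ 0 := by
    have := Complex.normSq_pos.2 hc
    rw [Complex.normSq_apply] at this
    nlinarith
  rw [metric_apply, reVec_smul, imVec_smul]
  simp only [map_add, map_smul, LinearMap.add_apply, LinearMap.smul_apply, smul_eq_mul, h3, h4,
    h4']
  have hE := h2.ne
  set E := formM S₀ (β.reVec (isoVec w)) (β.reVec (isoVec w))
  have hq : -(c.re * (c.re * E + -c.im * 0) + -c.im * (c.re * 0 + -c.im * E)) =
      (c.re ^ 2 + c.im ^ 2) * -E := by ring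
  rw [hq, mul_inv]
  field_simp
  ring

/-- The orthogonal group acts on the ball by isometries. -/
theorem metric_ballMap (hS₀ : S₀.PosDef) {A : IGL (s + 2)} (hA : A ∈ indefOPlus (s + 2))
    {w : Cn (s + 2)} (hw : w ∈ lieBall (s + 2)) {F' : Cn (s + 2) →L[ℝ] Cn (s + 2)}
    (hF : HasFDerivAt (ballMap (A : IMat (s + 2))) F' w) (ξ η : Cn (s + 2)) :
    β.metric (ballMap (A : IMat (s + 2)) w) (F' ξ) (F' η) = β.metric w ξ η := by
  rw [β.metric_eq_of_smul (ballMap_mem hA hw)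
    (nullB_ne_zero (side_cAct_isoVec_pos hA hw)) hS₀, ← cAct_isoVec hA hw, reVec_cAct, imVec_cAct]
  simp only [β.projDeriv_ballMap hS₀ hA hw hF, β.formM_realAct (mem_indefOPlus.1 hA).1]
  rfl

variable {z₀ : OrientedNegPlane S₀}

/-- The action of the orthogonal group on a component, transported from the ball. -/
def componentAction (hS₀ : S₀.PosDef) (h : connectedComponent z₀ = β.posHalf) :
    indefOPlus (s + 2) →* Equiv.Perm (DComponent z₀) :=
  (β.homeo hS₀ h).symm.toEquiv.permCongrHom.toMonoidHom.comp
    (MulAction.toPermHom (indefOPlus (s + 2)) (lieBall (s + 2)))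

theorem componentAction_apply (hS₀ : S₀.PosDef) (h : connectedComponent z₀ = β.posHalf)
    (A : indefOPlus (s + 2)) (z : DComponent z₀) :
    β.componentAction hS₀ h A z = (β.homeo hS₀ h).symm (A • β.homeo hS₀ h z) := rfl

-- From here on the action is known only through `componentAction_apply`.
attribute [irreducible] componentAction

theorem chart_componentAction (hS₀ : S₀.PosDef) (h : connectedComponent z₀ = β.posHalf)
    (A : indefOPlus (s + 2)) (z : DComponent z₀) :
    β.chart z₀ (β.componentAction hS₀ h A z) =
      ballMap ((A : IGL (s + 2)) : IMat (s + 2)) (β.chart z₀ z) := by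
  rw [componentAction_apply]
  have h1 := (β.homeo hS₀ h).apply_symm_apply (A • β.homeo hS₀ h z)
  exact congrArg Subtype.val h1

theorem continuous_componentAction (hS₀ : S₀.PosDef) (h : connectedComponent z₀ = β.posHalf) :
    Continuous fun p : indefOPlus (s + 2) × DComponent z₀ =>
      β.componentAction hS₀ h p.1 p.2 := by
  simp only [componentAction_apply]
  generalize β.homeo hS₀ h = e
  refine e.symm.continuous.comp (continuous_fst.smul ?_)
  exact e.continuous.comp continuous_snd

/-! ### The Hermitian structure on a component -/

/-- The complex manifold structure on a component given by the global chart. -/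
abbrev chartedSpace (hS₀ : S₀.PosDef) (h : connectedComponent z₀ = β.posHalf) :
    ChartedSpace (Cn (s + 2)) (DComponent z₀) :=
  haveI : Nonempty (DComponent z₀) := ⟨⟨z₀, mem_connectedComponent⟩⟩
  (β.isOpenEmbedding_chart hS₀ h).singletonChartedSpace

theorem isManifold (hS₀ : S₀.PosDef) (h : connectedComponent z₀ = β.posHalf) :
    letI := β.chartedSpace hS₀ h
    IsManifold 𝓘(ℂ, Cn (s + 2)) ω (DComponent z₀) :=
  haveI : Nonempty (DComponent z₀) := ⟨⟨z₀, mem_connectedComponent⟩⟩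
  (β.isOpenEmbedding_chart hS₀ h).isManifold_singleton

/-- The Hermitian metric on a component. -/
def hermitianMetric (hS₀ : S₀.PosDef) (h : connectedComponent z₀ = β.posHalf) :
    letI := β.chartedSpace hS₀ h
    haveI := β.isManifold hS₀ h
    HermitianMetric (s + 2) (DComponent z₀) :=
  letI := β.chartedSpace hS₀ h
  haveI := β.isManifold hS₀ h
  { riem :=
      { inner := fun z => β.metric (β.chart z₀ z)
        symm := fun z => β.metric_symm hS₀ (β.chart z₀ z)
        pos := fun z ξ hξ => β.metric_pos hS₀ (β.chart_mem hS₀ h z) ξ hξ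
        isVonNBounded := fun z => isVonNBounded_of_posDef (β.metric (β.chart z₀ z))
          fun ξ hξ => β.metric_pos hS₀ (β.chart_mem hS₀ h z) ξ hξ
        contMDiff := by
          have : Nonempty (DComponent z₀) := ⟨⟨z₀, mem_connectedComponent⟩⟩
          exact contMDiff_bilinear (β.isOpenEmbedding_chart hS₀ h) β.metric
            (by rw [β.range_chart hS₀ h]; exact β.contDiffOn_metric) _ fun _ _ _ => rfl }
    hermitian := fun z ξ η => β.metric_I hS₀ (β.chart_mem hS₀ h z) ξ η }

theorem isHolomorphicIsometry_componentAction (hS₀ : S₀.PosDef)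
    (h : connectedComponent z₀ = β.posHalf) (A : indefOPlus (s + 2)) :
    letI := β.chartedSpace hS₀ h
    haveI := β.isManifold hS₀ h
    IsHolomorphicIsometry (β.hermitianMetric hS₀ h) (β.componentAction hS₀ h A) := by
  let _ := β.chartedSpace hS₀ h
  have := β.isManifold hS₀ h
  have hne : Nonempty (DComponent z₀) := ⟨⟨z₀, mem_connectedComponent⟩⟩
  have hφ := β.isOpenEmbedding_chart hS₀ h
  have hc (A) : Continuous (β.componentAction hS₀ h A) :=
    Continuous.comp (g := fun p : indefOPlus (s + 2) × DComponent z₀ =>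
      β.componentAction hS₀ h p.1 p.2) (β.continuous_componentAction hS₀ h)
      (Continuous.prodMk_right A)
  have hd (A : indefOPlus (s + 2)) (z) := (differentiableAt_ballMap A.2 (β.chart_mem hS₀ h z))
  have hol (A) : MDifferentiable 𝓘(ℂ, Cn (s + 2)) 𝓘(ℂ, Cn (s + 2))
      (β.componentAction hS₀ h A) := fun z =>
    (hasMFDerivAt_self hφ (hc A) (β.chart_componentAction hS₀ h A)
      (hd A z).hasFDerivAt).mdifferentiableAt
  refine ⟨hol A, ?_, fun z ξ η => ?_⟩
  · have := hol A⁻¹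
    rwa [map_inv] at this
  · have h1 := (hd A z).hasFDerivAt.restrictScalars ℝ
    have h2 := (hasMFDerivAt_self (𝕜 := ℝ) hφ (hc A) (β.chart_componentAction hS₀ h A) h1).mfderiv
    rw [h2]
    change β.metric (β.chart z₀ _) _ _ = _
    rw [chart_componentAction]
    exact β.metric_ballMap hS₀ A.2 (β.chart_mem hS₀ h z) h1 ξ η

theorem isCanonicalStructure (hS₀ : S₀.PosDef) (h : connectedComponent z₀ = β.posHalf) :
    letI := β.chartedSpace hS₀ h
    haveI := β.isManifold hS₀ h
    IsCanonicalStructure hS₀ (β.hermitianMetric hS₀ h) := by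
  let _ := β.chartedSpace hS₀ h
  have := β.isManifold hS₀ h
  have hne : Nonempty (DComponent z₀) := ⟨⟨z₀, mem_connectedComponent⟩⟩
  have hφ := β.isOpenEmbedding_chart hS₀ h
  have hp (z : DComponent z₀) : (z : OrientedNegPlane S₀).proj hS₀ =
      β.projOf (isoVec (β.chart z₀ z)) := by
    rw [← β.proj_planeOf hS₀ (negIso_isoVec (β.chart_mem hS₀ h z)), β.planeOf_chart hS₀ h]
  have hd (z : DComponent z₀) (ξ : TangentSpace 𝓘(ℝ, Cn (s + 2)) z) :
      dProj hS₀ z ξ = β.projDeriv (β.chart z₀ z) ξ := by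
    rw [dProj, (hasMFDerivAt_vector (𝕜 := ℝ) hφ hp
      (β.hasFDerivAt_projOf (β.chart_mem hS₀ h z))).mfderiv]
    rfl
  refine ⟨contMDiff_vector (f₀ := fun w => β.projOf (isoVec w)) hφ hp
    (by rw [β.range_chart hS₀ h]; exact β.contDiffOn_projOf), fun z e he ho ξ => ?_,
    fun z e he ho ξ η => ?_⟩
  · rw [hd, hd]
    exact β.projDeriv_complexStructure hS₀ (β.chart_mem hS₀ h z)
      (he.trans (β.planeOf_chart hS₀ h z).symm) ho ξ
  · rw [hd, hd]
    exact β.metric_eq hS₀ (β.chart_mem hS₀ h z)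
      (he.trans (β.planeOf_chart hS₀ h z).symm) ho ξ η

end AdaptedBasis

end Isometry

/-! ### The identity component of the orthogonal group acts transitively -/

section IdentityComponent

variable {n : ℕ}

/-- The identity component of `O(n, 2)`. -/
def indefOId (n : ℕ) : Subgroup (IGL n) :=
  (Subgroup.connectedComponentOfOne (indefO n)).map (indefO n).subtype

theorem isClosed_indefO : IsClosed (indefO n : Set (IGL n)) := by
  have h : Continuous fun A : IGL n => (A : IMat n)ᵀ * etaMat n * (A : IMat n) := by
    have := Units.continuous_val (M := IMat n)
    fun_prop
  exact isClosed_singleton.preimage h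

theorem coe_indefOId : (indefOId n : Set (IGL n)) =
    Subtype.val '' (connectedComponent (1 : indefO n)) := rfl

theorem isClosed_indefOId : IsClosed (indefOId n : Set (IGL n)) := by
  rw [coe_indefOId]
  exact isClosed_indefO.isClosedEmbedding_subtypeVal.isClosedMap _ isClosed_connectedComponent

theorem isConnected_indefOId : IsConnected (indefOId n : Set (IGL n)) := by
  rw [coe_indefOId]
  exact isConnected_connectedComponent.image _ continuous_subtype_val.continuousOn

theorem indefOId_le : indefOId n ≤ indefO n := by
  rintro _ ⟨A, -, rfl⟩
  exact A.2

theorem mem_indefOId_of_continuous {X : Type*} [TopologicalSpace X] [PreconnectedSpace X]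
    {γ : X → IGL n} (hγ : Continuous γ) (h : ∀ x, γ x ∈ indefO n) {x₀ : X} (h₀ : γ x₀ = 1) (x : X) :
    γ x ∈ indefOId n := by
  have hc : Continuous fun x => (⟨γ x, h x⟩ : indefO n) := hγ.subtype_mk _
  have h1 := (isPreconnected_range hc).subset_connectedComponent (x := 1)
    ⟨x₀, Subtype.ext h₀⟩
  exact ⟨_, h1 ⟨x, rfl⟩, rfl⟩

/-- The side of a negative isotropic vector is never zero, so a connected group preserves it. -/
theorem indefOId_le_indefOPlus : indefOId n ≤ indefOPlus n := by
  intro A hA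
  refine mem_indefOPlus.2 ⟨indefOId_le hA, fun v hv hs => ?_⟩
  by_contra hneg
  have hc : Continuous fun A : IGL n => side (cAct (A : IMat n) v) := by
    have h1 : Continuous fun A : IGL n => cAct (A : IMat n) v :=
      continuous_cAct.comp (Units.continuous_val.prodMk continuous_const)
    unfold side nullA nullB
    fun_prop
  obtain ⟨B, hB, h0⟩ := isConnected_indefOId.isPreconnected.intermediate_value hA
    (one_mem (indefOId n)) hc.continuousOn
    ⟨not_lt.1 hneg, by simpa [cAct_one] using hs.le⟩
  exact (hv.cAct (indefOId_le hB)).side_ne_zero h0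

theorem formR_comm (x y : Fin n ⊕ Fin 2 → ℝ) : formR x y = formR y x := by
  simp only [formR, mul_comm]

theorem formR_add (x y z : Fin n ⊕ Fin 2 → ℝ) : formR x (y + z) = formR x y + formR x z := by
  simp only [formR_eq, mulVec_add, dotProduct_add]

theorem formR_smul (c : ℝ) (x y : Fin n ⊕ Fin 2 → ℝ) : formR x (c • y) = c * formR x y := by
  simp only [formR_eq, mulVec_smul, dotProduct_smul, smul_eq_mul]

theorem formR_sub (x y z : Fin n ⊕ Fin 2 → ℝ) : formR x (y - z) = formR x y - formR x z := by
  simp only [formR_eq, mulVec_sub, dotProduct_sub]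

theorem mem_indefO_iff_formR {A : IGL n} : A ∈ indefO n ↔
    ∀ x y, formR ((A : IMat n) *ᵥ x) ((A : IMat n) *ᵥ y) = formR x y := by
  refine ⟨fun hA => formR_mulVec hA, fun h => mem_indefO.2 ?_⟩
  ext i j
  have := h (Pi.single i 1) (Pi.single j 1)
  rw [formR_eq, formR_eq, ← Matrix.vecMul_transpose, ← Matrix.dotProduct_mulVec,
    Matrix.mulVec_mulVec, Matrix.mulVec_mulVec] at this
  simpa [Matrix.mul_assoc] using this

theorem formR_add_left (x y z : Fin n ⊕ Fin 2 → ℝ) :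
    formR (x + y) z = formR x z + formR y z := by
  simp only [formR_eq, add_dotProduct]

theorem formR_smul_left (c : ℝ) (x y : Fin n ⊕ Fin 2 → ℝ) :
    formR (c • x) y = c * formR x y := by
  simp only [formR_eq, smul_dotProduct, smul_eq_mul]

theorem formR_sub_left (x y z : Fin n ⊕ Fin 2 → ℝ) :
    formR (x - y) z = formR x z - formR y z := by
  simp only [formR_eq, sub_dotProduct]

/-- The matrix of the reflection in the hyperplane orthogonal to `m`. -/
def reflMat (m : Fin n ⊕ Fin 2 → ℝ) : IMat n :=
  1 - (2 * (formR m m)⁻¹) • Matrix.vecMulVec m (etaMat n *ᵥ m)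

theorem reflMat_mulVec (m x : Fin n ⊕ Fin 2 → ℝ) :
    reflMat m *ᵥ x = x - (2 * (formR m m)⁻¹ * formR m x) • m := by
  rw [reflMat, Matrix.sub_mulVec, Matrix.one_mulVec, Matrix.smul_mulVec, formR_comm m x,
    formR_eq x m, Matrix.vecMulVec_mulVec, dotProduct_comm, op_smul_eq_smul, smul_smul]

theorem reflMat_mul_self {m : Fin n ⊕ Fin 2 → ℝ} (hm : formR m m ≠ 0) :
    reflMat m * reflMat m = 1 := by
  refine Matrix.toLin'.injective (LinearMap.ext fun x => ?_)
  rw [Matrix.toLin'_apply, Matrix.toLin'_one, ← Matrix.mulVec_mulVec]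
  simp only [reflMat_mulVec, formR_sub, formR_smul]
  rw [LinearMap.id_apply, sub_sub, ← add_smul, sub_eq_self]
  convert zero_smul ℝ m
  field_simp
  ring

theorem formR_reflMat {m : Fin n ⊕ Fin 2 → ℝ} (hm : formR m m ≠ 0) (x y : Fin n ⊕ Fin 2 → ℝ) :
    formR (reflMat m *ᵥ x) (reflMat m *ᵥ y) = formR x y := by
  simp only [reflMat_mulVec, formR_sub, formR_smul, formR_sub_left, formR_smul_left,
    formR_comm x m]
  field_simp
  ring

/-- The product of the reflections in `f` and `f + f'` maps `f` to `f'`; moving `f'` on a segment to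
zero connects it with the identity. -/
theorem exists_transvection {f f' : Fin n ⊕ Fin 2 → ℝ} (hf : formR f f = -1)
    (hf' : formR f' f' = -1) (hff' : formR f f' < 1) : ∃ A ∈ indefOId n,
      (A : IMat n) *ᵥ f = f' ∧
      ∀ x, formR f x = 0 → formR f' x = 0 → (A : IMat n) *ᵥ x = x := by
  have hsum (t : ℝ) : formR (f + t • f') (f + t • f') = -1 - t ^ 2 + 2 * t * formR f f' := by
    simp only [formR_add, formR_smul, formR_add_left, formR_smul_left, hf, hf', formR_comm f' f]
    ring
  have hne (t : unitInterval) : formR (f + (t : ℝ) • f') (f + (t : ℝ) • f') ≠ 0 := by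
    rw [hsum]
    have h0 := t.2.1
    rcases h0.eq_or_lt with h | h
    · rw [← h]
      norm_num
    · nlinarith [sq_nonneg ((t : ℝ) - 1), mul_pos h (sub_pos.2 hff')]
  have hf0 : formR f f ≠ 0 := by rw [hf]; norm_num
  let γ : unitInterval → IGL n := fun t =>
    { val := reflMat (f + (t : ℝ) • f') * reflMat f
      inv := reflMat f * reflMat (f + (t : ℝ) • f')
      val_inv := by
        rw [Matrix.mul_assoc, ← Matrix.mul_assoc (reflMat f), reflMat_mul_self hf0, Matrix.one_mul,
          reflMat_mul_self (hne t)]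
      inv_val := by
        rw [Matrix.mul_assoc, ← Matrix.mul_assoc (reflMat (f + (t : ℝ) • f')),
          reflMat_mul_self (hne t), Matrix.one_mul, reflMat_mul_self hf0] }
  have hrefl : Continuous fun t : unitInterval => reflMat (f + (t : ℝ) • f') := by
    have h1 : Continuous fun t : unitInterval =>
        (formR (f + (t : ℝ) • f') (f + (t : ℝ) • f'))⁻¹ := by
      refine Continuous.inv₀ ?_ hne
      simp only [hsum]
      fun_prop
    unfold reflMat
    refine continuous_const.sub ((continuous_const.mul h1).smul ?_)
    fun_prop
  have hγ : Continuous γ := by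
    refine Units.continuous_iff.2 ⟨?_, ?_⟩
    · exact hrefl.mul continuous_const
    · exact continuous_const.mul hrefl
  have hval (t : unitInterval) (x) : (γ t : IMat n) *ᵥ x =
      reflMat (f + (t : ℝ) • f') *ᵥ (reflMat f *ᵥ x) := (Matrix.mulVec_mulVec _ _ _).symm
  refine ⟨γ 1, mem_indefOId_of_continuous hγ (fun t => mem_indefO_iff_formR.2 fun x y => ?_)
    (x₀ := 0) ?_ 1, ?_, fun x hx hx' => ?_⟩
  · rw [hval, hval, formR_reflMat (hne t), formR_reflMat hf0]
  · refine Units.ext ?_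
    change reflMat (f + (0 : ℝ) • f') * reflMat f = 1
    rw [zero_smul, add_zero, reflMat_mul_self hf0]
  · rw [hval]
    have h1 := hsum 1
    rw [one_smul] at h1
    have h2 : (-1 - 1 + 2 * formR f f') ≠ 0 := by linarith
    simp only [reflMat_mulVec, Set.Icc.coe_one, one_smul, h1, hf, formR_sub, formR_smul,
      formR_add_left, formR_comm f' f]
    have h3 : 2 * (-1 - 1 ^ 2 + 2 * 1 * formR f f')⁻¹ *
        ((-1 + formR f f') - 2 * (-1)⁻¹ * -1 * (-1 + formR f f')) = -1 := by
      have : (-1 - 1 ^ 2 + 2 * 1 * formR f f') ≠ 0 := by linarith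
      field_simp
      ring
    rw [h3]
    norm_num
    module
  · rw [hval]
    simp [reflMat_mulVec, hx, hx', formR_add_left]

theorem isoVec_zero : isoVec (0 : Cn n) = fun i =>
    ((1 / 2 * (Pi.single (.inr 0) 1 : Fin n ⊕ Fin 2 → ℝ) i : ℝ) : ℂ) +
      ((1 / 2 * (Pi.single (.inr 1) 1 : Fin n ⊕ Fin 2 → ℝ) i : ℝ) : ℂ) * Complex.I := by
  ext i
  rcases i with i | i
  · simp [isoVec]
  · fin_cases i <;> simp [isoVec, dotSq, div_eq_inv_mul]

theorem NegIso.formR_re_im {v : Fin n ⊕ Fin 2 → ℂ} (hv : NegIso v) :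
    formR (fun i => (v i).re) (fun i => (v i).re) < 0 ∧
    formR (fun i => (v i).im) (fun i => (v i).im) =
      formR (fun i => (v i).re) (fun i => (v i).re) ∧
    formR (fun i => (v i).re) (fun i => (v i).im) = 0 := by
  obtain ⟨h1, h2⟩ := hv
  rw [hermC_eq_formR] at h2
  rw [bilC_eq_formR] at h1
  have hr := congrArg Complex.re h1
  have hi := congrArg Complex.im h1
  simp at hr hi
  exact ⟨by linarith, by linarith, hi⟩

theorem side_eq_re (v : Fin n ⊕ Fin 2 → ℂ) :
    side v = 4 * (Complex.I * star (v (.inr 1)) * v (.inr 0)).re := by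
  rw [side, nullA, nullB, ← Complex.normSq_eq_norm_sq, ← Complex.normSq_eq_norm_sq,
    Complex.normSq_apply, Complex.normSq_apply]
  simp
  ring

/-- A negative isotropic vector on the positive side has a multiple with orthonormal real and
imaginary part the real part of which has negative coordinates `(c, 0)` with `c > 0`. -/
theorem exists_normalized_smul {v : Fin n ⊕ Fin 2 → ℂ} (hv : NegIso v) (hs : 0 < side v) :
    ∃ c : ℂ, c ≠ 0 ∧ 0 < ((c • v) (.inr 0)).re ∧ ((c • v) (.inr 1)).re = 0 ∧
      formR (fun i => ((c • v) i).re) (fun i => ((c • v) i).re) = -1 := by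
  -- This factor makes the last coordinate purely imaginary; by `side_eq_re` the one before it gets
  -- positive real part.
  set c := Complex.I * star (v (.inr 1)) with hc
  have h0 : 0 < ((c • v) (.inr 0)).re := by
    rw [side_eq_re] at hs
    rw [Pi.smul_apply, smul_eq_mul]
    linarith
  have h1 : ((c • v) (.inr 1)).re = 0 := by
    simp [hc]
    ring
  have hc0 : c ≠ 0 := by
    intro h
    simp [h] at h0
  have hE := (hv.smul hc0).formR_re_im.1
  set E := formR (fun i => ((c • v) i).re) (fun i => ((c • v) i).re) with hEdef
  have hr : 0 < (Real.sqrt (-E))⁻¹ := inv_pos.2 (Real.sqrt_pos.2 (neg_pos.2 hE))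
  have hre (i) : (((((Real.sqrt (-E))⁻¹ : ℝ) * c : ℂ) • v) i).re =
      (Real.sqrt (-E))⁻¹ * ((c • v) i).re := by
    rw [mul_smul, Pi.smul_apply, smul_eq_mul, Complex.re_ofReal_mul]
  refine ⟨((Real.sqrt (-E))⁻¹ : ℝ) * c, mul_ne_zero (Complex.ofReal_ne_zero.2 hr.ne') hc0, ?_, ?_,
    ?_⟩
  · rw [hre]
    positivity
  · rw [hre, h1, mul_zero]
  · have h2 : (fun i => (((((Real.sqrt (-E))⁻¹ : ℝ) * c : ℂ) • v) i).re) =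
        (Real.sqrt (-E))⁻¹ • fun i => ((c • v) i).re := funext hre
    rw [h2, formR_smul, formR_smul_left, ← hEdef, ← mul_assoc, ← mul_inv,
      Real.mul_self_sqrt (neg_pos.2 hE).le]
    have := hE.ne
    field_simp

/-- The group acts transitively: an isotropic vector in the given line is chosen whose real part `f`
has negative coordinates `(c, 0)` with `c > 0`, a first transvection maps the first negative basis
vector to `f`, and a second one, fixing that basis vector, adjusts the imaginary part. -/
theorem exists_ballMap_zero_eq {w : Cn n} (hw : w ∈ lieBall n) :
    ∃ A ∈ indefOId n, ballMap (A : IMat n) 0 = w := by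
  obtain ⟨c, hc, hpos, hzero, hnorm⟩ := exists_normalized_smul (negIso_isoVec hw)
    (side_isoVec_pos hw)
  set v := c • isoVec w with hvdef
  have hv : NegIso v := (negIso_isoVec hw).smul hc
  have hs : 0 < side v := by
    rw [hvdef, side_smul]
    have := side_isoVec_pos hw
    positivity
  obtain ⟨-, h2, h3⟩ := hv.formR_re_im
  set f₀ : Fin n ⊕ Fin 2 → ℝ := fun i => (v i).re with hf₀
  set f₁ : Fin n ⊕ Fin 2 → ℝ := fun i => (v i).im with hf₁
  have he (j : Fin 2) (x) : formR (Pi.single (.inr j) 1 : Fin n ⊕ Fin 2 → ℝ) x = -x (.inr j) := by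
    fin_cases j <;> simp [formR]
  obtain ⟨A₁, hA₁, hA₁f, -⟩ := exists_transvection (f := Pi.single (.inr 0) 1) (f' := f₀)
    (by rw [he]; simp) hnorm (by rw [he]; exact (neg_lt_zero.2 hpos).trans one_pos)
  have hinv (x) : (A₁ : IMat n) *ᵥ ((A₁⁻¹ : IGL n) : IMat n) *ᵥ x = x := by
    rw [Matrix.mulVec_mulVec, ← Units.val_mul, mul_inv_cancel, Units.val_one, Matrix.one_mulVec]
  have hinv' (x) : ((A₁⁻¹ : IGL n) : IMat n) *ᵥ (A₁ : IMat n) *ᵥ x = x := by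
    rw [Matrix.mulVec_mulVec, ← Units.val_mul, inv_mul_cancel, Units.val_one, Matrix.one_mulVec]
  have hO := indefOId_le (inv_mem hA₁)
  have hAf₀ : ((A₁⁻¹ : IGL n) : IMat n) *ᵥ f₀ = Pi.single (.inr 0) 1 := by rw [← hA₁f, hinv']
  set u := ((A₁⁻¹ : IGL n) : IMat n) *ᵥ f₁ with hu
  have hu0 : u (.inr 0) = 0 := by
    have := formR_mulVec hO f₀ f₁
    rw [hAf₀, he, h3] at this
    exact neg_eq_zero.1 this
  -- As the group preserves the orientation, `u` is on the side of the second negative basis vector.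
  have hu1 : 0 < u (.inr 1) := by
    have h4 := (mem_indefOPlus.1 (indefOId_le_indefOPlus (inv_mem hA₁))).2 v hv hs
    have hre := re_cAct ((A₁⁻¹ : IGL n) : IMat n) v
    have him := im_cAct ((A₁⁻¹ : IGL n) : IMat n) v
    rw [← hf₀, hAf₀] at hre
    rw [← hf₁, ← hu] at him
    have e00 := congrFun hre (.inr 0)
    have e10 := (congrFun him (.inr 0)).trans hu0
    have e11 := congrFun him (.inr 1)
    rw [Pi.single_eq_same] at e00
    rw [side_eq_re] at h4
    have h5 : cAct ((A₁⁻¹ : IGL n) : IMat n) v (.inr 0) = 1 := Complex.ext e00 e10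
    have h6 (z : ℂ) : (Complex.I * star z * 1).re = z.im := by simp
    rw [h5, h6, e11] at h4
    linarith
  obtain ⟨A₂, hA₂, hA₂f, hA₂'⟩ := exists_transvection (f := Pi.single (.inr 1) 1) (f' := u)
    (by rw [he]; simp) (by rw [hu, formR_mulVec hO, h2, hnorm]) (by rw [he]; linarith)
  have hA₂0 : (A₂ : IMat n) *ᵥ Pi.single (.inr 0) 1 = Pi.single (.inr 0) 1 :=
    hA₂' _ (by rw [he]; simp) (by rw [formR_comm, he, hu0, neg_zero])
  refine ⟨A₁ * A₂, mul_mem hA₁ hA₂, ?_⟩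
  have hact : cAct ((A₁ * A₂ : IGL n) : IMat n) (isoVec 0) = (1 / 2 : ℂ) • v := by
    have hre := re_cAct ((A₁ * A₂ : IGL n) : IMat n) (isoVec 0)
    have him := im_cAct ((A₁ * A₂ : IGL n) : IMat n) (isoVec 0)
    have e0 : (fun i => (isoVec (0 : Cn n) i).re) = (1 / 2 : ℝ) • Pi.single (.inr 0) 1 := by
      rw [isoVec_zero]
      ext i
      simp
    have e1 : (fun i => (isoVec (0 : Cn n) i).im) = (1 / 2 : ℝ) • Pi.single (.inr 1) 1 := by
      rw [isoVec_zero]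
      ext i
      simp
    rw [e0, Matrix.mulVec_smul, Units.val_mul, ← Matrix.mulVec_mulVec, hA₂0, hA₁f] at hre
    rw [e1, Matrix.mulVec_smul, Units.val_mul, ← Matrix.mulVec_mulVec, hA₂f, hinv] at him
    ext i
    apply Complex.ext
    · simpa [hf₀] using congrFun hre i
    · simpa [hf₁] using congrFun him i
  rw [ballMap, hact, affineCoord_smul (by norm_num), hvdef, affineCoord_smul hc, affineCoord_isoVec]

end IdentityComponent

/-! ### The Lie algebra of the orthogonal group -/

section LieAlgebra

attribute [local instance] LieRing.ofAssociativeRing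

/-- If an endomorphism `S` is adjoint to `T` for an inner product, then `S ∘ T` has positive
trace unless `T = 0`. -/
theorem trace_comp_pos_of_adjoint {W : Type*} [AddCommGroup W] [Module ℝ W] [FiniteDimensional ℝ W]
    (B : LinearMap.BilinForm ℝ W) (hB : ∀ x y, B x y = B y x) (hpos : ∀ x, x ≠ 0 → 0 < B x x)
    {S T : W →ₗ[ℝ] W} (h : ∀ x y, B x (S y) = B (T x) y) (hT : T ≠ 0) :
    0 < LinearMap.trace ℝ W (S ∘ₗ T) := by
  obtain ⟨b, hb⟩ := exists_orthonormal_basis B hB hpos rfl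
  have hrepr (x : W) (i) : b.repr x i = B (b i) x := by
    conv_rhs => rw [← b.sum_repr x, map_sum]
    simp [map_smul, hb, -Basis.sum_repr]
  have htr : LinearMap.trace ℝ W (S ∘ₗ T) = ∑ i, B (T (b i)) (T (b i)) := by
    rw [LinearMap.trace_eq_matrix_trace ℝ b, Matrix.trace]
    refine Finset.sum_congr rfl fun i _ => ?_
    rw [Matrix.diag_apply, LinearMap.toMatrix_apply, hrepr, LinearMap.comp_apply, h]
  have hnn (x : W) : 0 ≤ B x x := by
    by_cases hx : x = 0
    · simp [hx]
    · exact (hpos x hx).le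
  rw [htr]
  refine (Finset.sum_nonneg fun i _ => hnn _).lt_of_ne fun h0 => hT (b.ext fun i => ?_)
  have h1 := (Finset.sum_eq_zero_iff_of_nonneg fun i _ => hnn _).1 h0.symm i (Finset.mem_univ i)
  by_contra h2
  exact (hpos _ h2).ne' h1

variable {n : ℕ}

/-- The Lie algebra of `O(n, 2)`. -/
abbrev indefSo (n : ℕ) : LieSubalgebra ℝ (IMat n) := LieAlgebra.Orthogonal.so' (Fin n) (Fin 2) ℝ

theorem mem_indefSo {X : IMat n} : X ∈ indefSo n ↔ Xᵀ * etaMat n = -(etaMat n * X) := by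
  refine (mem_skewAdjointMatricesLieSubalgebra _ X).trans ?_
  rw [mem_skewAdjointMatricesSubmodule, Matrix.IsSkewAdjoint, Matrix.IsAdjointPair, Matrix.mul_neg]
  rfl

theorem transpose_mem_indefSo {X : IMat n} (hX : X ∈ indefSo n) : Xᵀ ∈ indefSo n := by
  rw [mem_indefSo] at hX ⊢
  have h := congrArg (fun Y => etaMat n * Y * etaMat n) hX
  simp only [Matrix.mul_neg, Matrix.neg_mul] at h
  rw [Matrix.mul_assoc, Matrix.mul_assoc, etaMat_mul_self, Matrix.mul_one, ← Matrix.mul_assoc,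
    etaMat_mul_self, Matrix.one_mul] at h
  rw [Matrix.transpose_transpose, h, neg_neg]

theorem etaMat_conj {X : IMat n} (hX : X ∈ indefSo n) : etaMat n * X * etaMat n = -Xᵀ := by
  rw [← neg_eq_iff_eq_neg, ← Matrix.neg_mul, ← mem_indefSo.1 hX, Matrix.mul_assoc, etaMat_mul_self,
    Matrix.mul_one]

/-- The inner product `tr(Xᵀ Y)` on the Lie algebra. -/
def traceForm (n : ℕ) : LinearMap.BilinForm ℝ (indefSo n) :=
  LinearMap.mk₂ ℝ (fun X Y => ((X : IMat n)ᵀ * (Y : IMat n)).trace)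
    (fun X Y Z => by simp [Matrix.add_mul]) (fun c X Y => by simp)
    (fun X Y Z => by simp [Matrix.mul_add]) (fun c X Y => by simp)

theorem traceForm_apply (X Y : indefSo n) :
    traceForm n X Y = ((X : IMat n)ᵀ * (Y : IMat n)).trace := rfl

theorem traceForm_comm (X Y : indefSo n) : traceForm n X Y = traceForm n Y X := by
  rw [traceForm_apply, traceForm_apply, ← Matrix.trace_transpose, Matrix.transpose_mul,
    Matrix.transpose_transpose]

theorem traceForm_pos (X : indefSo n) (hX : X ≠ 0) : 0 < traceForm n X X := by
  have h : traceForm n X X = ∑ j, ∑ i, (X : IMat n) i j ^ 2 := by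
    simp [traceForm_apply, Matrix.trace, Matrix.mul_apply, sq]
  rw [h]
  refine (Finset.sum_nonneg fun j _ => Finset.sum_nonneg fun i _ => sq_nonneg _).lt_of_ne
    fun h0 => hX (Subtype.ext (Matrix.ext fun i j => ?_))
  have h1 := (Finset.sum_eq_zero_iff_of_nonneg fun j _ =>
    Finset.sum_nonneg fun i _ => sq_nonneg _).1 h0.symm j (Finset.mem_univ j)
  have h2 := (Finset.sum_eq_zero_iff_of_nonneg fun i _ => sq_nonneg _).1 h1 i (Finset.mem_univ i)
  exact pow_eq_zero_iff two_ne_zero |>.1 h2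

/-- The transpose of an element of the Lie algebra. -/
def soTranspose (X : indefSo n) : indefSo n := ⟨(X : IMat n)ᵀ, transpose_mem_indefSo X.2⟩

/-- For the trace form, `ad Xᵀ` is the adjoint of `ad X`. -/
theorem traceForm_lie (X Y Z : indefSo n) :
    traceForm n Y ⁅X, Z⁆ = traceForm n ⁅soTranspose X, Y⁆ Z := by
  have h : (((soTranspose X : indefSo n) : IMat n)) = (X : IMat n)ᵀ := rfl
  simp only [traceForm_apply, LieSubalgebra.coe_bracket, LieRing.of_associative_ring_bracket, h,
    Matrix.transpose_sub, Matrix.transpose_mul, Matrix.transpose_transpose, Matrix.mul_sub,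
    Matrix.sub_mul, Matrix.trace_sub, Matrix.mul_assoc]
  rw [← Matrix.mul_assoc (Y : IMat n)ᵀ (Z : IMat n), Matrix.trace_mul_comm (_ * _) (X : IMat n)]

/-- The Lie algebra is spanned by the matrices `(E i j - E j i) η`. -/
theorem single_mem_indefSo (i j : Fin n ⊕ Fin 2) :
    (Matrix.single i j 1 - Matrix.single j i 1) * etaMat n ∈ indefSo n := by
  rw [mem_indefSo]
  simp only [Matrix.transpose_mul, Matrix.transpose_sub, Matrix.transpose_single,
    etaMat_transpose]
  rw [Matrix.mul_assoc, ← Matrix.mul_neg, ← Matrix.neg_mul, neg_sub]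

/-- The centre of the Lie algebra is trivial: if `X` commutes with `(E i j - E j i) η`, then the
entries of `X` in the rows `i`, `j` and the other columns vanish. -/
theorem eq_zero_of_forall_lie_eq_zero [NeZero n] {X : indefSo n} (h : ∀ Y : indefSo n, ⁅X, Y⁆ = 0) :
    X = 0 := by
  refine Subtype.ext (Matrix.ext fun i k => ?_)
  change (X : IMat n) i k = 0
  by_cases hik : i = k
  · subst hik
    have h1 := congrFun (congrFun (mem_indefSo.1 X.2) i) i
    rw [etaMat_eq, Matrix.mul_diagonal, Matrix.neg_apply, Matrix.diagonal_mul,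
      Matrix.transpose_apply] at h1
    rcases i with i | i <;> simp at h1 <;> linarith
  · obtain ⟨j, hji, hjk⟩ : ∃ j, j ≠ i ∧ j ≠ k := by
      have hc : 2 < Fintype.card (Fin n ⊕ Fin 2) := by
        have := NeZero.pos n
        simp only [Fintype.card_sum, Fintype.card_fin]
        omega
      obtain ⟨a, ha⟩ := Finset.exists_mem_notMem_of_card_lt_card (s := {i, k}) (t := Finset.univ)
        (Finset.card_le_two.trans_lt hc)
      simp only [Finset.mem_insert, Finset.mem_singleton, not_or] at ha
      exact ⟨a, ha.2⟩
    have h1 := congrArg (fun Y : indefSo n => (Y : IMat n) j k)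
      (h ⟨_, single_mem_indefSo i j⟩)
    simp only [LieSubalgebra.coe_bracket, LieRing.of_associative_ring_bracket, etaMat_eq] at h1
    rw [Matrix.sub_apply, ← Matrix.mul_assoc, Matrix.mul_diagonal, Matrix.mul_assoc] at h1
    simp only [Matrix.mul_sub, Matrix.sub_mul, Matrix.sub_apply] at h1
    rw [Matrix.mul_single_apply_of_ne _ _ _ _ _ hjk.symm,
      Matrix.mul_single_apply_of_ne _ _ _ _ _ (Ne.symm hik),
      Matrix.single_mul_apply_of_ne _ _ _ _ _ hji, Matrix.single_mul_apply_same,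
      Matrix.diagonal_mul] at h1
    rcases i with i | i <;> simpa using h1

/-- The Killing form of `X` and `Xᵀ` is the squared norm of `ad Xᵀ` for the trace form. -/
theorem killingForm_soTranspose_pos [NeZero n] {X : indefSo n} (hX : X ≠ 0) :
    0 < killingForm ℝ (indefSo n) X (soTranspose X) := by
  rw [killingForm_apply_apply]
  refine trace_comp_pos_of_adjoint (traceForm n) traceForm_comm traceForm_pos
    (fun Y Z => traceForm_lie X Y Z) fun h => hX ?_
  have h1 : soTranspose X = 0 :=
    eq_zero_of_forall_lie_eq_zero fun Y => LinearMap.congr_fun h Y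
  have h2 := congrArg (fun Y : indefSo n => (Y : IMat n)ᵀ) h1
  refine Subtype.ext ?_
  simpa [soTranspose] using h2

theorem isSemisimple_indefSo [NeZero n] : LieAlgebra.IsSemisimple ℝ (indefSo n) := by
  have : LieAlgebra.IsKilling ℝ (indefSo n) := by
    refine ⟨(LieSubmodule.eq_bot_iff _).2 fun X hX => ?_⟩
    by_contra hne
    have h1 := (LieIdeal.mem_killingCompl ℝ (indefSo n) ⊤).1 hX (soTranspose X)
      (LieSubmodule.mem_top _)
    rw [LieModule.traceForm_comm] at h1
    exact (killingForm_soTranspose_pos hne).ne' h1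
  infer_instance

end LieAlgebra

/-! ### One-parameter subgroups and the Cartan involutions -/

section Exponential

attribute [local instance] LieRing.ofAssociativeRing

variable {n : ℕ}

open scoped Matrix.Norms.Operator in
theorem hasDerivAt_exp_smul_apply (X : IMat n) (i j : Fin n ⊕ Fin 2) :
    HasDerivAt (fun t : ℝ => NormedSpace.exp (t • X) i j) (X i j) 0 := by
  have h := hasDerivAt_exp_smul_const (𝕂 := ℝ) X 0
  rw [zero_smul, NormedSpace.exp_zero, Matrix.one_mul] at h
  exact hasDerivAt_pi.1 (hasDerivAt_pi.1 h i) j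

open scoped Matrix.Norms.Operator in
theorem continuous_exp_smul (X : IMat n) : Continuous fun t : ℝ => NormedSpace.exp (t • X) :=
  NormedSpace.exp_continuous.comp (continuous_id.smul continuous_const)

theorem exp_mul_exp_neg (X : IMat n) : NormedSpace.exp X * NormedSpace.exp (-X) = 1 := by
  rw [← Matrix.exp_add_of_commute _ _ (Commute.refl X).neg_right, add_neg_cancel,
    NormedSpace.exp_zero]

/-- The exponential as an invertible matrix. -/
def expGL (X : IMat n) : IGL n where
  val := NormedSpace.exp X
  inv := NormedSpace.exp (-X)
  val_inv := exp_mul_exp_neg X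
  inv_val := by simpa using exp_mul_exp_neg (-X)

theorem continuous_expGL (X : IMat n) : Continuous fun t : ℝ => expGL (t • X) := by
  refine Units.continuous_iff.2 ⟨continuous_exp_smul X, ?_⟩
  have := continuous_exp_smul (-X)
  simp only [smul_neg] at this
  exact this

theorem transpose_mul_etaMat {A : IGL n} (hA : A ∈ indefO n) :
    (A : IMat n)ᵀ * etaMat n = etaMat n * ((A⁻¹ : IGL n) : IMat n) := by
  have h : (A : IMat n) * ((A⁻¹ : IGL n) : IMat n) = 1 := A.mul_inv
  rw [← mem_indefO.1 hA, Matrix.mul_assoc _ (A : IMat n), h, Matrix.mul_one, mem_indefO.1 hA]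

theorem expGL_mem_indefO {X : IMat n} (hX : X ∈ indefSo n) : expGL X ∈ indefO n := by
  rw [mem_indefO]
  change (NormedSpace.exp X)ᵀ * etaMat n * NormedSpace.exp X = etaMat n
  have hu : IsUnit (etaMat n) := (centralSymm n).isUnit
  have hinv : (etaMat n)⁻¹ = etaMat n := Matrix.inv_eq_left_inv etaMat_mul_self
  have h1 := Matrix.exp_conj (etaMat n) X hu
  rw [hinv, etaMat_conj hX] at h1
  have h2 : etaMat n * NormedSpace.exp X = NormedSpace.exp (-Xᵀ) * etaMat n := by
    rw [h1, Matrix.mul_assoc, etaMat_mul_self, Matrix.mul_one]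
  rw [Matrix.mul_assoc, h2, ← Matrix.mul_assoc, ← Matrix.exp_transpose, exp_mul_exp_neg,
    Matrix.one_mul]

theorem isLieAlgebraOf_indefSo : IsLieAlgebraOf (indefOId n) (indefSo n) := by
  intro X
  constructor
  · intro hX t
    exact ⟨⟨_, mem_indefOId_of_continuous (continuous_expGL X)
      (fun t => expGL_mem_indefO (Submodule.smul_mem _ t hX)) (x₀ := 0)
      (Units.ext (by simp [expGL])) t⟩, rfl⟩
  · intro h
    -- Differentiate `exp(t X)ᵀ η = η exp(-t X)` at `t = 0`.
    have h1 (t : ℝ) : (NormedSpace.exp (t • X))ᵀ * etaMat n =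
        etaMat n * NormedSpace.exp (t • -X) := by
      obtain ⟨a, ha⟩ := h t
      have h2 := transpose_mul_etaMat (indefOId_le a.2)
      have h3 : (a : IGL n) = expGL (t • X) := Units.ext ha
      rw [h3] at h2
      rw [smul_neg]
      exact h2
    rw [mem_indefSo]
    ext i j
    rw [etaMat_eq, Matrix.mul_diagonal, Matrix.neg_apply, Matrix.diagonal_mul,
      Matrix.transpose_apply, ← mul_neg]
    refine ((hasDerivAt_exp_smul_apply X j i).mul_const _).unique ?_
    refine ((hasDerivAt_exp_smul_apply (-X) i j).const_mul _).congr_of_eventuallyEq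
      (.of_forall fun t => ?_)
    have h2 := congrFun (congrFun (h1 t) i) j
    rw [etaMat_eq, Matrix.mul_diagonal, Matrix.diagonal_mul, Matrix.transpose_apply] at h2
    exact h2

theorem conj_mem_indefSo {A : IGL n} (hA : A ∈ indefO n) {X : IMat n} (hX : X ∈ indefSo n) :
    (A : IMat n) * X * ((A⁻¹ : IGL n) : IMat n) ∈ indefSo n := by
  rw [mem_indefSo] at hX ⊢
  have h1 := transpose_mul_etaMat hA
  have h2 := transpose_mul_etaMat (inv_mem hA)
  rw [inv_inv] at h2
  rw [Matrix.transpose_mul, Matrix.transpose_mul, Matrix.mul_assoc, Matrix.mul_assoc, h1,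
    ← Matrix.mul_assoc Xᵀ, hX, Matrix.neg_mul, Matrix.mul_neg, Matrix.mul_assoc (etaMat n),
    ← Matrix.mul_assoc, h2]
  simp only [Matrix.mul_assoc]

/-- The adjoint action of the orthogonal group on its Lie algebra. -/
def soConj (A : IGL n) (hA : A ∈ indefO n) : indefSo n ≃ₗ⁅ℝ⁆ indefSo n where
  toFun X := ⟨_, conj_mem_indefSo hA X.2⟩
  invFun X := ⟨_, conj_mem_indefSo (inv_mem hA) X.2⟩
  map_add' X Y := Subtype.ext (by simp [Matrix.mul_add, Matrix.add_mul])
  map_smul' c X := Subtype.ext (by simp)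
  map_lie' {X Y} := Subtype.ext (by
    have h : ((A⁻¹ : IGL n) : IMat n) * (A : IMat n) = 1 := A.inv_mul
    have h' (Z : IMat n) : ((A⁻¹ : IGL n) : IMat n) * ((A : IMat n) * Z) = Z := by
      rw [← Matrix.mul_assoc, h, Matrix.one_mul]
    simp only [LieSubalgebra.coe_bracket, LieRing.of_associative_ring_bracket, Matrix.mul_sub,
      Matrix.sub_mul, Matrix.mul_assoc, h'])
  left_inv X := Subtype.ext (by
    have h : ((A⁻¹ : IGL n) : IMat n) * (A : IMat n) = 1 := A.inv_mul
    change ((A⁻¹ : IGL n) : IMat n) * ((A : IMat n) * X * ((A⁻¹ : IGL n) : IMat n)) * _ = X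
    rw [inv_inv, ← Matrix.mul_assoc, ← Matrix.mul_assoc, h, Matrix.one_mul, Matrix.mul_assoc, h,
      Matrix.mul_one])
  right_inv X := Subtype.ext (by
    have h : (A : IMat n) * ((A⁻¹ : IGL n) : IMat n) = 1 := A.mul_inv
    change (A : IMat n) * (((A⁻¹ : IGL n) : IMat n) * X * ((A⁻¹⁻¹ : IGL n) : IMat n)) * _ = X
    rw [inv_inv, ← Matrix.mul_assoc, ← Matrix.mul_assoc, h, Matrix.one_mul, Matrix.mul_assoc, h,
      Matrix.mul_one])

theorem coe_soConj {A : IGL n} (hA : A ∈ indefO n) (X : indefSo n) :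
    (soConj A hA X : IMat n) = (A : IMat n) * X * ((A⁻¹ : IGL n) : IMat n) := rfl

theorem exp_soConj {A : IGL n} (hA : A ∈ indefO n) (t : ℝ) (X : indefSo n) :
    NormedSpace.exp (t • (soConj A hA X : IMat n)) =
      (A : IMat n) * NormedSpace.exp (t • (X : IMat n)) * ((A⁻¹ : IGL n) : IMat n) := by
  rw [coe_soConj, ← Matrix.exp_units_conj, Matrix.mul_smul, Matrix.smul_mul]

/-- The elements of the identity component as elements of `indefOPlus`. -/
abbrev idToPlus (n : ℕ) : indefOId n →* indefOPlus n :=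
  Subgroup.inclusion indefOId_le_indefOPlus

/-- The centre of the ball. -/
def ballCenter (n : ℕ) : lieBall n := ⟨0, zero_mem_lieBall⟩

/-- `θ` is a Cartan involution of the Lie algebra whose fixed points are the Lie algebra of the
stabilizer of the point `w`. -/
def IsCartanAt (w : lieBall n) (θ : indefSo n ≃ₗ⁅ℝ⁆ indefSo n) : Prop :=
  (∀ X, θ (θ X) = X) ∧
  (∀ X : indefSo n, θ X = X ↔ ∀ t : ℝ, ∃ a : indefOId n,
    ((a : IGL n) : IMat n) = NormedSpace.exp (t • (X : IMat n)) ∧ idToPlus n a • w = w) ∧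
  (∀ X : indefSo n, θ X = X → X ≠ 0 → killingForm ℝ (indefSo n) X X < 0) ∧
  (∀ X : indefSo n, θ X = -X → X ≠ 0 → 0 < killingForm ℝ (indefSo n) X X)

theorem soConj_centralSymm (X : indefSo n) :
    soConj (centralSymm n) (mem_indefOPlus.1 centralSymm_mem).1 X = -soTranspose X :=
  Subtype.ext (etaMat_conj X.2)

theorem eq_zero_of_eq_neg {w : Cn n} (h : w = -w) : w = 0 := by
  ext k
  exact self_eq_neg.1 (congrArg (fun v : Cn n => v k) h)

theorem centralSymm_smul (w : lieBall n) :
    (((⟨centralSymm n, centralSymm_mem⟩ : indefOPlus n) • w : lieBall n) : Cn n) = -(w : Cn n) :=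
  ballMap_centralSymm _

/-- At the centre of the ball the Cartan involution is `X ↦ -Xᵀ`. -/
theorem isCartanAt_ballCenter [NeZero n] : IsCartanAt (ballCenter n)
    (soConj (centralSymm n) (mem_indefOPlus.1 centralSymm_mem).1) := by
  have ht (X : indefSo n) : soTranspose (soTranspose X) = X := rfl
  have hneg (X : indefSo n) : soTranspose (-X) = -soTranspose X := rfl
  refine ⟨fun X => ?_, fun X => ⟨fun hX t => ?_, fun h => ?_⟩, fun X hX h0 => ?_, fun X hX h0 => ?_⟩
  · rw [soConj_centralSymm, soConj_centralSymm, hneg, neg_neg, ht]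
  · obtain ⟨a, ha⟩ := (isLieAlgebraOf_indefSo (X : IMat n)).1 X.2 t
    refine ⟨a, ha, ?_⟩
    -- `exp(t X)` commutes with the central symmetry, of which the centre is the only fixed point.
    have h1 := exp_soConj (mem_indefOPlus.1 (centralSymm_mem (n := n))).1 t X
    rw [hX, ← ha] at h1
    have h2 : (⟨centralSymm n, centralSymm_mem⟩ : indefOPlus n) * idToPlus n a =
        idToPlus n a * ⟨centralSymm n, centralSymm_mem⟩ := by
      refine Subtype.ext (Units.ext ?_)
      change (centralSymm n : IMat n) * ((a : IGL n) : IMat n) =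
        ((a : IGL n) : IMat n) * (centralSymm n : IMat n)
      have h : (((centralSymm n)⁻¹ : IGL n) : IMat n) * (centralSymm n : IMat n) = 1 :=
        (centralSymm n).inv_mul
      conv_rhs => rw [h1]
      rw [Matrix.mul_assoc, h, Matrix.mul_one]
    have h3 := congrArg (fun A : indefOPlus n => ((A • ballCenter n : lieBall n) : Cn n)) h2
    simp only [mul_smul] at h3
    rw [centralSymm_smul] at h3
    have h4 : (⟨centralSymm n, centralSymm_mem⟩ : indefOPlus n) • ballCenter n = ballCenter n :=
      Subtype.ext ((centralSymm_smul _).trans neg_zero)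
    rw [h4] at h3
    exact Subtype.ext (eq_zero_of_eq_neg h3.symm)
  · have h1 (k : Fin n) (j : Fin 2) : (X : IMat n) (.inl k) (.inr j) = 0 := by
      -- Differentiate the vanishing upper right block of `exp(t X)` at `t = 0`.
      refine (hasDerivAt_exp_smul_apply (X : IMat n) (.inl k) (.inr j)).unique ?_
      refine (hasDerivAt_const (0 : ℝ) (0 : ℝ)).congr_of_eventuallyEq (.of_forall fun t => ?_)
      obtain ⟨a, ha, hfix⟩ := h t
      have h2 := apply_inl_inr_eq_zero (indefOId_le_indefOPlus a.2) (congrArg Subtype.val hfix) k j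
      rwa [ha] at h2
    have h2 (k : Fin n) (j : Fin 2) : (X : IMat n) (.inr j) (.inl k) = 0 := by
      have h3 := congrFun (congrFun (mem_indefSo.1 X.2) (.inl k)) (.inr j)
      rw [etaMat_eq, Matrix.mul_diagonal, Matrix.neg_apply, Matrix.diagonal_mul,
        Matrix.transpose_apply, h1] at h3
      simpa using h3
    refine Subtype.ext (Matrix.ext fun i j => ?_)
    change (etaMat n * (X : IMat n) * etaMat n) i j = (X : IMat n) i j
    rw [etaMat_eq, Matrix.mul_diagonal, Matrix.diagonal_mul]
    rcases i with i | i <;> rcases j with j | j <;> simp [h1, h2]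
  · have h1 : soTranspose X = -X := by
      rw [soConj_centralSymm] at hX
      exact neg_eq_iff_eq_neg.1 hX
    have := killingForm_soTranspose_pos h0
    rw [h1, map_neg] at this
    exact neg_pos.1 this
  · have h1 : soTranspose X = X := by
      rw [soConj_centralSymm] at hX
      exact neg_injective hX
    have := killingForm_soTranspose_pos h0
    rwa [h1] at this

/-- The Cartan involution at the centre is transported to the other points by the adjoint action. -/
theorem IsCartanAt.conj {w : lieBall n} {θ : indefSo n ≃ₗ⁅ℝ⁆ indefSo n} (h : IsCartanAt w θ)
    (a : indefOId n) : IsCartanAt (idToPlus n a • w)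
      (((soConj (a : IGL n) (indefOId_le a.2)).symm.trans θ).trans
        (soConj (a : IGL n) (indefOId_le a.2))) := by
  obtain ⟨h1, h2, h3, h4⟩ := h
  set e := soConj (a : IGL n) (indefOId_le a.2) with he
  have hfix (X : indefSo n) : (e.symm.trans θ).trans e X = X ↔ θ (e.symm X) = e.symm X := by
    change e (θ (e.symm X)) = X ↔ _
    exact ⟨fun h => (e.symm_apply_apply _).symm.trans (congrArg e.symm h),
      fun h => by rw [h, e.apply_symm_apply]⟩
  have hneg (X : indefSo n) : (e.symm.trans θ).trans e X = -X ↔ θ (e.symm X) = -e.symm X := by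
    change e (θ (e.symm X)) = -X ↔ _
    exact ⟨fun h => ((e.symm_apply_apply _).symm.trans (congrArg e.symm h)).trans (map_neg _ _),
      fun h => by rw [h, map_neg, e.apply_symm_apply]⟩
  have hkill (X : indefSo n) : killingForm ℝ (indefSo n) (e.symm X) (e.symm X) =
      killingForm ℝ (indefSo n) X X := LieAlgebra.killingForm_of_equiv_apply e.symm X X
  have hne (X : indefSo n) (hX : X ≠ 0) : e.symm X ≠ 0 := fun h0 => hX (by
    rw [← e.apply_symm_apply X, h0, map_zero])
  refine ⟨fun X => ?_, fun X => ?_, fun X hX h0 => ?_, fun X hX h0 => ?_⟩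
  · change e (θ (e.symm (e (θ (e.symm X))))) = X
    rw [e.symm_apply_apply, h1, e.apply_symm_apply]
  · rw [hfix, h2]
    have hX (t : ℝ) : NormedSpace.exp (t • (X : IMat n)) = ((a : IGL n) : IMat n) *
        NormedSpace.exp (t • (e.symm X : IMat n)) * (((a : IGL n)⁻¹ : IGL n) : IMat n) := by
      rw [← exp_soConj (indefOId_le a.2), ← he, e.apply_symm_apply]
    refine forall_congr' fun t => ⟨?_, ?_⟩
    · rintro ⟨b, hb, hbw⟩
      refine ⟨a * b * a⁻¹, ?_, ?_⟩
      · rw [hX, ← hb]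
        rfl
      · rw [map_mul, map_mul, map_inv, mul_smul, mul_smul, inv_smul_smul, hbw]
    · rintro ⟨b, hb, hbw⟩
      refine ⟨a⁻¹ * b * a, ?_, ?_⟩
      · rw [hX] at hb
        change (((a : IGL n)⁻¹ : IGL n) : IMat n) * ((b : IGL n) : IMat n) *
          ((a : IGL n) : IMat n) = _
        have h : (((a : IGL n)⁻¹ : IGL n) : IMat n) * ((a : IGL n) : IMat n) = 1 :=
          (a : IGL n).inv_mul
        rw [hb, ← Matrix.mul_assoc, ← Matrix.mul_assoc, h, Matrix.one_mul, Matrix.mul_assoc, h,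
          Matrix.mul_one]
      · rw [map_mul, map_mul, map_inv, mul_smul, mul_smul, hbw, inv_smul_smul]
  · rw [← hkill]
    exact h3 _ ((hfix X).1 hX) (hne X h0)
  · rw [← hkill]
    exact h4 _ ((hneg X).1 hX) (hne X h0)

theorem exists_smul_ballCenter_eq (w : lieBall n) :
    ∃ a : indefOId n, idToPlus n a • ballCenter n = w := by
  obtain ⟨A, hA, h⟩ := exists_ballMap_zero_eq w.2
  exact ⟨⟨A, hA⟩, Subtype.ext h⟩

theorem exists_isCartanAt [NeZero n] (w : lieBall n) : ∃ θ, IsCartanAt w θ := by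
  obtain ⟨a, rfl⟩ := exists_smul_ballCenter_eq w
  exact ⟨_, isCartanAt_ballCenter.conj a⟩

end Exponential

/-! ### Symmetric structure of the ball and of the components -/

section Symmetric

/-- The symmetry of the Lie ball at a point is conjugate to `w ↦ -w`. -/
theorem exists_symmetry {n : ℕ} (w : lieBall n) :
    ∃ σ : indefOPlus n, σ * σ = 1 ∧ ∀ w' : lieBall n, σ • w' = w' ↔ w' = w := by
  obtain ⟨a, rfl⟩ := exists_smul_ballCenter_eq w
  set b := idToPlus n a
  set c : indefOPlus n := ⟨centralSymm n, centralSymm_mem⟩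
  have hc : c * c = 1 := Subtype.ext (Units.ext etaMat_mul_self)
  have hfix (w' : lieBall n) : c • w' = w' ↔ w' = ballCenter n := by
    rw [Subtype.ext_iff, Subtype.ext_iff, centralSymm_smul]
    refine ⟨fun h => eq_zero_of_eq_neg h.symm, fun h => ?_⟩
    rw [h]
    exact neg_zero
  refine ⟨b * c * b⁻¹, ?_, fun w' => ?_⟩
  · calc b * c * b⁻¹ * (b * c * b⁻¹) = b * (c * c) * b⁻¹ := by group
      _ = 1 := by rw [hc]; group
  · rw [mul_smul, mul_smul, smul_eq_iff_eq_inv_smul, hfix, inv_smul_eq_iff]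

theorem isBoundedSymmetricDomain_lieBall {n : ℕ} : IsBoundedSymmetricDomain (lieBall n) where
  isOpen := isOpen_lieBall
  isConnected := isConnected_lieBall
  isBounded := isBounded_lieBall
  symmetry p hp := by
    obtain ⟨σ, hσ, hfix⟩ := exists_symmetry ⟨p, hp⟩
    refine ⟨ballMap ((σ : IGL n) : IMat n), fun w hw => ballMap_mem σ.2 hw,
      fun w hw => (differentiableAt_ballMap σ.2 hw).differentiableWithinAt, fun w hw => ?_, ?_, ?_⟩
    · have h : σ • σ • (⟨w, hw⟩ : lieBall n) = ⟨w, hw⟩ := by rw [← mul_smul, hσ, one_smul]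
      exact congrArg Subtype.val h
    · exact congrArg Subtype.val ((hfix ⟨p, hp⟩).2 rfl)
    · filter_upwards [nhdsWithin_le_nhds (isOpen_lieBall.mem_nhds hp), self_mem_nhdsWithin]
        with q hq hqp h
      exact hqp (congrArg Subtype.val ((hfix ⟨q, hq⟩).1 (Subtype.ext h)))

namespace AdaptedBasis

variable {s : ℕ} {S₀ : Matrix (Fin s) (Fin s) ℝ} (β : AdaptedBasis S₀)
  {z₀ : OrientedNegPlane S₀}

theorem componentAction_eq_iff (hS₀ : S₀.PosDef) (h : connectedComponent z₀ = β.posHalf)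
    (A : indefOPlus (s + 2)) (z z' : DComponent z₀) :
    β.componentAction hS₀ h A z = z' ↔ A • β.homeo hS₀ h z = β.homeo hS₀ h z' := by
  rw [componentAction_apply, ← (β.homeo hS₀ h).injective.eq_iff, Homeomorph.apply_symm_apply]

theorem isHermitianSymmetricSpace (hS₀ : S₀.PosDef) (h : connectedComponent z₀ = β.posHalf) :
    letI := β.chartedSpace hS₀ h
    haveI := β.isManifold hS₀ h
    IsHermitianSymmetricSpace (β.hermitianMetric hS₀ h) := by
  let _ := β.chartedSpace hS₀ h
  have := β.isManifold hS₀ h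
  have hφ := (β.isOpenEmbedding_chart hS₀ h).isEmbedding
  refine ⟨hφ.t2Space, hφ.secondCountableTopology,
    isConnected_iff_connectedSpace.1 isConnected_connectedComponent, fun p => ?_⟩
  obtain ⟨σ, hσ, hfix⟩ := exists_symmetry (β.homeo hS₀ h p)
  refine ⟨β.componentAction hS₀ h σ, β.isHolomorphicIsometry_componentAction hS₀ h σ, fun q => ?_,
    ?_, ?_⟩
  · rw [← Equiv.Perm.mul_apply, ← map_mul, hσ, map_one, Equiv.Perm.one_apply]
  · rw [componentAction_eq_iff, hfix]
  · filter_upwards [self_mem_nhdsWithin] with q hq h1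
    rw [componentAction_eq_iff, hfix] at h1
    exact hq ((β.homeo hS₀ h).injective h1)

/-- Only `1` and `-1` can act trivially on a component. -/
theorem finite_ker (hS₀ : S₀.PosDef) (h : connectedComponent z₀ = β.posHalf) :
    Finite ((β.componentAction hS₀ h).comp (idToPlus (s + 2))).ker := by
  have hmem (a : ((β.componentAction hS₀ h).comp (idToPlus (s + 2))).ker) :
      (((a : indefOId (s + 2)) : IGL (s + 2)) : IMat (s + 2)) ∈ ({1, -1} : Set (IMat (s + 2))) := by
    refine eq_one_or_neg_one_of_ballMap_eq (indefOId_le_indefOPlus a.1.2) fun w hw => ?_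
    obtain ⟨z, rfl⟩ := β.exists_chart_eq hS₀ h hw
    have h1 := DFunLike.congr_fun (MonoidHom.mem_ker.1 a.2) z
    have h2 := β.chart_componentAction hS₀ h (idToPlus (s + 2) a) z
    rw [MonoidHom.comp_apply, Equiv.Perm.one_apply] at h1
    rw [h1] at h2
    exact h2.symm
  have hfin : Finite ({1, -1} : Set (IMat (s + 2))) := Set.toFinite _
  refine Finite.of_injective (fun a => (⟨_, hmem a⟩ : ({1, -1} : Set (IMat (s + 2)))))
    fun a b hab => ?_
  exact Subtype.ext (Subtype.ext (Units.ext (congrArg Subtype.val hab)))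

theorem isOfNoncompactType (hS₀ : S₀.PosDef) (h : connectedComponent z₀ = β.posHalf) :
    letI := β.chartedSpace hS₀ h
    haveI := β.isManifold hS₀ h
    IsOfNoncompactType (β.hermitianMetric hS₀ h) := by
  let _ := β.chartedSpace hS₀ h
  have := β.isManifold hS₀ h
  refine ⟨Fin (s + 2) ⊕ Fin 2, inferInstance, inferInstance, indefOId (s + 2), indefSo (s + 2),
    (β.componentAction hS₀ h).comp (idToPlus (s + 2)), isClosed_indefOId, isConnected_indefOId,
    isLieAlgebraOf_indefSo, isSemisimple_indefSo, ?_,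
    fun a => β.isHolomorphicIsometry_componentAction hS₀ h _, fun x y => ?_, β.finite_ker hS₀ h,
    fun o => ?_⟩
  · have h1 : Continuous (idToPlus (s + 2)) := continuous_subtype_val.subtype_mk _
    have h2 : Continuous fun p : indefOId (s + 2) × DComponent z₀ =>
        (idToPlus (s + 2) p.1, p.2) := (h1.comp continuous_fst).prodMk continuous_snd
    exact Continuous.comp (g := fun p : indefOPlus (s + 2) × DComponent z₀ =>
      β.componentAction hS₀ h p.1 p.2) (β.continuous_componentAction hS₀ h) h2
  · obtain ⟨a, ha⟩ := exists_smul_ballCenter_eq (β.homeo hS₀ h x)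
    obtain ⟨b, hb⟩ := exists_smul_ballCenter_eq (β.homeo hS₀ h y)
    refine ⟨b * a⁻¹, ?_⟩
    rw [MonoidHom.comp_apply, componentAction_eq_iff, ← ha, ← hb, map_mul, map_inv, mul_smul,
      inv_smul_smul]
  · obtain ⟨θ, h1, h2, h3, h4⟩ := exists_isCartanAt (β.homeo hS₀ h o)
    refine ⟨θ, h1, fun X => ?_, h3, h4⟩
    simp only [MonoidHom.comp_apply, componentAction_eq_iff]
    exact h2 X

theorem isBiholomorphicTo_lieBall (hS₀ : S₀.PosDef) (h : connectedComponent z₀ = β.posHalf) :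
    letI := β.chartedSpace hS₀ h
    IsBiholomorphicTo (DComponent z₀) (lieBall (s + 2)) := by
  let _ := β.chartedSpace hS₀ h
  have hne : Nonempty (DComponent z₀) := ⟨⟨z₀, mem_connectedComponent⟩⟩
  have hφ := β.isOpenEmbedding_chart hS₀ h
  have hinv := Function.leftInverse_invFun hφ.injective
  refine ⟨β.chart z₀, Function.invFun (β.chart z₀), fun z => ?_, ?_, β.chart_mem hS₀ h, hinv,
    fun w hw => Function.invFun_eq (β.exists_chart_eq hS₀ h hw)⟩
  · exact (hasMFDerivAt_vector hφ (f₀ := id) (fun _ => rfl) (hasFDerivAt_id _)).mdifferentiableAt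
  · rw [← β.range_chart hS₀ h]
    exact mdifferentiableOn_chart_symm hφ hinv

end AdaptedBasis

end Symmetric

end

theorem mainTheorem3 (s : ℕ) (S₀ : Matrix (Fin s) (Fin s) ℝ) (hS₀ : S₀.PosDef) :
    Nonempty (OrientedNegPlane S₀) ∧
    (∀ z₀ : OrientedNegPlane S₀,
      IsOpen (connectedComponent z₀) ∧ IsOpen (connectedComponent z₀.opposite) ∧
      Disjoint (connectedComponent z₀) (connectedComponent z₀.opposite) ∧
      connectedComponent z₀ ∪ connectedComponent z₀.opposite = Set.univ) ∧
    ∀ z₀ : OrientedNegPlane S₀,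
      ∃ (_ : ChartedSpace (Cn (s + 2)) (DComponent z₀))
        (_ : IsManifold 𝓘(ℂ, Cn (s + 2)) ω (DComponent z₀))
        (g : HermitianMetric (s + 2) (DComponent z₀)),
        IsCanonicalStructure hS₀ g ∧
        IsHermitianSymmetricSpace g ∧
        IsOfNoncompactType g ∧
        ∃ U : Set (Cn (s + 2)), IsBoundedSymmetricDomain U ∧ IsBiholomorphicTo (DComponent z₀) U := by
  refine ⟨nonempty_orientedNegPlane hS₀, components_orientedNegPlane hS₀, fun z₀ => ?_⟩
  obtain ⟨β, hβ⟩ := exists_adaptedBasis hS₀ z₀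
  have hz : z₀ ∈ β.posHalf := by
    rw [← hβ, β.toPlane_frame]
    exact β.ofCoord_mem hS₀ _
  have h := β.connectedComponent_eq_posHalf hS₀ hz
  exact ⟨β.chartedSpace hS₀ h, β.isManifold hS₀ h, β.hermitianMetric hS₀ h,
    β.isCanonicalStructure hS₀ h, β.isHermitianSymmetricSpace hS₀ h, β.isOfNoncompactType hS₀ h,
    lieBall (s + 2), isBoundedSymmetricDomain_lieBall, β.isBiholomorphicTo_lieBall hS₀ h⟩
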